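/- Let $m\ge 0$, let $M$ be the space of real symmetric $m\times m$ matrices with Lebesgue measure $dA=\prod_{i\ge j}da_{ij}$, let $\Xi=M\times\mathbb R^m\times\mathbb R$ with measure $d\xi=dA\,db\,dc$, and let $\mathrm{Aff}(m)=\mathbb R^m\rtimes GL(m)$ be the affine group, acting on $\mathbb R^m$ by $(t,L)\cdot x=t+Lx$ and on $\Xi$ by $$(t,L)\cdot(A,b,c)=\bigl(L^{-\top}AL^{-1},\ L^{-\top}b-2L^{-\top}AL^{-1}t,\ c+t^\top L^{-\top}AL^{-1}t-t^\top L^{-\top}b\bigr)$$ (these are group actions). For $\sigma:\mathbb R\to\mathbb C$ put $\phi_\sigma(x,(A,b,c))=\sigma(x^\top Ax+x^\top b+c)$, and for $\gamma:\Xi\to\mathbb C$, $\psi:\mathbb R^m\times\Xi\to\mathbb C$, $f:\mathbb R^m\to\mathbb C$ put $$\mathrm{QNN}_\sigma[\gamma](x)=\int_\Xi\gamma(\xi)\,\phi_\sigma(x,\xi)\,d\xi,\qquad R_\psi[f](\xi)=\int_{\mathbb R^m}f(x)\,\overline{\psi(x,\xi)}\,dx .$$ Let $\pi$ be the regular representation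 of $\mathrm{Aff}(m)$ on $L^2(\mathbb R^m)$, $\pi_{(t,L)}[f](x)=|\det L|^{-1/2}f(L^{-1}(x-t))$, which acts by unitary operators. 1. (Joint invariance.) For every function $\sigma$, $\phi_\sigma(g\cdot x,g\cdot\xi)=\phi_\sigma(x,\xi)$ for all $g\in\mathrm{Aff}(m)$, $x\in\mathbb R^m$, $\xi\in\Xi$. 2. (Irreducibility.) $\pi$ is irreducible: $L^2(\mathbb R^m)\neq 0$, and its only closed $\pi$-invariant subspaces are $0$ and $L^2(\mathbb R^m)$. 3. (Reconstruction formula.) Let $s\in\mathbb R$ and let $D\subseteq L^2(\mathbb R^m)$ be a dense $\pi$-invariant subspace (for example $D=L^2(\mathbb R^m)$). Consider functions $\psi$ with $\psi(g\cdot x,g\cdot\xi)=|\det L|^s\psi(x,\xi)$ for all $g=(t,L)$, $x$, $\xi$ (for $s=0$ this says that $\psi$ is joint-$\mathrm{Aff}(m)$-invariant). Call a pair $(\sigma,\psi)$ of a function $\sigma:\mathbb R\to\mathbb C$ and such a $\psi$ admissible if for every $f\in D$ the integrals defining $R_\psi[f](\xi)$ and $\mathrm{QNN}_\sigma[R_\psi[f]](x)$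 converge absolutely for a.e. $\xi$ and a.e. $x$, and $\mathrm{QNN}_\sigma\circ R_\psi$ maps $D$ into $L^2(\mathbb R^m)$ and is bounded on $D$ in the $L^2$-norm. Then there are constants $\langle\!\langle\sigma,\psi\rangle\!\rangle\in\mathbb C$ such that for every admissible $(\sigma,\psi)$ and every $f\in D$, $$\mathrm{QNN}_\sigma[R_\psi[f]]=\langle\!\langle\sigma,\psi\rangle\!\rangle f\quad\text{a.e.},$$ and $\langle\!\langle\sigma,\psi\rangle\!\rangle$ is linear in $\sigma$ and conjugate-linear in $\psi$ on admissible pairs. 4. (Right inverse and universality.) Suppose that $\sigma$ is a tempered function, i.e. $\int_{\mathbb R}|\sigma(t)|(1+|t|)^{-k}\,dt<\infty$ for some $k\in\mathbb N$ (with $\sigma$ a.e. measurable), and that $\sigma$ is not almost everywhere equal to a polynomial. Then: (a) there are a continuous compactly supported $\eta:M\to\mathbb R$ and a Schwartz function $\rho:\mathbb R\to\mathbb C$ such that, with $\psi(x,(A,b,c))=\eta(A)\,\rho(x^\top Ax+x^\top b+c)$, for every Schwartz function $f:\mathbb R^m\to\mathbb C$ the integrals defining $R_\psi[f](\xi)$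 and $\mathrm{QNN}_\sigma[R_\psi[f]](x)$ converge absolutely for all $\xi\in\Xi$ and all $x\in\mathbb R^m$, $R_\psi[f]\in L^2(\Xi)$, and $\mathrm{QNN}_\sigma[R_\psi[f]](x)=f(x)$ for all $x\in\mathbb R^m$; (b) $\mathrm{QNN}_\sigma$ is $L^2(\mathbb R^m)$-universal: for every $f\in L^2(\mathbb R^m)$ and $\varepsilon>0$ there is $\gamma\in L^2(\Xi)$ such that the integral defining $\mathrm{QNN}_\sigma[\gamma](x)$ converges absolutely for every $x$, $\mathrm{QNN}_\sigma[\gamma]\in L^2(\mathbb R^m)$ and $\|\mathrm{QNN}_\sigma[\gamma]-f\|_{L^2(\mathbb R^m)}<\varepsilon$. -/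

import Mathlib

open MeasureTheory Matrix
open scoped ENNReal ComplexConjugate SchwartzMap

noncomputable section

/-! ### Joint-equivariant machines and ridgelet transforms -/

/-- Joint-`G`-invariance of a feature map: `φ (g • x) (g • ξ) = φ x ξ`. -/
def IsJointInvariant (G : Type*) {X Ξ Y : Type*} [SMul G X] [SMul G Ξ] (φ : X → Ξ → Y) : Prop :=
  ∀ (g : G) (x : X) (ξ : Ξ), φ (g • x) (g • ξ) = φ x ξ

/-- The machine `LM[γ; φ](x) = ∫ γ(ξ) φ(x, ξ) dξ`. -/
def machine {X Ξ : Type*} [MeasureSpace Ξ] (φ : X → Ξ → ℂ) (γ : Ξ → ℂ) (x : X) : ℂ :=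
  ∫ ξ, γ ξ * φ x ξ

/-- The ridgelet transform `R[f; ψ](ξ) = ∫ f(x) conj (ψ(x, ξ)) dx`. -/
def ridgelet {X Ξ : Type*} [MeasureSpace X] (ψ : X → Ξ → ℂ) (f : X → ℂ) (ξ : Ξ) : ℂ :=
  ∫ x, f x * conj (ψ x ξ)

/-- The composite operator `LM_φ ∘ R_ψ` is defined on the subspace `D` of `L²(X)` by absolutely
convergent integrals, takes values in `L²(X)`, and is bounded there for the `L²`-norm. -/
structure IsBoundedOn {X Ξ : Type*} [MeasureSpace X] [MeasureSpace Ξ] (φ ψ : X → Ξ → ℂ)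
    (D : Submodule ℂ (Lp ℂ 2 (volume : Measure X))) : Prop where
  ridgelet_integrable : ∀ f ∈ D, ∀ᵐ ξ : Ξ, Integrable fun x : X => f x * conj (ψ x ξ)
  machine_integrable : ∀ f ∈ D, ∀ᵐ x : X, Integrable fun ξ : Ξ => ridgelet ψ f ξ * φ x ξ
  memLp : ∀ f ∈ D, MemLp (machine φ (ridgelet ψ f)) 2 (volume : Measure X)
  bounded : ∃ C : NNReal, ∀ f ∈ D,
    eLpNorm (machine φ (ridgelet ψ f)) 2 (volume : Measure X) ≤ C * eLpNorm f 2 volume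

/-- The subspace `D` is mapped into itself by the group representation `π`. -/
def IsInvariantSubspace {G H : Type*} [Group G] [NormedAddCommGroup H] [InnerProductSpace ℂ H]
    (π : G →* (H ≃ₗᵢ[ℂ] H)) (D : Submodule ℂ H) : Prop :=
  ∀ g : G, ∀ f ∈ D, π g f ∈ D

/-- Irreducibility of a representation by unitary operators on a nonzero Hilbert space: the only
closed invariant subspaces are the trivial ones. -/
def IsIrreducibleRep {G H : Type*} [Group G] [NormedAddCommGroup H] [InnerProductSpace ℂ H]
    (π : G →* (H ≃ₗᵢ[ℂ] H)) : Prop :=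
  Nontrivial H ∧ ∀ K : Submodule ℂ H, IsClosed (K : Set H) → IsInvariantSubspace π K →
    K = ⊥ ∨ K = ⊤

/-! ### The affine group and its regular representation -/

/-- The data domain `ℝ^m`. -/
abbrev DataDom (m : ℕ) : Type := EuclideanSpace ℝ (Fin m)

/-- The action of `GL(m)` on the additive group `ℝ^m` by `t ↦ L t`. -/
def glAut (m : ℕ) : GL (Fin m) ℝ →* MulAut (Multiplicative (DataDom m)) where
  toFun L :=
    { toFun := fun v => .ofAdd (WithLp.toLp 2 (L.val *ᵥ v.toAdd.ofLp))
      invFun := fun v => .ofAdd (WithLp.toLp 2 (L⁻¹.val *ᵥ v.toAdd.ofLp))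
      left_inv := fun v => by simp
      right_inv := fun v => by simp
      map_mul' := fun v w => by simp [Matrix.mulVec_add] }
  map_one' := by ext v; simp
  map_mul' L L' := by ext v; simp

/-- The affine group `Aff(m) = ℝ^m ⋊ GL(m)`. -/
abbrev AffGroup (m : ℕ) : Type := Multiplicative (DataDom m) ⋊[glAut m] GL (Fin m) ℝ

namespace AffGroup

variable {m : ℕ}

/-- The translation part `t` of `g = (t, L)`. -/
def t (g : AffGroup m) : Fin m → ℝ := g.left.toAdd.ofLp

/-- The linear part `L` of `g = (t, L)`. -/
def L (g : AffGroup m) : Matrix (Fin m) (Fin m) ℝ := g.right.val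

/-- The inverse `L⁻¹` of the linear part of `g = (t, L)`. -/
def Linv (g : AffGroup m) : Matrix (Fin m) (Fin m) ℝ := g.right⁻¹.val

@[simp] lemma t_one : (1 : AffGroup m).t = 0 := rfl
@[simp] lemma L_one : (1 : AffGroup m).L = 1 := rfl
@[simp] lemma Linv_one : (1 : AffGroup m).Linv = 1 := by simp [Linv]
lemma t_mul (g h : AffGroup m) : (g * h).t = g.t + g.L *ᵥ h.t := rfl
lemma L_mul (g h : AffGroup m) : (g * h).L = g.L * h.L := rfl
lemma Linv_mul (g h : AffGroup m) : (g * h).Linv = h.Linv * g.Linv := by simp [Linv]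
@[simp] lemma L_mul_Linv (g : AffGroup m) : g.L * g.Linv = 1 := by simp [L, Linv]
@[simp] lemma Linv_mul_L (g : AffGroup m) : g.Linv * g.L = 1 := by simp [L, Linv]
lemma det_L_ne_zero (g : AffGroup m) : g.L.det ≠ 0 := by
  have h := congrArg Matrix.det g.L_mul_Linv
  rw [Matrix.det_mul, Matrix.det_one] at h
  exact left_ne_zero_of_mul_eq_one h

/-- `(t, L) · x = t + L x`. -/
instance : MulAction (AffGroup m) (DataDom m) where
  smul g x := WithLp.toLp 2 (g.t + g.L *ᵥ x.ofLp)
  one_smul x := by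
    change WithLp.toLp 2 ((1 : AffGroup m).t + (1 : AffGroup m).L *ᵥ x.ofLp) = x
    simp
  mul_smul g h x := by
    change WithLp.toLp 2 ((g * h).t + (g * h).L *ᵥ x.ofLp)
      = WithLp.toLp 2 (g.t + g.L *ᵥ (h.t + h.L *ᵥ x.ofLp))
    rw [t_mul, L_mul, Matrix.mulVec_add, Matrix.mulVec_mulVec, add_assoc]

lemma smul_def (g : AffGroup m) (x : DataDom m) :
    g • x = WithLp.toLp 2 (g.t + g.L *ᵥ x.ofLp) := rfl

lemma map_smul_volume (g : AffGroup m) :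
    Measure.map (fun x : DataDom m => g • x) volume
      = ENNReal.ofReal |g.L.det|⁻¹ • (volume : Measure (DataDom m)) := by
  set T : DataDom m →ₗ[ℝ] DataDom m := Matrix.toEuclideanLin g.L with hT
  have hdet : LinearMap.det T = g.L.det := by
    rw [hT, Matrix.toEuclideanLin, Matrix.toLpLin_eq_toLin]
    exact LinearMap.det_toLin _ _
  have hf : (fun x : DataDom m => g • x) = (fun x => WithLp.toLp 2 g.t + x) ∘ T := by
    funext x
    rfl
  rw [hf, ← Measure.map_map (by fun_prop) T.continuous_of_finiteDimensional.measurable,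
    Measure.map_linearMap_addHaar_eq_smul_addHaar _ (by rw [hdet]; exact g.det_L_ne_zero),
    Measure.map_smul, map_add_left_eq_self, hdet, abs_inv]

lemma measurable_smul (g : AffGroup m) : Measurable (fun x : DataDom m => g • x) := by
  have : Continuous (fun x : DataDom m => g • x) := by
    change Continuous (fun x : DataDom m => WithLp.toLp 2 g.t + Matrix.toEuclideanLin g.L x)
    exact continuous_const.add (LinearMap.continuous_of_finiteDimensional _)
  exact this.measurable

lemma quasiMeasurePreserving_smul (g : AffGroup m) :
    Measure.QuasiMeasurePreserving (fun x : DataDom m => g • x) volume volume :=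
  ⟨g.measurable_smul, by
    rw [map_smul_volume]
    exact Measure.smul_absolutelyContinuous⟩

lemma det_L_inv (g : AffGroup m) : (g⁻¹).L.det = (g.L.det)⁻¹ := by
  have h : (g⁻¹).L * g.L = 1 := by rw [← L_mul, inv_mul_cancel, L_one]
  have h := congrArg Matrix.det h
  rw [Matrix.det_mul, Matrix.det_one] at h
  exact eq_inv_of_mul_eq_one_left h

/-- The function `x ↦ |det L|^(-1/2) f(g⁻¹ · x)`, where `g⁻¹ · x = L⁻¹ (x - t)`. -/
def pull (g : AffGroup m) (f : DataDom m → ℂ) (x : DataDom m) : ℂ :=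
  ((|g.L.det| ^ (-(1 / 2) : ℝ) : ℝ) : ℂ) * f (g⁻¹ • x)

lemma eLpNorm_pull (g : AffGroup m) {f : DataDom m → ℂ} (hf : AEStronglyMeasurable f volume) :
    eLpNorm (g.pull f) 2 volume = eLpNorm f 2 volume := by
  have hpos : 0 < |g.L.det| := abs_pos.mpr g.det_L_ne_zero
  have h1 : g.pull f
      = (((|g.L.det| ^ (-(1 / 2) : ℝ) : ℝ) : ℂ)) • (f ∘ fun x => g⁻¹ • x) := rfl
  rw [h1, eLpNorm_const_smul, ← eLpNorm_map_measure
    (hf.mono_ac (g⁻¹).quasiMeasurePreserving_smul.absolutelyContinuous)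
    (g⁻¹).measurable_smul.aemeasurable, map_smul_volume, det_L_inv, abs_inv, inv_inv,
    eLpNorm_smul_measure_of_ne_top (by simp), smul_eq_mul, ← mul_assoc]
  have h2 : ‖((|g.L.det| ^ (-(1 / 2) : ℝ) : ℝ) : ℂ)‖ₑ
      = ENNReal.ofReal (|g.L.det| ^ (-(1 / 2) : ℝ)) := by
    rw [← ofReal_norm, Complex.norm_real, Real.norm_of_nonneg (by positivity)]
  have h3 : ((1 : ℝ≥0∞) / 2).toReal = 1 / 2 := by simp
  rw [h2, h3, ENNReal.ofReal_rpow_of_pos hpos,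
    ← ENNReal.ofReal_mul (by positivity), ← Real.rpow_add hpos]
  norm_num

lemma memLp_pull (g : AffGroup m) {f : DataDom m → ℂ} (hf : MemLp f 2 volume) :
    MemLp (g.pull f) 2 volume :=
  ⟨(hf.1.comp_quasiMeasurePreserving (g⁻¹).quasiMeasurePreserving_smul).const_mul _, by
    rw [eLpNorm_pull g hf.1]; exact hf.2⟩

lemma pull_congr (g : AffGroup m) {f f' : DataDom m → ℂ} (h : f =ᵐ[volume] f') :
    g.pull f =ᵐ[volume] g.pull f' := by
  filter_upwards [(g⁻¹).quasiMeasurePreserving_smul.ae_eq_comp h] with x hx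
  simp only [pull]
  rw [show f (g⁻¹ • x) = f' (g⁻¹ • x) from hx]

lemma pull_mul (g h : AffGroup m) (f : DataDom m → ℂ) : (g * h).pull f = g.pull (h.pull f) := by
  funext x
  simp only [pull, L_mul, Matrix.det_mul, abs_mul, _root_.mul_inv_rev,
    SemigroupAction.mul_smul]
  rw [Real.mul_rpow (abs_nonneg _) (abs_nonneg _)]
  push_cast
  ring

lemma pull_one (f : DataDom m → ℂ) : (1 : AffGroup m).pull f = f := by
  funext x
  simp [pull]

end AffGroup

/-- The Hilbert space `L²(ℝ^m)`. -/
abbrev L2Space (m : ℕ) : Type := Lp ℂ 2 (volume : Measure (DataDom m))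

/-- The operator `π_g` on `L²(ℝ^m)`. -/
def regularOp {m : ℕ} (g : AffGroup m) : L2Space m →ₗᵢ[ℂ] L2Space m where
  toFun f := MemLp.toLp (g.pull f) (g.memLp_pull (Lp.memLp f))
  map_add' f f' := by
    rw [← MemLp.toLp_add]
    refine MemLp.toLp_congr _ _ ((g.pull_congr (Lp.coeFn_add f f')).trans (.of_forall fun x => ?_))
    simp only [AffGroup.pull, Pi.add_apply, mul_add]
  map_smul' c f := by
    rw [RingHom.id_apply, ← MemLp.toLp_const_smul c (g.memLp_pull (Lp.memLp f))]
    refine MemLp.toLp_congr _ _ ((g.pull_congr (Lp.coeFn_smul c f)).trans (.of_forall fun x => ?_))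
    simp only [AffGroup.pull, Pi.smul_apply, smul_eq_mul]
    ring
  norm_map' f := by
    change ‖MemLp.toLp (g.pull f) (g.memLp_pull (Lp.memLp f))‖ = ‖f‖
    rw [Lp.norm_toLp,
      AffGroup.eLpNorm_pull g (Lp.aestronglyMeasurable f), Lp.norm_def]

lemma coeFn_regularOp {m : ℕ} (g : AffGroup m) (f : L2Space m) :
    regularOp g f =ᵐ[volume] g.pull f :=
  MemLp.coeFn_toLp (g.memLp_pull (Lp.memLp f))

lemma regularOp_one {m : ℕ} (f : L2Space m) : regularOp (1 : AffGroup m) f = f :=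
  Lp.ext ((coeFn_regularOp 1 f).trans (by rw [AffGroup.pull_one]))

lemma regularOp_mul {m : ℕ} (g h : AffGroup m) (f : L2Space m) :
    regularOp (g * h) f = regularOp g (regularOp h f) := by
  refine Lp.ext ((coeFn_regularOp _ f).trans ?_)
  rw [AffGroup.pull_mul]
  exact ((coeFn_regularOp g _).trans (g.pull_congr (coeFn_regularOp h f))).symm

/-- The regular representation `π_g[f](x) = |det L|^(-1/2) f(g⁻¹ · x)` of `Aff(m)` on `L²(ℝ^m)`,
by unitary operators. -/
def regularRep (m : ℕ) : AffGroup m →* (L2Space m ≃ₗᵢ[ℂ] L2Space m) where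
  toFun g :=
    { toLinearEquiv := LinearEquiv.ofLinearMap (regularOp g).toLinearMap (regularOp g⁻¹).toLinearMap
        (by ext1 f; simp [← regularOp_mul, regularOp_one])
        (by ext1 f; simp [← regularOp_mul, regularOp_one])
      norm_map' := (regularOp g).norm_map }
  map_one' := by ext1 f; exact regularOp_one f
  map_mul' g h := by ext1 f; exact regularOp_mul g h f

lemma coeFn_regularRep {m : ℕ} (g : AffGroup m) (f : L2Space m) :
    regularRep m g f =ᵐ[volume] g.pull f :=
  coeFn_regularOp g f

/-! ### The quadratic-form network -/

/-- The space `M` of real symmetric `m × m` matrices. -/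
abbrev SymMat (m : ℕ) : Type := {A : Matrix (Fin m) (Fin m) ℝ // A.IsSymm}

/-- Index pairs `(i, j)` with `i ≥ j`. -/
abbrev LowerIdx (m : ℕ) : Type := {p : Fin m × Fin m // p.2 ≤ p.1}

/-- A symmetric matrix is given by its entries `a_ij`, `i ≥ j`. -/
def symHomeo (m : ℕ) : (LowerIdx m → ℝ) ≃ₜ SymMat m where
  toFun a := ⟨Matrix.of fun i j => a ⟨(max i j, min i j), min_le_max⟩, by
    ext i j
    simp [Matrix.transpose_apply, max_comm, min_comm]⟩
  invFun A p := A.1 p.1.1 p.1.2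
  left_inv a := by
    funext p
    obtain ⟨⟨i, j⟩, h⟩ := p
    simp only [Matrix.of_apply]
    congr 2
    simp only [Prod.mk.injEq]
    exact ⟨max_eq_left h, min_eq_right h⟩
  right_inv A := by
    ext i j
    rcases le_total i j with h | h
    · simp only [Matrix.of_apply, max_eq_right h, min_eq_left h]
      exact A.2.apply i j
    · simp only [Matrix.of_apply, max_eq_left h, min_eq_right h]
  continuous_toFun := by
    refine Continuous.subtype_mk (continuous_matrix fun i j => ?_) _
    exact continuous_apply _
  continuous_invFun := by
    refine continuous_pi fun p => ?_
    exact continuous_subtype_val.matrix_elem _ _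

/-- Lebesgue measure `dA = ⋀_{i ≥ j} da_ij` on the symmetric matrices. -/
instance (m : ℕ) : MeasureSpace (SymMat m) where
  toMeasurableSpace := borel _
  volume := @Measure.map _ _ _ (borel _) (symHomeo m) volume

instance (m : ℕ) : BorelSpace (SymMat m) := ⟨rfl⟩

lemma measurePreserving_symHomeo (m : ℕ) : MeasurePreserving (symHomeo m) :=
  ⟨(symHomeo m).continuous.measurable, rfl⟩

instance (m : ℕ) : SigmaFinite (volume : Measure (SymMat m)) := by
  have h : (volume : Measure (SymMat m)) = Measure.map (symHomeo m).toMeasurableEquiv volume := rfl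
  rw [h]
  exact MeasurableEquiv.sigmaFinite_map _

/-- The parameter domain `Ξ = M × ℝ^m × ℝ` of triples `(A, b, c)`, with the product measure
`dA db dc`. -/
abbrev QuadParam (m : ℕ) : Type := SymMat m × DataDom m × ℝ

/-- The quadratic polynomial `xᵀ A x + xᵀ b + c`. -/
def quadForm {m : ℕ} (x : DataDom m) (ξ : QuadParam m) : ℝ :=
  x.ofLp ⬝ᵥ (ξ.1.1 *ᵥ x.ofLp) + x.ofLp ⬝ᵥ ξ.2.1.ofLp + ξ.2.2

/-- The feature map `φ(x, (A, b, c)) = σ(xᵀ A x + xᵀ b + c)`. -/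
def quadFeature {Y : Type*} (m : ℕ) (σ : ℝ → Y) (x : DataDom m) (ξ : QuadParam m) : Y :=
  σ (quadForm x ξ)

/-- The quadratic-form network
`QNN[γ](x) = ∫ γ(A, b, c) σ(xᵀ A x + xᵀ b + c) dA db dc`. -/
def QNN {m : ℕ} (σ : ℝ → ℂ) (γ : QuadParam m → ℂ) (x : DataDom m) : ℂ :=
  machine (quadFeature m σ) γ x

/-- `(t, L) · (A, b, c) = (L⁻ᵀ A L⁻¹, L⁻ᵀ b - 2 L⁻ᵀ A L⁻¹ t, c + tᵀ L⁻ᵀ A L⁻¹ t - tᵀ L⁻ᵀ b)`. -/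
def quadAct {m : ℕ} (g : AffGroup m) (ξ : QuadParam m) : QuadParam m :=
  (⟨g.Linvᵀ * ξ.1.1 * g.Linv, by
      simp [Matrix.IsSymm, Matrix.transpose_mul, ξ.1.2.eq, Matrix.mul_assoc]⟩,
    WithLp.toLp 2 (g.Linvᵀ *ᵥ ξ.2.1.ofLp - (2 : ℝ) • ((g.Linvᵀ * ξ.1.1 * g.Linv) *ᵥ g.t)),
    ξ.2.2 + g.t ⬝ᵥ ((g.Linvᵀ * ξ.1.1 * g.Linv) *ᵥ g.t) - g.t ⬝ᵥ (g.Linvᵀ *ᵥ ξ.2.1.ofLp))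

lemma smul_aux_mulVec {m : ℕ} (g : AffGroup m) (P : Matrix (Fin m) (Fin m) ℝ) (u : Fin m → ℝ) :
    (g.Linvᵀ * P * g.Linv) *ᵥ (g.t + g.L *ᵥ u)
      = (g.Linvᵀ * P * g.Linv) *ᵥ g.t + g.Linvᵀ *ᵥ (P *ᵥ u) := by
  rw [Matrix.mulVec_add, Matrix.mulVec_mulVec, Matrix.mul_assoc (g.Linvᵀ * P),
    AffGroup.Linv_mul_L, Matrix.mul_one, Matrix.mulVec_mulVec]

lemma smul_aux_dot {m : ℕ} (g : AffGroup m) (u v : Fin m → ℝ) :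
    (g.L *ᵥ u) ⬝ᵥ (g.Linvᵀ *ᵥ v) = u ⬝ᵥ v := by
  rw [Matrix.mulVec_transpose, dotProduct_comm, ← Matrix.dotProduct_mulVec,
    Matrix.mulVec_mulVec, AffGroup.Linv_mul_L, Matrix.one_mulVec, dotProduct_comm]

lemma smul_aux_symm {m : ℕ} (g : AffGroup m) (u : Fin m → ℝ) {P : Matrix (Fin m) (Fin m) ℝ}
    (hP : Pᵀ = P) :
    (g.L *ᵥ u) ⬝ᵥ ((g.Linvᵀ * P * g.Linv) *ᵥ g.t) = g.t ⬝ᵥ (g.Linvᵀ *ᵥ (P *ᵥ u)) := by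
  rw [Matrix.mul_assoc, ← Matrix.mulVec_mulVec, smul_aux_dot, ← Matrix.mulVec_mulVec,
    Matrix.mulVec_transpose, dotProduct_comm g.t, ← Matrix.dotProduct_mulVec,
    Matrix.dotProduct_mulVec, ← Matrix.mulVec_transpose, hP]

/-- The action of `Aff(m)` on the parameter domain. -/
instance (m : ℕ) : MulAction (AffGroup m) (QuadParam m) where
  smul := quadAct
  one_smul ξ := by
    change quadAct 1 ξ = ξ
    simp [quadAct]
  mul_smul g h ξ := by
    obtain ⟨A, b, c⟩ := ξ
    change quadAct (g * h) (A, b, c) = quadAct g (quadAct h (A, b, c))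
    have hA : ((g * h).Linvᵀ * A.1 * (g * h).Linv)
        = g.Linvᵀ * (h.Linvᵀ * A.1 * h.Linv) * g.Linv := by
      simp only [AffGroup.Linv_mul, Matrix.transpose_mul, Matrix.mul_assoc]
    have hb : (g * h).Linvᵀ *ᵥ b.ofLp = g.Linvᵀ *ᵥ (h.Linvᵀ *ᵥ b.ofLp) := by
      simp only [AffGroup.Linv_mul, Matrix.transpose_mul, Matrix.mulVec_mulVec]
    have hP : (h.Linvᵀ * A.1 * h.Linv)ᵀ = h.Linvᵀ * A.1 * h.Linv := by
      simp [Matrix.transpose_mul, A.2.eq, Matrix.mul_assoc]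
    refine Prod.ext (Subtype.ext hA) (Prod.ext (congrArg (WithLp.toLp 2) ?_) ?_)
    · change (g * h).Linvᵀ *ᵥ b.ofLp
          - (2 : ℝ) • (((g * h).Linvᵀ * A.1 * (g * h).Linv) *ᵥ (g * h).t)
        = g.Linvᵀ *ᵥ (h.Linvᵀ *ᵥ b.ofLp - (2 : ℝ) • ((h.Linvᵀ * A.1 * h.Linv) *ᵥ h.t))
          - (2 : ℝ) • ((g.Linvᵀ * (h.Linvᵀ * A.1 * h.Linv) * g.Linv) *ᵥ g.t)
      rw [hA, hb, AffGroup.t_mul, smul_aux_mulVec, Matrix.mulVec_sub, Matrix.mulVec_smul, smul_add]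
      abel
    · change c + (g * h).t ⬝ᵥ (((g * h).Linvᵀ * A.1 * (g * h).Linv) *ᵥ (g * h).t)
          - (g * h).t ⬝ᵥ ((g * h).Linvᵀ *ᵥ b.ofLp)
        = c + h.t ⬝ᵥ ((h.Linvᵀ * A.1 * h.Linv) *ᵥ h.t) - h.t ⬝ᵥ (h.Linvᵀ *ᵥ b.ofLp)
          + g.t ⬝ᵥ ((g.Linvᵀ * (h.Linvᵀ * A.1 * h.Linv) * g.Linv) *ᵥ g.t)
          - g.t ⬝ᵥ (g.Linvᵀ *ᵥ
            (h.Linvᵀ *ᵥ b.ofLp - (2 : ℝ) • ((h.Linvᵀ * A.1 * h.Linv) *ᵥ h.t)))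
      rw [hA, hb, AffGroup.t_mul, smul_aux_mulVec]
      simp only [add_dotProduct, dotProduct_add, smul_aux_dot, smul_aux_symm g h.t hP,
        Matrix.mulVec_sub, Matrix.mulVec_smul, dotProduct_sub, dotProduct_smul, smul_eq_mul]
      ring

/-- `ψ (g • x) (g • ξ) = |det L|^s ψ x ξ` for all `g = (t, L)` in `Aff(m)`. -/
def IsRelInvariant (m : ℕ) (s : ℝ) (ψ : DataDom m → QuadParam m → ℂ) : Prop :=
  ∀ (g : AffGroup m) (x : DataDom m) (ξ : QuadParam m),
    ψ (g • x) (g • ξ) = ((|g.L.det| ^ s : ℝ) : ℂ) * ψ x ξ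

lemma isRelInvariant_zero_iff (m : ℕ) (ψ : DataDom m → QuadParam m → ℂ) :
    IsRelInvariant m 0 ψ ↔ IsJointInvariant (AffGroup m) ψ := by
  simp [IsRelInvariant, IsJointInvariant]

/-- The feature map `ψ(x, (A, b, c)) = η(A) ρ(xᵀ A x + xᵀ b + c)`. -/
def windowedFeature {m : ℕ} (η : SymMat m → ℝ) (ρ : ℝ → ℂ) (x : DataDom m) (ξ : QuadParam m) : ℂ :=
  (η ξ.1 : ℂ) * quadFeature m ρ x ξ

/-- `σ` is locally integrable of at most polynomial growth in the mean, i.e. it is a function that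
defines a tempered distribution by absolutely convergent integrals. -/
def IsTemperedFun (σ : ℝ → ℂ) : Prop :=
  ∃ k : ℕ, Integrable fun t : ℝ => (((1 + |t|) ^ k)⁻¹ : ℝ) • σ t

/-- `σ` coincides almost everywhere with a polynomial function. -/
def IsAEPolynomial (σ : ℝ → ℂ) : Prop :=
  ∃ p : Polynomial ℂ, σ =ᵐ[volume] fun t : ℝ => p.eval (t : ℂ)

end

noncomputable section

open scoped FourierTransform ContDiff

/-! ### Tempered functions and Schwartz functions -/

/-! Joint invariance holds because the action on `(A, b, c)` transports the polynomial `x ↦ xᵀAx +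
xᵀb + c` to its composition with `g⁻¹`.

Irreducibility: for `f` in an invariant subspace and `h` orthogonal to it, the inner products of `h`
with `π_(t,A) f`, as functions of `t`, are the Fourier transform of the `L¹` function `ξ ↦ conj (ĥ
ξ) · f̂(Aᵀξ)`, up to a constant. So this product vanishes a.e. for each invertible `A`. The family
`Aᵀξ = ξ + ξ_j v` and Fubini in `(v, ξ)` give a single `ξ` with `ĥ ξ ≠ 0` and `f̂(ξ + ξ_j v) = 0`
for a.e. `v`, hence `f = 0` unless `h = 0` (`eq_zero_or_eq_zero_of_orthogonal`).

Reconstruction: the bounded extension `T` of `QNN ∘ R` satisfies `T π_g = χ(g) π_g T` with `χ(g) >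
0`, by change of variables. If `T` commutes with every `π_g`, Schur's lemma makes it scalar.
Otherwise some `χ(g) ≠ 1`, and comparing operator norms gives `T = 0`, the scalar zero.

Right inverse: take `conj ρ = 𝓕 τ` with `τ w = |w|^m χ w`, where `χ` is Schwartz and vanishes near
zero. Opening `𝓕 τ` writes the ridgelet transform as an integral over `w` of Fourier transforms, at
`w b`, of `f` times a quadratic phase. Integrating over `b` is Fourier inversion at the origin,
where the phase is one; the Jacobian `|w|^(-m)` cancels against `τ`, leaving `f 0 · 𝓕 χ c` whatever
`A` is (`integral_ridgeSlice`). Pairing with `σ` and the window gives `QNN[R f](0) = (∫ η)(∫ σ · 𝓕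
χ) f 0`, and translation covariance moves this to every point. A `χ` with `∫ σ · 𝓕 χ ≠ 0` exists
because otherwise `σ` has spectrum at the origin alone and is a polynomial
(`isAEPolynomial_of_fourier`). Absolute convergence rests on `exists_ridgeSlice_decay`. Universality
follows by density of Schwartz functions. -/

lemma SchwartzMap.exists_one_add_norm_pow_mul_le {E F : Type*} [NormedAddCommGroup E]
    [NormedSpace ℝ E] [NormedAddCommGroup F] [NormedSpace ℝ F] (f : 𝓢(E, F)) (k n : ℕ) :
    ∃ C, 0 ≤ C ∧ ∀ x, (1 + ‖x‖) ^ k * ‖iteratedFDeriv ℝ n f x‖ ≤ C :=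
  ⟨_, by positivity, fun x => SchwartzMap.one_add_le_sup_seminorm_apply (𝕜 := ℝ) (m := (k, n))
    le_rfl le_rfl f x⟩

lemma SchwartzMap.exists_one_add_norm_pow_mul_apply_le {E F : Type*} [NormedAddCommGroup E]
    [NormedSpace ℝ E] [NormedAddCommGroup F] [NormedSpace ℝ F] (f : 𝓢(E, F)) (k : ℕ) :
    ∃ C, 0 ≤ C ∧ ∀ x, (1 + ‖x‖) ^ k * ‖f x‖ ≤ C := by
  simpa using f.exists_one_add_norm_pow_mul_le k 0

/-- Taylor expansion of a Schwartz function with a remainder that decays in the base point. -/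
lemma SchwartzMap.exists_taylor_bound (Θ : 𝓢(ℝ, ℂ)) (n k : ℕ) :
    ∃ (C : ℝ) (c : ℕ → ℝ → ℂ), 0 ≤ C ∧ ∀ a b : ℝ,
      ‖Θ (a - b) - ∑ j ∈ Finset.range (n + 1), c j a * (b : ℂ) ^ j‖ * (1 + |a|) ^ k
        ≤ C * (|b| ^ (n + 1) * (1 + |b|) ^ k) := by
  obtain ⟨C, hC0, hC⟩ := Θ.exists_one_add_norm_pow_mul_le k (n + 1)
  refine ⟨C, fun j a => ((j.factorial : ℝ)⁻¹ : ℝ) • iteratedDeriv j (fun x => Θ (a - x)) 0, hC0,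
    fun a b => ?_⟩
  set F : ℝ → ℂ := fun x => Θ (a - x) with hF
  have hFs : ContDiff ℝ ∞ F := Θ.smooth'.comp (contDiff_const.sub contDiff_id)
  have hFn : ∀ j : ℕ, ContDiff ℝ j F := fun j => hFs.of_le (mod_cast le_top)
  -- Restricting to the segment from `a` to `a - b` puts the expansion on `[0, 1]`, with no case
  -- split on the sign of `b`.
  set f : ℝ → ℂ := fun r => F (b * r) with hf
  have hfs : ContDiff ℝ ∞ f := hFs.comp (contDiff_const.mul contDiff_id)
  have hfn : ∀ j : ℕ, ContDiff ℝ j f := fun j => hfs.of_le (mod_cast le_top)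
  have hder : ∀ j : ℕ, ∀ r, iteratedDeriv j f r = b ^ j • iteratedDeriv j F (b * r) := by
    intro j r
    have := iteratedDeriv_comp_const_smul (hFn j) b
    exact congrFun this r
  have hw : ∀ j : ℕ, ∀ r ∈ Set.Icc (0 : ℝ) 1,
      iteratedDerivWithin j f (Set.Icc 0 1) r = b ^ j • iteratedDeriv j F (b * r) := by
    intro j r hr
    rw [iteratedDerivWithin_eq_iteratedDeriv (uniqueDiffOn_Icc zero_lt_one)
      (hfn j).contDiffAt hr, hder]
  have hb : ∀ y ∈ Set.Icc (0 : ℝ) 1, ‖iteratedDerivWithin (n + 1) f (Set.Icc 0 1) y‖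
      ≤ |b| ^ (n + 1) * (C * (1 + |b|) ^ k / (1 + |a|) ^ k) := by
    intro y hy
    rw [hw _ _ hy, norm_smul, norm_pow, Real.norm_eq_abs]
    gcongr
    rw [hF, iteratedDeriv_comp_const_sub]
    simp only [norm_smul, norm_pow, norm_neg, norm_one, one_pow, one_mul]
    rw [le_div_iff₀ (by positivity)]
    have h1 := hC (a - b * y)
    rw [norm_iteratedFDeriv_eq_norm_iteratedDeriv] at h1
    -- Peetre's inequality: decay at the intermediate point becomes decay at the base point, at the
    -- cost of a power of `1 + |b|`.
    have h2 : 1 + |a| ≤ (1 + ‖a - b * y‖) * (1 + |b|) := by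
      have h3 : |a| ≤ |a - b * y| + |b * y| := by
        simpa using abs_add_le (a - b * y) (b * y)
      have h4 : |b * y| ≤ |b| := by
        rw [abs_mul, abs_of_nonneg hy.1]
        exact mul_le_of_le_one_right (abs_nonneg _) hy.2
      rw [Real.norm_eq_abs]
      nlinarith [abs_nonneg (a - b * y), abs_nonneg b]
    calc _ ≤ ‖iteratedDeriv (n + 1) Θ (a - b * y)‖ * ((1 + ‖a - b * y‖) * (1 + |b|)) ^ k := by
          gcongr
      _ = ((1 + ‖a - b * y‖) ^ k * ‖iteratedDeriv (n + 1) Θ (a - b * y)‖) * (1 + |b|) ^ k := by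
          rw [mul_pow]; ring
      _ ≤ _ := by gcongr
  have ht := taylor_mean_remainder_bound (zero_le_one' ℝ) (n := n) (hfs.of_le (mod_cast le_top)).contDiffOn
    (Set.right_mem_Icc.2 zero_le_one) hb
  rw [taylor_within_apply] at ht
  have h5 : ∑ j ∈ Finset.range (n + 1), ((j.factorial : ℝ)⁻¹ * (1 - 0) ^ j) •
      iteratedDerivWithin j f (Set.Icc 0 1) 0
      = ∑ j ∈ Finset.range (n + 1), (((j.factorial : ℝ)⁻¹ : ℝ) • iteratedDeriv j F 0) * (b : ℂ) ^ j := by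
    refine Finset.sum_congr rfl fun j _ => ?_
    rw [hw j 0 (Set.left_mem_Icc.2 zero_le_one)]
    simp only [sub_zero, one_pow, mul_one, mul_zero, Complex.real_smul]
    push_cast
    ring
  rw [h5] at ht
  have h6 : f 1 = Θ (a - b) := by simp [hf, hF]
  rw [h6] at ht
  calc _ ≤ (|b| ^ (n + 1) * (C * (1 + |b|) ^ k / (1 + |a|) ^ k)) * (1 + |a|) ^ k := by
        gcongr
        refine ht.trans ?_
        rw [sub_zero, one_pow, mul_one]
        exact div_le_self (by positivity) (mod_cast Nat.one_le_iff_ne_zero.2 n.factorial_ne_zero)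
    _ = _ := by field_simp

/-- A fixed smooth cutoff, equal to one near the origin, as a Schwartz function. -/
def cutoff : 𝓢(ℝ, ℂ) :=
  let b : ContDiffBump (0 : ℝ) := ⟨1, 2, one_pos, one_lt_two⟩
  HasCompactSupport.toSchwartzMap (f := fun x => ((b x : ℝ) : ℂ))
    (b.hasCompactSupport.comp_left (g := fun x : ℝ => (x : ℂ)) Complex.ofReal_zero)
    (Complex.ofRealCLM.contDiff.comp b.contDiff)

lemma cutoff_eq_one {x : ℝ} (hx : |x| ≤ 1) : cutoff x = 1 := by
  have : ((⟨1, 2, one_pos, one_lt_two⟩ : ContDiffBump (0 : ℝ)) x) = 1 :=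
    ContDiffBump.one_of_mem_closedBall _ (by simpa using hx)
  change (((⟨1, 2, one_pos, one_lt_two⟩ : ContDiffBump (0 : ℝ)) x : ℝ) : ℂ) = 1
  rw [this, Complex.ofReal_one]

/-- Dilation of a Schwartz function on the line. -/
def dilate (ε : ℝ) (hε : ε ≠ 0) : 𝓢(ℝ, ℂ) →L[ℂ] 𝓢(ℝ, ℂ) :=
  SchwartzMap.compCLMOfContinuousLinearEquiv ℂ
    (ContinuousLinearEquiv.unitsEquivAut ℝ (Units.mk0 ε hε))

lemma dilate_apply {ε : ℝ} (hε : ε ≠ 0) (f : 𝓢(ℝ, ℂ)) (x : ℝ) : dilate ε hε f x = f (x * ε) := by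
  simp [dilate]

lemma fourier_dilate {ε : ℝ} (hε : 0 < ε) (f : 𝓢(ℝ, ℂ)) (w : ℝ) :
    𝓕 (dilate ε hε.ne' f) w = (ε : ℂ)⁻¹ * 𝓕 f (w / ε) := by
  rw [SchwartzMap.fourier_coe, SchwartzMap.fourier_coe, Real.fourier_eq', Real.fourier_eq']
  simp only [dilate_apply]
  have := Measure.integral_comp_mul_right
    (fun v : ℝ => Complex.exp (↑(-2 * Real.pi * inner ℝ v (w / ε)) * Complex.I) • f v) ε
  rw [abs_inv, abs_of_pos hε, Complex.real_smul, Complex.ofReal_inv] at this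
  rw [← this]
  congr 1
  funext v
  congr 4
  simp only [RCLike.inner_apply, conj_trivial]
  field_simp

lemma integrable_mul_of_tempered {σ : ℝ → ℂ} {k : ℕ}
    (hσ : Integrable fun t : ℝ => (((1 + |t|) ^ k)⁻¹ : ℝ) • σ t) {g : ℝ → ℂ}
    (hg : AEStronglyMeasurable g) {C : ℝ} (hC : ∀ t, (1 + |t|) ^ k * ‖g t‖ ≤ C) :
    Integrable (fun t => σ t * g t) ∧
      ‖∫ t, σ t * g t‖ ≤ C * ∫ t, ‖(((1 + |t|) ^ k)⁻¹ : ℝ) • σ t‖ := by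
  have hb : ∀ t, ‖σ t * g t‖ ≤ C * ‖(((1 + |t|) ^ k)⁻¹ : ℝ) • σ t‖ := by
    intro t
    have h1 : 0 < (1 + |t|) ^ k := by positivity
    rw [norm_mul, norm_smul, Real.norm_of_nonneg (by positivity)]
    calc ‖σ t‖ * ‖g t‖ = ((1 + |t|) ^ k * ‖g t‖) * (((1 + |t|) ^ k)⁻¹ * ‖σ t‖) := by
          field_simp
      _ ≤ _ := by gcongr; exact hC t
  have hm : AEStronglyMeasurable (fun t => σ t * g t) := by
    have h1 : (fun t => σ t * g t)
        = fun t => (((1 + |t|) ^ k : ℝ) • ((((1 + |t|) ^ k)⁻¹ : ℝ) • σ t)) * g t := by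
      funext t
      have h1 : (1 + |t|) ^ k ≠ 0 := by positivity
      rw [smul_smul, mul_inv_cancel₀ h1, one_smul]
    rw [h1]
    have h2 : AEStronglyMeasurable (fun t : ℝ => (1 + |t|) ^ k) :=
      (by fun_prop : Continuous fun t : ℝ => (1 + |t|) ^ k).aestronglyMeasurable
    exact (h2.smul hσ.1).mul hg
  refine ⟨(hσ.norm.const_mul C).mono' hm (.of_forall hb), ?_⟩
  rw [← integral_const_mul]
  exact norm_integral_le_of_norm_le (hσ.norm.const_mul C) (.of_forall hb)

/-- Puts the weight exponent in the form `n + 1`, the order of a Taylor remainder after degree `n`.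
-/
lemma tempered_succ {σ : ℝ → ℂ} {k : ℕ}
    (hσ : Integrable fun t : ℝ => (((1 + |t|) ^ k)⁻¹ : ℝ) • σ t) :
    Integrable fun t : ℝ => (((1 + |t|) ^ (k + 1))⁻¹ : ℝ) • σ t := by
  have h1 : (fun t : ℝ => (((1 + |t|) ^ (k + 1))⁻¹ : ℝ) • σ t)
      = fun t => ((1 + |t|)⁻¹ : ℝ) • ((((1 + |t|) ^ k)⁻¹ : ℝ) • σ t) := by
    funext t
    rw [smul_smul, pow_succ, mul_inv, mul_comm]
  rw [h1]
  refine Integrable.bdd_smul (φ := fun t : ℝ => (1 + |t|)⁻¹) hσ 1 ?_ (.of_forall fun t => ?_)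
  · exact (Continuous.inv₀ (by fun_prop) fun t => by positivity).aestronglyMeasurable
  · rw [Real.norm_of_nonneg (by positivity)]
    exact inv_le_one_of_one_le₀ (by linarith [abs_nonneg t])

lemma integrable_mul_schwartz {σ : ℝ → ℂ} {k : ℕ}
    (hσ : Integrable fun t : ℝ => (((1 + |t|) ^ k)⁻¹ : ℝ) • σ t) (g : 𝓢(ℝ, ℂ)) :
    Integrable fun t => σ t * g t := by
  obtain ⟨C, -, hC⟩ := g.exists_one_add_norm_pow_mul_apply_le k
  exact (integrable_mul_of_tempered hσ g.continuous.aestronglyMeasurable hC).1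

lemma integrable_pow_mul_schwartz (g : 𝓢(ℝ, ℂ)) (j : ℕ) :
    Integrable fun t : ℝ => (t : ℂ) ^ j * g t := by
  refine (g.integrable_pow_mul volume j).mono' ?_ (.of_forall fun t => ?_)
  · exact ((by fun_prop : Continuous fun t : ℝ => (t : ℂ) ^ j).mul g.continuous).aestronglyMeasurable
  · rw [norm_mul, norm_pow, Complex.norm_real]

lemma fourier_fourierInv_schwartz (g : 𝓢(ℝ, ℂ)) (w : ℝ) : 𝓕⁻ g w = 𝓕 g (-w) := by
  rw [SchwartzMap.fourierInv_apply_eq]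
  simp

/-- If `σ` annihilates the Fourier transforms of all Schwartz functions vanishing near the origin,
then it annihilates all Schwartz functions with enough vanishing moments. -/
lemma integral_mul_eq_zero_of_moments {σ : ℝ → ℂ} {n : ℕ}
    (hσ : Integrable fun t : ℝ => (((1 + |t|) ^ (n + 1))⁻¹ : ℝ) • σ t)
    (h0 : ∀ χ : 𝓢(ℝ, ℂ), ∀ δ > 0, (∀ w, |w| < δ → χ w = 0) → ∫ t, σ t * 𝓕 χ t = 0)
    (φ : 𝓢(ℝ, ℂ)) (hφ : ∀ j < n + 1, ∫ t : ℝ, (t : ℂ) ^ j * φ t = 0) :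
    ∫ t, σ t * φ t = 0 := by
  set Θ : 𝓢(ℝ, ℂ) := 𝓕⁻ cutoff with hΘ
  obtain ⟨C, c, hC0, hC⟩ := Θ.exists_taylor_bound n (n + 1)
  have hint : Integrable fun s : ℝ => ‖φ s‖ * (|s| ^ (n + 1) * (1 + |s|) ^ (n + 1)) := by
    have h1 : ∀ s : ℝ, ‖φ s‖ * (|s| ^ (n + 1) * (1 + |s|) ^ (n + 1))
        = ∑ i ∈ Finset.range (n + 1 + 1), ((n + 1).choose i : ℝ) * (‖s‖ ^ (i + (n + 1)) * ‖φ s‖) := by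
      intro s
      rw [add_comm 1 |s|, add_pow]
      simp only [one_pow, mul_one, Real.norm_eq_abs]
      rw [Finset.mul_sum, Finset.mul_sum]
      exact Finset.sum_congr rfl fun i _ => by ring
    simp only [h1]
    exact integrable_finsetSum _ fun i _ => (φ.integrable_pow_mul volume _).const_mul _
  set I := ∫ s : ℝ, ‖φ s‖ * (|s| ^ (n + 1) * (1 + |s|) ^ (n + 1)) with hI
  set J := ∫ t, ‖(((1 + |t|) ^ (n + 1))⁻¹ : ℝ) • σ t‖ with hJ
  -- Only frequencies of `φ` below about `ε` are seen by `σ`; the moments make that part `O(ε)` in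
  -- the norm dual to the weight of `σ`.
  have key : ∀ ε : ℝ, 0 < ε → ε ≤ 1 → ‖∫ t, σ t * φ t‖ ≤ (ε * (C * I)) * J := by
    intro ε hε hε1
    set Θε : 𝓢(ℝ, ℂ) := (ε : ℂ) • dilate ε hε.ne' Θ with hΘε
    have hFΘ : ∀ w, 𝓕 Θε w = cutoff (w / ε) := by
      intro w
      rw [hΘε, FourierTransform.fourier_smul, _root_.smul_apply, fourier_dilate hε, hΘ,
        FourierTransform.fourier_fourierInv_eq, smul_eq_mul, ← mul_assoc,
        mul_inv_cancel₀ (mod_cast hε.ne'), one_mul]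
    set h : 𝓢(ℝ, ℂ) := SchwartzMap.convolution (ContinuousLinearMap.mul ℂ ℂ) φ Θε with hh
    have hFh : ∀ w, 𝓕 h w = 𝓕 φ w * cutoff (w / ε) := by
      intro w
      rw [hh, SchwartzMap.fourier_convolution, SchwartzMap.pairing_apply_apply, hFΘ]
      rfl
    -- The low-pass part `h` agrees with `φ` at frequencies `|w| < ε`, so `h0` applies to the
    -- difference.
    have h1 : ∫ t, σ t * (φ - h) t = 0 := by
      have := h0 (𝓕⁻ (φ - h)) ε hε fun w hw => by
        rw [fourier_fourierInv_schwartz, show 𝓕 (φ - h) = 𝓕 φ - 𝓕 h from map_sub (FourierTransform.fourierCLM ℂ 𝓢(ℝ, ℂ)) φ h,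
          _root_.sub_apply, hFh,
          cutoff_eq_one, mul_one, sub_self]
        rw [abs_div, abs_neg, abs_of_pos hε, div_le_one hε]
        exact hw.le
      rwa [FourierTransform.fourier_fourierInv_eq] at this
    have h2 : ∫ t, σ t * φ t = ∫ t, σ t * h t := by
      rw [← sub_eq_zero, ← integral_sub (integrable_mul_schwartz hσ φ) (integrable_mul_schwartz hσ h),
        ← h1]
      exact integral_congr_ae (.of_forall fun t => by simp [mul_sub])
    rw [h2]
    refine (integrable_mul_of_tempered hσ h.continuous.aestronglyMeasurable fun t => ?_).2
    have h3 : h t = ∫ s, φ s * ((ε : ℂ) * Θ (ε * t - ε * s)) := by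
      rw [hh, SchwartzMap.convolution_apply, convolution]
      refine integral_congr_ae (.of_forall fun s => ?_)
      simp only [ContinuousLinearMap.mul_apply', hΘε, _root_.smul_apply, dilate_apply,
        smul_eq_mul]
      rw [show (t - s) * ε = ε * t - ε * s by ring]
    have h4 : ∀ j ∈ Finset.range (n + 1), Integrable fun s : ℝ =>
        φ s * ((ε : ℂ) * (c j (ε * t) * ((ε * s : ℝ) : ℂ) ^ j)) := by
      intro j _
      refine ((integrable_pow_mul_schwartz φ j).const_mul (ε * (c j (ε * t) * ε ^ j))).congr
        (.of_forall fun s => ?_)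
      push_cast
      ring
    -- The Taylor polynomial in `s` integrates to zero against `φ` by the vanishing moments, so it
    -- may be subtracted freely.
    have h5 : ∫ s, ∑ j ∈ Finset.range (n + 1), φ s * ((ε : ℂ) * (c j (ε * t) * ((ε * s : ℝ) : ℂ) ^ j))
        = 0 := by
      rw [integral_finsetSum _ h4]
      refine Finset.sum_eq_zero fun j hj => ?_
      rw [← mul_zero ((ε : ℂ) * (c j (ε * t) * ε ^ j)), ← hφ j (Finset.mem_range.1 hj),
        ← integral_const_mul]
      refine integral_congr_ae (.of_forall fun s => ?_)
      push_cast
      ring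
    have h6 : Integrable fun s => φ s * ((ε : ℂ) * Θ (ε * t - ε * s)) := by
      obtain ⟨D, -, hD⟩ := Θ.exists_one_add_norm_pow_mul_apply_le 0
      refine φ.integrable.mul_bdd (c := ε * D) ?_ (.of_forall fun s => ?_)
      · exact (continuous_const.mul (Θ.continuous.comp (by fun_prop))).aestronglyMeasurable
      · rw [norm_mul, Complex.norm_real, Real.norm_of_nonneg hε.le]
        gcongr
        simpa using hD (ε * t - ε * s)
    have h7 : h t = ∫ s, φ s * (ε * (Θ (ε * t - ε * s)
        - ∑ j ∈ Finset.range (n + 1), c j (ε * t) * ((ε * s : ℝ) : ℂ) ^ j)) := by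
      rw [h3, ← sub_zero (∫ s, φ s * ((ε : ℂ) * Θ (ε * t - ε * s))), ← h5,
        ← integral_sub h6 (integrable_finsetSum _ h4)]
      refine integral_congr_ae (.of_forall fun s => ?_)
      simp only [mul_sub, Finset.mul_sum]
    have h8 : ‖h t‖ ≤ ∫ s, (ε * C * ε ^ (n + 1) / (1 + |ε * t|) ^ (n + 1)) *
        (‖φ s‖ * (|s| ^ (n + 1) * (1 + |s|) ^ (n + 1))) := by
      rw [h7]
      refine norm_integral_le_of_norm_le (hint.const_mul _) (.of_forall fun s => ?_)
      rw [norm_mul, norm_mul, Complex.norm_real, Real.norm_of_nonneg hε.le]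
      have h9 := hC (ε * t) (ε * s)
      rw [← le_div_iff₀ (by positivity)] at h9
      have h10 : |ε * s| ^ (n + 1) * (1 + |ε * s|) ^ (n + 1)
          ≤ ε ^ (n + 1) * (|s| ^ (n + 1) * (1 + |s|) ^ (n + 1)) := by
        rw [abs_mul, abs_of_pos hε, mul_pow, mul_assoc]
        gcongr
        exact mul_le_of_le_one_left (abs_nonneg _) hε1
      calc _ ≤ ‖φ s‖ * (ε * (C * (ε ^ (n + 1) * (|s| ^ (n + 1) * (1 + |s|) ^ (n + 1)))
            / (1 + |ε * t|) ^ (n + 1))) := by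
            gcongr
            refine h9.trans ?_
            gcongr
        _ = _ := by ring
    rw [integral_const_mul] at h8
    -- The `ε ^ (n + 1)` of the remainder pays exactly for the weight in `t`; the factor `ε` from
    -- normalising `Θε` survives.
    have h11 : ε ^ (n + 1) * (1 + |t|) ^ (n + 1) ≤ (1 + |ε * t|) ^ (n + 1) := by
      rw [← mul_pow, abs_mul, abs_of_pos hε]
      gcongr
      linarith [mul_add ε 1 |t|]
    have hI0 : 0 ≤ I := integral_nonneg fun s => by positivity
    calc _ ≤ (1 + |t|) ^ (n + 1) * ((ε * C * ε ^ (n + 1) / (1 + |ε * t|) ^ (n + 1)) * I) := by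
          gcongr
      _ = (ε * (C * I)) * ((ε ^ (n + 1) * (1 + |t|) ^ (n + 1)) / (1 + |ε * t|) ^ (n + 1)) := by ring
      _ ≤ (ε * (C * I)) * 1 := by
          gcongr
          exact div_le_one_of_le₀ h11 (by positivity)
      _ = _ := mul_one _
  by_contra hne
  have hpos := norm_pos_iff.2 hne
  have h12 : Filter.Tendsto (fun ε : ℝ => (ε * (C * I)) * J) (nhdsWithin 0 (Set.Ioi 0)) (nhds 0) := by
    have : Continuous fun ε : ℝ => (ε * (C * I)) * J := by fun_prop
    simpa using (this.tendsto 0).mono_left nhdsWithin_le_nhds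
  have h13 := ge_of_tendsto h12 (b := ‖∫ t, σ t * φ t‖) (by
    filter_upwards [Ioc_mem_nhdsGT (zero_lt_one' ℝ)] with ε hε using key ε hε.1 hε.2)
  linarith

/-- Pairing with `σ` vanishes on the common kernel of finitely many moment functionals, so by linear
algebra it is a combination of them; the coefficients are those of the polynomial. -/
lemma isAEPolynomial_of_fourier {σ : ℝ → ℂ} (hσ : IsTemperedFun σ)
    (h0 : ∀ χ : 𝓢(ℝ, ℂ), ∀ δ > 0, (∀ w, |w| < δ → χ w = 0) → ∫ t, σ t * 𝓕 χ t = 0) :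
    IsAEPolynomial σ := by
  obtain ⟨n, hn⟩ := hσ
  have hσ' := tempered_succ hn
  let K : 𝓢(ℝ, ℂ) →ₗ[ℂ] ℂ :=
    { toFun := fun φ => ∫ t, σ t * φ t
      map_add' := fun φ ψ => by
        rw [← integral_add (integrable_mul_schwartz hn φ) (integrable_mul_schwartz hn ψ)]
        simp [mul_add]
      map_smul' := fun a φ => by
        rw [RingHom.id_apply, smul_eq_mul, ← integral_const_mul]
        simp [mul_left_comm] }
  let L : Fin (n + 1) → 𝓢(ℝ, ℂ) →ₗ[ℂ] ℂ := fun j =>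
    { toFun := fun φ => ∫ t : ℝ, (t : ℂ) ^ (j : ℕ) * φ t
      map_add' := fun φ ψ => by
        rw [← integral_add (integrable_pow_mul_schwartz φ j) (integrable_pow_mul_schwartz ψ j)]
        simp [mul_add]
      map_smul' := fun a φ => by
        rw [RingHom.id_apply, smul_eq_mul, ← integral_const_mul]
        simp [mul_left_comm] }
  have hmem : K ∈ Submodule.span ℂ (Set.range L) := by
    refine mem_span_of_iInf_ker_le_ker fun φ hφ => ?_
    simp only [Submodule.mem_iInf, LinearMap.mem_ker] at hφ
    exact integral_mul_eq_zero_of_moments hσ' h0 φ fun j hj => hφ ⟨j, hj⟩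
  obtain ⟨c, hc⟩ := (Submodule.mem_span_range_iff_exists_fun ℂ).1 hmem
  let p : Polynomial ℂ := ∑ j : Fin (n + 1), Polynomial.C (c j) * Polynomial.X ^ (j : ℕ)
  have hp : ∀ t : ℝ, p.eval (t : ℂ) = ∑ j : Fin (n + 1), c j * (t : ℂ) ^ (j : ℕ) := fun t => by
    simp [p, Polynomial.eval_finsetSum]
  refine ⟨p, ?_⟩
  have hpc : Continuous fun t : ℝ => p.eval (t : ℂ) := p.continuous.comp Complex.continuous_ofReal
  refine ae_eq_of_integral_contDiff_smul_eq ?_ hpc.locallyIntegrable fun g hg hgc => ?_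
  · have h1 := (hn.locallyIntegrable.locallyIntegrableOn Set.univ).continuousOn_smul
      isOpen_univ.isLocallyClosed (g := fun t : ℝ => (1 + |t|) ^ n) (by fun_prop)
    rw [locallyIntegrableOn_univ] at h1
    refine h1.congr (.of_forall fun t => ?_)
    have h2 : (1 + |t|) ^ n ≠ 0 := by positivity
    simp only [smul_smul]
    rw [mul_inv_cancel₀ h2, one_smul]
  · let φ : 𝓢(ℝ, ℂ) := HasCompactSupport.toSchwartzMap (f := fun x => ((g x : ℝ) : ℂ))
      (hgc.comp_left (g := fun x : ℝ => (x : ℂ)) Complex.ofReal_zero)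
      (Complex.ofRealCLM.contDiff.comp hg)
    have h3 : K φ = ∑ j, c j * L j φ := by rw [← hc]; simp
    have h4 : ∫ x, g x • σ x = K φ := by
      refine integral_congr_ae (.of_forall fun t => ?_)
      simp only [Complex.real_smul]
      exact mul_comm _ _
    rw [h4, h3]
    have h5 : ∀ j : Fin (n + 1), c j * L j φ = ∫ t : ℝ, c j * ((t : ℂ) ^ (j : ℕ) * φ t) := fun j =>
      (integral_const_mul _ _).symm
    simp only [h5]
    rw [← integral_finsetSum _ fun (j : Fin (n + 1)) _ =>
      (integrable_pow_mul_schwartz φ j).const_mul (c j)]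
    refine integral_congr_ae (.of_forall fun t => ?_)
    simp only [hp, Complex.real_smul, Finset.mul_sum]
    refine Finset.sum_congr rfl fun j _ => ?_
    change _ = (g t : ℂ) * _
    change c j * ((t : ℂ) ^ (j : ℕ) * (g t : ℂ)) = _
    ring

/-- A bounded function whose derivative is supported in `[0, δ]`. As a multiplier it splits a
Schwartz function vanishing near the origin into its positive and negative halves. -/
lemma smoothTransition_hasTemperateGrowth {δ : ℝ} (hδ : 0 < δ) :
    Function.HasTemperateGrowth fun w : ℝ => ((Real.smoothTransition (w / δ) : ℝ) : ℂ) := by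
  have hs : ContDiff ℝ ∞ fun w : ℝ => Real.smoothTransition (w / δ) :=
    Real.smoothTransition.contDiff.comp (contDiff_id.div_const δ)
  have hd : HasCompactSupport (fderiv ℝ fun w : ℝ => Real.smoothTransition (w / δ)) := by
    refine HasCompactSupport.intro (isCompact_Icc (a := 0) (b := δ)) fun w hw => ?_
    rw [Set.mem_Icc, not_and_or, not_le, not_le] at hw
    rcases hw with hw | hw
    · have : (fun w : ℝ => Real.smoothTransition (w / δ)) =ᶠ[nhds w] fun _ => 0 := by
        filter_upwards [Iio_mem_nhds hw] with v hv
        exact Real.smoothTransition.zero_of_nonpos (div_nonpos_of_nonpos_of_nonneg (le_of_lt hv) hδ.le)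
      rw [this.fderiv_eq]
      simp
    · have : (fun w : ℝ => Real.smoothTransition (w / δ)) =ᶠ[nhds w] fun _ => 1 := by
        filter_upwards [Ioi_mem_nhds hw] with v hv
        exact Real.smoothTransition.one_of_one_le ((one_le_div hδ).2 (le_of_lt hv))
      rw [this.fderiv_eq]
      simp
  have h1 : Function.HasTemperateGrowth fun w : ℝ => Real.smoothTransition (w / δ) := by
    refine .of_fderiv (k := 0) (C := 1) (hd.hasTemperateGrowth (hs.fderiv_right (by simp)))
      (hs.differentiable (by simp)) fun w => ?_
    rw [pow_zero, mul_one, Real.norm_of_nonneg (Real.smoothTransition.nonneg _)]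
    exact Real.smoothTransition.le_one _
  exact Function.Complex.hasTemperateGrowth_ofReal.comp h1

/-- A tempered function that is not a polynomial is detected by a Schwartz function supported on
one side of the origin in frequency. -/
lemma exists_oneSided_of_not_isAEPolynomial {σ : ℝ → ℂ} (hσ : IsTemperedFun σ)
    (hp : ¬ IsAEPolynomial σ) :
    ∃ (χ : 𝓢(ℝ, ℂ)) (s δ : ℝ), |s| = 1 ∧ 0 < δ ∧ (∀ w, s * w < δ → χ w = 0) ∧
      ∫ t, σ t * 𝓕 χ t ≠ 0 := by
  have h0 : ∃ χ : 𝓢(ℝ, ℂ), ∃ δ > 0, (∀ w, |w| < δ → χ w = 0) ∧ ∫ t, σ t * 𝓕 χ t ≠ 0 := by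
    by_contra! h
    exact hp (isAEPolynomial_of_fourier hσ h)
  obtain ⟨χ, δ, hδ, hχ, hne⟩ := h0
  have htg := smoothTransition_hasTemperateGrowth hδ
  set χ₁ : 𝓢(ℝ, ℂ) := SchwartzMap.smulLeftCLM ℂ
    (fun w : ℝ => ((Real.smoothTransition (w / δ) : ℝ) : ℂ)) χ with hχ₁
  have hχ₁a : ∀ w, χ₁ w = (Real.smoothTransition (w / δ) : ℝ) * χ w := fun w => by
    rw [hχ₁, SchwartzMap.smulLeftCLM_apply_apply htg, smul_eq_mul]
  -- If the positive half pairs to zero with `σ`, the negative half carries the whole nonzero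
  -- pairing.
  by_cases h1 : ∫ t, σ t * 𝓕 χ₁ t = 0
  · refine ⟨χ - χ₁, -1, δ, by simp, hδ, fun w hw => ?_, ?_⟩
    · rw [_root_.sub_apply, hχ₁a]
      by_cases hw' : w < δ
      · rw [hχ w (abs_lt.2 ⟨by linarith, hw'⟩), mul_zero, sub_zero]
      · rw [Real.smoothTransition.one_of_one_le ((one_le_div hδ).2 (not_lt.1 hw'))]
        simp
    · obtain ⟨k, hk⟩ := hσ
      rw [show 𝓕 (χ - χ₁) = 𝓕 χ - 𝓕 χ₁ from
        map_sub (FourierTransform.fourierCLM ℂ 𝓢(ℝ, ℂ)) χ χ₁]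
      simp only [_root_.sub_apply, mul_sub]
      rwa [integral_sub (integrable_mul_schwartz hk _) (integrable_mul_schwartz hk _), h1, sub_zero]
  · refine ⟨χ₁, 1, δ, by simp, hδ, fun w hw => ?_, h1⟩
    rw [hχ₁a]
    rw [one_mul] at hw
    by_cases hw' : w ≤ 0
    · rw [Real.smoothTransition.zero_of_nonpos (div_nonpos_of_nonpos_of_nonneg hw' hδ.le)]
      simp
    · rw [hχ w (abs_lt.2 ⟨by linarith, hw⟩), mul_zero]

/-! ### Quadratic chirps -/

lemma hasTemperateGrowth_cexp_mul_I :
    Function.HasTemperateGrowth fun t : ℝ => Complex.exp (t * Complex.I) := by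
  have hd : ∀ n, iteratedDeriv n (fun t : ℝ => Complex.exp (t * Complex.I))
      = fun t : ℝ => Complex.I ^ n * Complex.exp (t * Complex.I) := by
    intro n
    induction n with
    | zero => simp
    | succ n ih =>
      rw [iteratedDeriv_succ, ih]
      funext t
      have h1 : HasDerivAt (fun t : ℝ => Complex.exp (t * Complex.I))
          (Complex.exp (t * Complex.I) * (1 * Complex.I)) t :=
        ((Complex.ofRealCLM.hasDerivAt (x := t)).mul_const Complex.I).cexp
      rw [(h1.const_mul (Complex.I ^ n)).deriv]
      ring
  refine ⟨?_, fun n => ⟨0, 1, fun t => ?_⟩⟩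
  · exact (Complex.contDiff_exp (𝕜 := ℝ)).comp (Complex.ofRealCLM.contDiff.mul contDiff_const)
  · rw [norm_iteratedFDeriv_eq_norm_iteratedDeriv, hd, norm_mul, Complex.norm_exp_ofReal_mul_I]
    simp

section Chirp

variable {E : Type*} [NormedAddCommGroup E] [InnerProductSpace ℝ E]

/-- The quadratic phase `y ↦ exp (-2πi w ⟪y, T y⟫)`. -/
def chirp (T : E →L[ℝ] E) (w : ℝ) (y : E) : ℂ :=
  Complex.exp ((-2 * Real.pi * w * inner ℝ y (T y) : ℝ) * Complex.I)

lemma norm_chirp (T : E →L[ℝ] E) (w : ℝ) (y : E) : ‖chirp T w y‖ = 1 :=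
  Complex.norm_exp_ofReal_mul_I _

lemma chirp_hasTemperateGrowth (T : E →L[ℝ] E) (w : ℝ) : (chirp T w).HasTemperateGrowth := by
  refine hasTemperateGrowth_cexp_mul_I.comp (f := fun y => -2 * Real.pi * w * inner ℝ y (T y)) ?_
  refine Function.HasTemperateGrowth.mul (.const _) ?_
  exact ContinuousLinearMap.bilinear_hasTemperateGrowth (𝕜 := ℝ) (innerSL ℝ) (.id')
    T.hasTemperateGrowth

lemma hasFDerivAt_chirp (T : E →L[ℝ] E) (w : ℝ) (y : E) :
    ∃ D : E →L[ℝ] ℂ, HasFDerivAt (chirp T w) D y ∧ ∀ v, D v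
      = (-2 * Real.pi * w * Complex.I) * ((inner ℝ v (T y) + inner ℝ y (T v) : ℝ) : ℂ) * chirp T w y := by
  have h1 := (hasFDerivAt_id (𝕜 := ℝ) y).inner ℝ (T.hasFDerivAt (x := y))
  have h2 := Complex.ofRealCLM.hasFDerivAt.comp y (h1.const_mul (-2 * Real.pi * w))
  have h3 := (h2.mul_const Complex.I).cexp
  refine ⟨_, h3, fun v => ?_⟩
  simp [chirp]
  ring

/-- A Schwartz function multiplied with a quadratic phase. -/
def chirpMul (T : E →L[ℝ] E) (w : ℝ) : 𝓢(E, ℂ) →L[ℂ] 𝓢(E, ℂ) :=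
  SchwartzMap.smulLeftCLM ℂ (chirp T w)

lemma chirpMul_apply (T : E →L[ℝ] E) (w : ℝ) (f : 𝓢(E, ℂ)) (y : E) :
    chirpMul T w f y = chirp T w y * f y :=
  SchwartzMap.smulLeftCLM_apply_apply (chirp_hasTemperateGrowth T w) f y

/-- A Schwartz function multiplied with a linear functional. -/
def coordMul (v : E) : 𝓢(E, ℂ) →L[ℂ] 𝓢(E, ℂ) :=
  SchwartzMap.smulLeftCLM ℂ fun y : E => ((inner ℝ y v : ℝ) : ℂ)

lemma coordMul_apply (v : E) (f : 𝓢(E, ℂ)) (y : E) :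
    coordMul v f y = (inner ℝ y v : ℝ) * f y :=
  SchwartzMap.smulLeftCLM_apply_apply
    (Function.Complex.hasTemperateGrowth_ofReal.comp (Function.hasTemperateGrowth_inner_left v)) f y

variable [FiniteDimensional ℝ E]

open LineDeriv in
-- The derivative of the phase is linear in `y`. Expanding it in an orthonormal basis leaves
-- Schwartz functions free of `T` and `w`, so that later constants are uniform in both.
lemma lineDerivOp_chirpMul (T : E →L[ℝ] E) (w : ℝ) (f : 𝓢(E, ℂ)) (v : E) :
    ∂_{v} (chirpMul T w f) = chirpMul T w (∂_{v} f) + (-2 * Real.pi * w * Complex.I : ℂ) •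
      ∑ k, ((inner ℝ v (T (stdOrthonormalBasis ℝ E k)) + inner ℝ (stdOrthonormalBasis ℝ E k) (T v) : ℝ)
        : ℂ) • chirpMul T w (coordMul (stdOrthonormalBasis ℝ E k) f) := by
  ext y
  obtain ⟨D, hD, hDv⟩ := hasFDerivAt_chirp T w y
  have h1 := hD.mul (f.hasFDerivAt y)
  have h2 : (⇑(chirpMul T w f)) = fun y => chirp T w y * f y := funext fun y => chirpMul_apply T w f y
  rw [SchwartzMap.lineDerivOp_apply_eq_fderiv, h2]
  erw [h1.fderiv]
  have h3 : inner ℝ v (T y) + inner ℝ y (T v)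
      = ∑ k, (inner ℝ v (T (stdOrthonormalBasis ℝ E k)) + inner ℝ (stdOrthonormalBasis ℝ E k) (T v))
        * inner ℝ y (stdOrthonormalBasis ℝ E k) := by
    conv_lhs => rw [← (stdOrthonormalBasis ℝ E).sum_repr' y]
    simp only [map_sum, map_smul, inner_sum, sum_inner, inner_smul_left, inner_smul_right,
      conj_trivial, ← Finset.sum_add_distrib]
    refine Finset.sum_congr rfl fun k _ => ?_
    rw [real_inner_comm y]
    ring
  simp only [_root_.add_apply, _root_.smul_apply, _root_.sum_apply, chirpMul_apply,
    coordMul_apply, SchwartzMap.lineDerivOp_apply_eq_fderiv, hDv, h3, smul_eq_mul]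
  push_cast
  simp only [Finset.mul_sum, Finset.sum_mul]
  congr 1
  refine Finset.sum_congr rfl fun k _ => ?_
  ring

variable [MeasurableSpace E] [BorelSpace E]

lemma norm_fourier_chirpMul_le (T : E →L[ℝ] E) (w : ℝ) (f : 𝓢(E, ℂ)) (ζ : E) :
    ‖𝓕 (chirpMul T w f) ζ‖ ≤ ∫ y, ‖f y‖ := by
  rw [SchwartzMap.fourier_coe]
  refine (VectorFourier.norm_fourierIntegral_le_integral_norm _ _ _ _ _).trans_eq ?_
  simp only [chirpMul_apply, norm_mul, norm_chirp, one_mul]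

open LineDeriv in
lemma inner_mul_fourier (f : 𝓢(E, ℂ)) (v ζ : E) :
    𝓕 (∂_{v} f) ζ = (2 * Real.pi * Complex.I) * ((inner ℝ ζ v : ℝ) * 𝓕 f ζ) := by
  rw [SchwartzMap.fourier_lineDerivOp_eq, _root_.smul_apply,
    SchwartzMap.smulLeftCLM_apply_apply (Function.hasTemperateGrowth_inner_left v),
    smul_eq_mul, Complex.real_smul]

open LineDeriv in
/-- The Fourier transform of a chirped Schwartz function decays rapidly, with at most polynomial
dependence on the chirp rate. -/
lemma exists_pow_mul_norm_fourier_chirpMul_le (R : ℝ) (hR : 0 ≤ R) (M : ℕ) (f : 𝓢(E, ℂ)) :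
    ∃ C, 0 ≤ C ∧ ∀ T : E →L[ℝ] E, ‖T‖ ≤ R → ∀ (w : ℝ) (ζ : E),
      ‖ζ‖ ^ M * ‖𝓕 (chirpMul T w f) ζ‖ ≤ C * (1 + |w|) ^ M := by
  -- Each power of `ζ` is a derivative, which either falls on `f` or brings down `w` times a
  -- coordinate; the hypothesis is therefore needed for `∂f` and `coordMul _ f`.
  induction M generalizing f with
  | zero =>
    exact ⟨∫ y, ‖f y‖, integral_nonneg fun y => norm_nonneg _, fun T _ w ζ => by
      simpa using norm_fourier_chirpMul_le T w f ζ⟩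
  | succ M ih =>
    set b := stdOrthonormalBasis ℝ E with hb
    choose C₁ hC₁0 hC₁ using fun k => ih (∂_{b k} f)
    choose C₂ hC₂0 hC₂ using fun k => ih (coordMul (b k) f)
    refine ⟨∑ i, (C₁ i + 2 * Real.pi * ∑ k, 2 * R * C₂ k), Finset.sum_nonneg fun i _ => ?_,
      fun T hT w ζ => ?_⟩
    · have : 0 ≤ ∑ k, 2 * R * C₂ k := Finset.sum_nonneg fun k _ => by have := hC₂0 k; positivity
      have := hC₁0 i
      positivity
    have hcomp : ∀ i, |inner ℝ ζ (b i)| * (‖ζ‖ ^ M * ‖𝓕 (chirpMul T w f) ζ‖)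
        ≤ (C₁ i + 2 * Real.pi * ∑ k, 2 * R * C₂ k) * (1 + |w|) ^ (M + 1) := by
      intro i
      have h1 := inner_mul_fourier (chirpMul T w f) (b i) ζ
      have h2 : ‖𝓕 (∂_{b i} (chirpMul T w f)) ζ‖
          = 2 * Real.pi * (|inner ℝ ζ (b i)| * ‖𝓕 (chirpMul T w f) ζ‖) := by
        rw [h1, norm_mul, norm_mul, norm_mul, norm_mul, Complex.norm_real, Complex.norm_real]
        simp [abs_of_pos Real.pi_pos]
      have h3 : |inner ℝ ζ (b i)| * ‖𝓕 (chirpMul T w f) ζ‖ ≤ ‖𝓕 (∂_{b i} (chirpMul T w f)) ζ‖ := by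
        rw [h2]
        have h4 : 1 ≤ 2 * Real.pi := by linarith [Real.pi_gt_three]
        exact le_mul_of_one_le_left (by positivity) h4
      have h5 : 𝓕 (∂_{b i} (chirpMul T w f)) ζ = 𝓕 (chirpMul T w (∂_{b i} f)) ζ +
          (-2 * Real.pi * w * Complex.I : ℂ) * ∑ k,
            ((inner ℝ (b i) (T (b k)) + inner ℝ (b k) (T (b i)) : ℝ) : ℂ) *
              𝓕 (chirpMul T w (coordMul (b k) f)) ζ := by
        rw [lineDerivOp_chirpMul, ← FourierTransform.fourierCLM_apply (R := ℂ), map_add, map_smul,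
          map_sum]
        simp only [map_smul, FourierTransform.fourierCLM_apply, _root_.add_apply,
          _root_.smul_apply, _root_.sum_apply, smul_eq_mul, hb]
      have h6 : ∀ k, ‖((inner ℝ (b i) (T (b k)) + inner ℝ (b k) (T (b i)) : ℝ) : ℂ)‖ ≤ 2 * R := by
        intro k
        have h7 : ∀ i k, |inner ℝ (b i) (T (b k))| ≤ R := fun i k => by
          refine (abs_real_inner_le_norm _ _).trans ?_
          rw [b.norm_eq_one, one_mul]
          refine (T.le_opNorm _).trans ?_
          rwa [b.norm_eq_one, mul_one]
        rw [Complex.norm_real, Real.norm_eq_abs]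
        exact (abs_add_le _ _).trans (by linarith [h7 i k, h7 k i])
      have h8 : ‖(-2 * Real.pi * w * Complex.I : ℂ)‖ = 2 * Real.pi * |w| := by
        simp [abs_of_pos Real.pi_pos]
      calc _ = ‖ζ‖ ^ M * (|inner ℝ ζ (b i)| * ‖𝓕 (chirpMul T w f) ζ‖) := by ring
        _ ≤ ‖ζ‖ ^ M * (‖𝓕 (chirpMul T w (∂_{b i} f)) ζ‖ + 2 * Real.pi * |w| *
            ∑ k, 2 * R * ‖𝓕 (chirpMul T w (coordMul (b k) f)) ζ‖) := by
            gcongr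
            refine h3.trans ?_
            rw [h5]
            refine (norm_add_le _ _).trans ?_
            rw [norm_mul, h8]
            gcongr
            refine (norm_sum_le _ _).trans ?_
            gcongr with k
            rw [norm_mul]
            gcongr
            exact h6 k
        _ = ‖ζ‖ ^ M * ‖𝓕 (chirpMul T w (∂_{b i} f)) ζ‖ + 2 * Real.pi * |w| *
            ∑ k, 2 * R * (‖ζ‖ ^ M * ‖𝓕 (chirpMul T w (coordMul (b k) f)) ζ‖) := by
            simp only [mul_add, Finset.mul_sum]
            congr 1
            exact Finset.sum_congr rfl fun k _ => by ring
        _ ≤ C₁ i * (1 + |w|) ^ M + 2 * Real.pi * |w| * ∑ k, 2 * R * (C₂ k * (1 + |w|) ^ M) := by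
            refine add_le_add (hC₁ i T hT w ζ) ?_
            refine mul_le_mul_of_nonneg_left (Finset.sum_le_sum fun k _ => ?_) (by positivity)
            exact mul_le_mul_of_nonneg_left (hC₂ k T hT w ζ) (by positivity)
        _ = (C₁ i * 1 + 2 * Real.pi * |w| * ∑ k, 2 * R * C₂ k) * (1 + |w|) ^ M := by
            rw [add_mul, mul_one, mul_assoc _ (∑ k, 2 * R * C₂ k), Finset.sum_mul]
            congr 2
            exact Finset.sum_congr rfl fun k _ => by ring
        _ ≤ (C₁ i * (1 + |w|) + 2 * Real.pi * (1 + |w|) * ∑ k, 2 * R * C₂ k) * (1 + |w|) ^ M := by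
            have hS : 0 ≤ ∑ k, 2 * R * C₂ k :=
              Finset.sum_nonneg fun k _ => by have := hC₂0 k; positivity
            have := hC₁0 i
            gcongr
            · linarith [abs_nonneg w]
            · linarith
        _ = _ := by ring
    have hζ : ‖ζ‖ ≤ ∑ i, |inner ℝ ζ (b i)| := by
      conv_lhs => rw [← b.sum_repr' ζ]
      refine (norm_sum_le _ _).trans (Finset.sum_le_sum fun i _ => ?_)
      rw [norm_smul, b.norm_eq_one, mul_one, real_inner_comm, Real.norm_eq_abs]
    calc _ = ‖ζ‖ * (‖ζ‖ ^ M * ‖𝓕 (chirpMul T w f) ζ‖) := by ring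
      _ ≤ (∑ i, |inner ℝ ζ (b i)|) * (‖ζ‖ ^ M * ‖𝓕 (chirpMul T w f) ζ‖) := by gcongr
      _ ≤ _ := by
        rw [Finset.sum_mul, Finset.sum_mul]
        exact Finset.sum_le_sum fun i _ => hcomp i

end Chirp

/-! ### Integrals of ridge profiles against Schwartz functions: decay and inversion. -/

section RidgeSlice

variable {E : Type*} [NormedAddCommGroup E] [InnerProductSpace ℝ E]

lemma chirp_mul_phase (T : E →L[ℝ] E) (b : E) (c w : ℝ) (y : E) :
    Complex.exp ((-2 * Real.pi * (w * (inner ℝ y (T y) + inner ℝ y b + c)) : ℝ) * Complex.I)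
      = Complex.exp ((-2 * Real.pi * (w * c) : ℝ) * Complex.I) *
        (Complex.exp ((-2 * Real.pi * inner ℝ y (w • b) : ℝ) * Complex.I) * chirp T w y) := by
  rw [chirp, ← Complex.exp_add, ← Complex.exp_add, inner_smul_right]
  congr 1
  push_cast
  ring

variable [FiniteDimensional ℝ E] [MeasurableSpace E] [BorelSpace E]

/-- The integral of `f` against a ridge profile `g` over the level sets of
`y ↦ ⟪y, T y⟫ + ⟪y, b⟫ + c`. -/
def ridgeSlice (g : 𝓢(ℝ, ℂ)) (f : E → ℂ) (T : E →L[ℝ] E) (b : E) (c : ℝ) : ℂ :=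
  ∫ y, f y * g (inner ℝ y (T y) + inner ℝ y b + c)

lemma integrable_ridgeSlice (g : 𝓢(ℝ, ℂ)) (f : 𝓢(E, ℂ)) (T : E →L[ℝ] E) (b : E) (c : ℝ) :
    Integrable fun y => f y * g (inner ℝ y (T y) + inner ℝ y b + c) := by
  obtain ⟨D, -, hD⟩ := g.exists_one_add_norm_pow_mul_apply_le 0
  refine f.integrable.mul_bdd (c := D) ?_ (.of_forall fun y => ?_)
  · exact (g.continuous.comp (by fun_prop)).aestronglyMeasurable
  · simpa using hD (inner ℝ y (T y) + inner ℝ y b + c)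

lemma fourier_chirpMul_eq (T : E →L[ℝ] E) (w : ℝ) (f : 𝓢(E, ℂ)) (b : E) :
    𝓕 (chirpMul T w f) (w • b) = ∫ y, f y *
      (Complex.exp ((-2 * Real.pi * inner ℝ y (w • b) : ℝ) * Complex.I) * chirp T w y) := by
  rw [SchwartzMap.fourier_coe, Real.fourier_eq']
  refine integral_congr_ae (.of_forall fun y => ?_)
  simp only [chirpMul_apply, smul_eq_mul]
  ring

/-- The ridge slice in terms of Fourier transforms of chirped functions. -/
lemma ridgeSlice_fourier (τ : 𝓢(ℝ, ℂ)) (f : 𝓢(E, ℂ)) (T : E →L[ℝ] E) (b : E) (c : ℝ) :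
    ridgeSlice (𝓕 τ) f T b c = ∫ w : ℝ, τ w *
      (Complex.exp ((-2 * Real.pi * (w * c) : ℝ) * Complex.I) * 𝓕 (chirpMul T w f) (w • b)) := by
  have h1 : ∀ y, f y * 𝓕 τ (inner ℝ y (T y) + inner ℝ y b + c) = ∫ w : ℝ, f y * (τ w *
      Complex.exp ((-2 * Real.pi * (w * (inner ℝ y (T y) + inner ℝ y b + c)) : ℝ) * Complex.I)) := by
    intro y
    rw [integral_const_mul, SchwartzMap.fourier_coe, Real.fourier_eq']
    congr 1
    refine integral_congr_ae (.of_forall fun w => ?_)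
    simp only [smul_eq_mul, RCLike.inner_apply, conj_trivial]
    rw [mul_comm, mul_comm w]
  rw [ridgeSlice]
  simp only [h1]
  rw [integral_integral_swap]
  · refine integral_congr_ae (.of_forall fun w => ?_)
    simp only [chirp_mul_phase, fourier_chirpMul_eq]
    rw [← integral_const_mul, ← integral_const_mul]
    refine integral_congr_ae (.of_forall fun y => ?_)
    simp only
    ring
  · refine (f.integrable.norm.mul_prod τ.integrable.norm).mono' ?_ (.of_forall fun p => ?_)
    · refine Continuous.aestronglyMeasurable ?_
      have := f.continuous
      have := τ.continuous
      simp only [Function.uncurry_def]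
      fun_prop
    · simp only [Function.uncurry]
      rw [norm_mul, norm_mul, Complex.norm_exp_ofReal_mul_I, mul_one]

/-- With `|w| ≥ δ`, decay in the frequency `w • b` is decay in `b`. This is why the profile must
have no frequencies near zero. -/
lemma exists_pow_mul_norm_fourier_smul_le {R : ℝ} (hR : 0 ≤ R) {δ : ℝ} (hδ : 0 < δ) (M : ℕ)
    (f : 𝓢(E, ℂ)) :
    ∃ C, 0 ≤ C ∧ ∀ T : E →L[ℝ] E, ‖T‖ ≤ R → ∀ (w : ℝ) (b : E), δ ≤ |w| →
      (1 + ‖b‖) ^ M * ‖𝓕 (chirpMul T w f) (w • b)‖ ≤ C * (1 + |w|) ^ M := by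
  obtain ⟨C₀, hC₀0, hC₀⟩ := exists_pow_mul_norm_fourier_chirpMul_le R hR 0 f
  obtain ⟨C₁, hC₁0, hC₁⟩ := exists_pow_mul_norm_fourier_chirpMul_le R hR M f
  refine ⟨2 ^ (M - 1) * (C₀ + (δ ^ M)⁻¹ * C₁), by positivity, fun T hT w b hw => ?_⟩
  have h0 := hC₀ T hT w (w • b)
  have h1 := hC₁ T hT w (w • b)
  rw [pow_zero, one_mul, pow_zero, mul_one] at h0
  set F := ‖𝓕 (chirpMul T w f) (w • b)‖ with hF
  have hF0 : 0 ≤ F := norm_nonneg _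
  have h2 : ‖b‖ ^ M * F ≤ (δ ^ M)⁻¹ * C₁ * (1 + |w|) ^ M := by
    rw [mul_assoc, le_inv_mul_iff₀ (by positivity)]
    refine le_trans ?_ h1
    rw [norm_smul, mul_pow, Real.norm_eq_abs, mul_assoc]
    gcongr
  have h3 : (1 + ‖b‖) ^ M ≤ 2 ^ (M - 1) * (1 ^ M + ‖b‖ ^ M) :=
    add_pow_le zero_le_one (norm_nonneg _) M
  calc _ ≤ (2 ^ (M - 1) * (1 ^ M + ‖b‖ ^ M)) * F := by gcongr
    _ = 2 ^ (M - 1) * (F + ‖b‖ ^ M * F) := by ring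
    _ ≤ 2 ^ (M - 1) * (C₀ * (1 + |w|) ^ M + (δ ^ M)⁻¹ * C₁ * (1 + |w|) ^ M) := by
      gcongr
      refine h0.trans (le_mul_of_one_le_right hC₀0 (one_le_pow₀ ?_))
      linarith [abs_nonneg w]
    _ = _ := by ring

lemma integrable_norm_mul_one_add_pow (τ : 𝓢(ℝ, ℂ)) (M : ℕ) :
    Integrable fun w : ℝ => ‖τ w‖ * (1 + |w|) ^ M := by
  have h1 : ∀ w : ℝ, ‖τ w‖ * (1 + |w|) ^ M
      = ∑ i ∈ Finset.range (M + 1), (M.choose i : ℝ) * (‖w‖ ^ i * ‖τ w‖) := by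
    intro s
    rw [add_comm 1 |s|, add_pow]
    simp only [one_pow, mul_one, Real.norm_eq_abs]
    rw [Finset.mul_sum]
    exact Finset.sum_congr rfl fun i _ => by ring
  simp only [h1]
  exact integrable_finsetSum _ fun i _ => (τ.integrable_pow_mul volume _).const_mul _

/-- Decay in the slope, from the Fourier side: the growth `(1 + |w|) ^ M` caused by the chirp is
absorbed by `τ`. -/
lemma exists_ridgeSlice_decay_left {R : ℝ} (hR : 0 ≤ R) {δ : ℝ} (hδ : 0 < δ) (M : ℕ)
    {τ : 𝓢(ℝ, ℂ)} (hτ : ∀ w, |w| < δ → τ w = 0) (f : 𝓢(E, ℂ)) :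
    ∃ C, 0 ≤ C ∧ ∀ T : E →L[ℝ] E, ‖T‖ ≤ R → ∀ (b : E) (c : ℝ),
      (1 + ‖b‖) ^ M * ‖ridgeSlice (𝓕 τ) f T b c‖ ≤ C := by
  obtain ⟨C, hC0, hC⟩ := exists_pow_mul_norm_fourier_smul_le hR hδ M f
  refine ⟨∫ w : ℝ, C * (‖τ w‖ * (1 + |w|) ^ M), integral_nonneg fun w => by positivity,
    fun T hT b c => ?_⟩
  rw [ridgeSlice_fourier]
  have h1 : (1 + ‖b‖) ^ M = ‖(((1 + ‖b‖) ^ M : ℝ) : ℂ)‖ := by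
    rw [Complex.norm_real, Real.norm_of_nonneg (by positivity)]
  rw [h1, ← norm_mul, ← integral_const_mul]
  refine norm_integral_le_of_norm_le ((integrable_norm_mul_one_add_pow τ M).const_mul C)
    (.of_forall fun w => ?_)
  rw [norm_mul, norm_mul, norm_mul, ← h1, Complex.norm_exp_ofReal_mul_I, one_mul]
  by_cases hw : |w| < δ
  · rw [hτ w hw]
    simp
  · calc _ = ‖τ w‖ * ((1 + ‖b‖) ^ M * ‖𝓕 (chirpMul T w f) (w • b)‖) := by ring
      _ ≤ ‖τ w‖ * (C * (1 + |w|) ^ M) := by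
        exact mul_le_mul_of_nonneg_left (hC T hT w b (not_lt.1 hw)) (norm_nonneg _)
      _ = _ := by ring

/-- Decay in the offset, from the space side: a large `c` forces a large argument of `g`, a large
`y`, or a large `b`. The first two are controlled by `g` and `f`; the last costs `(1 + ‖b‖) ^ N`. -/
lemma exists_ridgeSlice_decay_right {R : ℝ} (hR : 0 ≤ R) (N : ℕ) (g : 𝓢(ℝ, ℂ)) (f : 𝓢(E, ℂ)) :
    ∃ C, 0 ≤ C ∧ ∀ T : E →L[ℝ] E, ‖T‖ ≤ R → ∀ (b : E) (c : ℝ),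
      (1 + |c|) ^ N * ‖ridgeSlice g f T b c‖ ≤ C * (1 + ‖b‖) ^ N := by
  obtain ⟨D, hD0, hD⟩ := g.exists_one_add_norm_pow_mul_apply_le N
  have hint : Integrable fun y : E => ‖f y‖ * (1 + ‖y‖) ^ (2 * N) := by
    have h1 : ∀ y : E, ‖f y‖ * (1 + ‖y‖) ^ (2 * N)
        = ∑ i ∈ Finset.range (2 * N + 1), ((2 * N).choose i : ℝ) * (‖y‖ ^ i * ‖f y‖) := by
      intro s
      rw [add_comm 1 ‖s‖, add_pow]
      simp only [one_pow, mul_one]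
      rw [Finset.mul_sum]
      exact Finset.sum_congr rfl fun i _ => by ring
    simp only [h1]
    exact integrable_finsetSum _ fun i _ => (f.integrable_pow_mul volume _).const_mul _
  refine ⟨D * (1 + R) ^ N * ∫ y : E, ‖f y‖ * (1 + ‖y‖) ^ (2 * N), ?_, fun T hT b c => ?_⟩
  · have : 0 ≤ ∫ y : E, ‖f y‖ * (1 + ‖y‖) ^ (2 * N) := integral_nonneg fun y => by positivity
    positivity
  have h1 : (1 + |c|) ^ N = ‖(((1 + |c|) ^ N : ℝ) : ℂ)‖ := by
    rw [Complex.norm_real, Real.norm_of_nonneg (by positivity)]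
  rw [h1, ← norm_mul, ridgeSlice, ← integral_const_mul, mul_right_comm, ← integral_const_mul]
  refine norm_integral_le_of_norm_le (hint.const_mul _) (.of_forall fun y => ?_)
  rw [norm_mul, norm_mul, ← h1]
  set u := inner ℝ y (T y) + inner ℝ y b + c with hu
  have h2 : 1 + |c| ≤ (1 + ‖u‖) * ((1 + R) * (1 + ‖y‖) ^ 2 * (1 + ‖b‖)) := by
    have h3 : |inner ℝ y (T y)| ≤ ‖y‖ * (R * ‖y‖) := by
      refine (abs_real_inner_le_norm _ _).trans ?_
      gcongr
      exact (T.le_opNorm y).trans (by gcongr)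
    have h4 : |inner ℝ y b| ≤ ‖y‖ * ‖b‖ := abs_real_inner_le_norm _ _
    have h5 : |c| ≤ ‖u‖ + (|inner ℝ y (T y)| + |inner ℝ y b|) := by
      have : c = u - (inner ℝ y (T y) + inner ℝ y b) := by rw [hu]; ring
      rw [this, Real.norm_eq_abs]
      exact (abs_sub _ _).trans (by gcongr; exact abs_add_le _ _)
    have h6 : 1 + (‖y‖ * (R * ‖y‖) + ‖y‖ * ‖b‖) ≤ (1 + R) * (1 + ‖y‖) ^ 2 * (1 + ‖b‖) := by
      have hy := norm_nonneg y
      have hb := norm_nonneg b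
      have e : (1 + R) * (1 + ‖y‖) ^ 2 * (1 + ‖b‖) - (1 + (‖y‖ * (R * ‖y‖) + ‖y‖ * ‖b‖))
          = ‖y‖ * 2 + ‖y‖ ^ 2 + ‖b‖ + ‖b‖ * ‖y‖ + ‖b‖ * ‖y‖ ^ 2 + R * (1 + ‖y‖ * 2)
            + R * (1 + ‖y‖) ^ 2 * ‖b‖ := by ring
      have : 0 ≤ ‖y‖ * 2 + ‖y‖ ^ 2 + ‖b‖ + ‖b‖ * ‖y‖ + ‖b‖ * ‖y‖ ^ 2 + R * (1 + ‖y‖ * 2)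
            + R * (1 + ‖y‖) ^ 2 * ‖b‖ := by positivity
      linarith
    calc 1 + |c| ≤ 1 + (‖u‖ + (‖y‖ * (R * ‖y‖) + ‖y‖ * ‖b‖)) := by linarith
      _ ≤ (1 + ‖u‖) * (1 + (‖y‖ * (R * ‖y‖) + ‖y‖ * ‖b‖)) := by
        have : 0 ≤ ‖u‖ * (‖y‖ * (R * ‖y‖) + ‖y‖ * ‖b‖) := by positivity
        linarith [add_mul 1 ‖u‖ (1 + (‖y‖ * (R * ‖y‖) + ‖y‖ * ‖b‖))]
      _ ≤ _ := by gcongr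
  calc (1 + |c|) ^ N * (‖f y‖ * ‖g u‖)
      ≤ ((1 + ‖u‖) * ((1 + R) * (1 + ‖y‖) ^ 2 * (1 + ‖b‖))) ^ N * (‖f y‖ * ‖g u‖) := by gcongr
    _ = ((1 + ‖u‖) ^ N * ‖g u‖) * ((1 + R) ^ N * (1 + ‖b‖) ^ N * (‖f y‖ * (1 + ‖y‖) ^ (2 * N))) := by
        rw [mul_pow, mul_pow, mul_pow, ← pow_mul]
        ring
    _ ≤ D * ((1 + R) ^ N * (1 + ‖b‖) ^ N * (‖f y‖ * (1 + ‖y‖) ^ (2 * N))) := by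
        gcongr
        exact hD u
    _ = _ := by ring

/-- Rapid decay of ridge slices, uniformly for bounded `T`. -/
lemma exists_ridgeSlice_decay {R : ℝ} (hR : 0 ≤ R) {δ : ℝ} (hδ : 0 < δ) (M N : ℕ)
    {τ : 𝓢(ℝ, ℂ)} (hτ : ∀ w, |w| < δ → τ w = 0) (f : 𝓢(E, ℂ)) :
    ∃ C, 0 ≤ C ∧ ∀ T : E →L[ℝ] E, ‖T‖ ≤ R → ∀ (b : E) (c : ℝ),
      ‖ridgeSlice (𝓕 τ) f T b c‖ ≤ C * (((1 + ‖b‖) ^ M)⁻¹ * ((1 + |c|) ^ N)⁻¹) := by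
  -- The geometric mean of the two estimates. Exponents are doubled for the square root, and the
  -- extra `2 * N` offsets the loss in `b` of the second estimate.
  obtain ⟨C₁, hC₁0, hC₁⟩ := exists_ridgeSlice_decay_left hR hδ (2 * M + 2 * N) hτ f
  obtain ⟨C₂, hC₂0, hC₂⟩ := exists_ridgeSlice_decay_right hR (2 * N) (𝓕 τ) f
  refine ⟨√(C₁ * C₂), Real.sqrt_nonneg _, fun T hT b c => ?_⟩
  have h1 := hC₁ T hT b c
  have h2 := hC₂ T hT b c
  set G := ‖ridgeSlice (𝓕 τ) f T b c‖ with hG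
  have hG0 : 0 ≤ G := norm_nonneg _
  rw [← mul_inv, ← div_eq_mul_inv, le_div_iff₀ (by positivity)]
  refine Real.le_sqrt_of_sq_le ?_
  have h3 : 0 < (1 + ‖b‖) ^ (2 * N) := by positivity
  refine le_of_mul_le_mul_right ?_ h3
  calc _ = ((1 + ‖b‖) ^ (2 * M + 2 * N) * G) * ((1 + |c|) ^ (2 * N) * G) := by
        rw [pow_add, pow_mul', pow_mul', pow_mul']
        ring
    _ ≤ C₁ * (C₂ * (1 + ‖b‖) ^ (2 * N)) := mul_le_mul h1 h2 (by positivity) hC₁0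
    _ = _ := by ring

/-- Integrating a ridge slice over its slope parameter evaluates the function at the origin. -/
lemma integral_ridgeSlice {δ : ℝ} (hδ : 0 < δ) {τ χ : 𝓢(ℝ, ℂ)} (hτ : ∀ w, |w| < δ → τ w = 0)
    (hχ : ∀ w, |w| < δ → χ w = 0)
    (hτχ : ∀ w, τ w = ((|w| ^ Module.finrank ℝ E : ℝ) : ℂ) * χ w) (f : 𝓢(E, ℂ)) (T : E →L[ℝ] E)
    (c : ℝ) : ∫ b, ridgeSlice (𝓕 τ) f T b c = f 0 * 𝓕 χ c := by
  simp only [ridgeSlice_fourier]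
  -- Fourier inversion at the origin, where the chirp equals one for all `T` and `w`.
  have hinv : ∀ w : ℝ, ∫ ζ, 𝓕 (chirpMul T w f) ζ = f 0 := by
    intro w
    have h1 : 𝓕⁻ (𝓕 (chirpMul T w f)) 0 = chirpMul T w f 0 := by
      rw [FourierTransform.fourierInv_fourier_eq]
    rw [SchwartzMap.fourierInv_coe, Real.fourierInv_eq'] at h1
    simpa [chirpMul_apply, chirp] using h1
  have hin : ∀ w : ℝ, ∫ b, τ w * (Complex.exp ((-2 * Real.pi * (w * c) : ℝ) * Complex.I) *
      𝓕 (chirpMul T w f) (w • b))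
      = f 0 * (Complex.exp ((-2 * Real.pi * (w * c) : ℝ) * Complex.I) * χ w) := by
    intro w
    by_cases hw : |w| < δ
    · simp [hτ w hw, hχ w hw]
    · have hw0 : 0 < |w| := hδ.trans_le (not_lt.1 hw)
      -- The Jacobian of `b ↦ w • b` is what the power of `|w|` in `τ` was inserted to cancel.
      rw [integral_const_mul, integral_const_mul, Measure.integral_comp_smul, hinv, hτχ,
        abs_inv, abs_pow, Complex.real_smul, Complex.ofReal_inv]
      have h2 : ((|w| ^ Module.finrank ℝ E : ℝ) : ℂ) ≠ 0 := by
        exact_mod_cast (pow_pos hw0 _).ne'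
      field_simp
  rw [integral_integral_swap]
  · simp only [hin]
    rw [integral_const_mul, SchwartzMap.fourier_coe, Real.fourier_eq']
    congr 1
    refine integral_congr_ae (.of_forall fun w => ?_)
    simp only [smul_eq_mul, RCLike.inner_apply, conj_trivial]
    rw [mul_comm w]
  · set M := (volume : Measure E).integrablePower with hM
    obtain ⟨C, hC0, hC⟩ := exists_pow_mul_norm_fourier_smul_le (norm_nonneg T) hδ M f
    have hb : Integrable fun b : E => (1 + ‖b‖) ^ (-(M : ℝ)) :=
      Measure.integrable_pow_neg_integrablePower volume
    refine (hb.mul_prod ((integrable_norm_mul_one_add_pow τ M).const_mul C)).mono' ?_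
      (.of_forall fun p => ?_)
    · have h1 : StronglyMeasurable fun p : E × ℝ => 𝓕 (chirpMul T p.2 f) (p.2 • p.1) := by
        simp only [fourier_chirpMul_eq]
        refine StronglyMeasurable.integral_prod_right (f := fun (p : E × ℝ) (y : E) => f y *
          (Complex.exp ((-2 * Real.pi * inner ℝ y (p.2 • p.1) : ℝ) * Complex.I) * chirp T p.2 y)) ?_
        refine Continuous.stronglyMeasurable ?_
        have := f.continuous
        simp only [Function.uncurry_def, chirp]
        fun_prop
      have h2 : Continuous fun p : E × ℝ => τ p.2 := τ.continuous.comp continuous_snd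
      have h3 : Continuous fun p : E × ℝ =>
          Complex.exp ((-2 * Real.pi * (p.2 * c) : ℝ) * Complex.I) := by fun_prop
      exact (h2.stronglyMeasurable.mul (h3.stronglyMeasurable.mul h1)).aestronglyMeasurable
    · obtain ⟨b, w⟩ := p
      simp only [Function.uncurry]
      rw [norm_mul, norm_mul, Complex.norm_exp_ofReal_mul_I, one_mul]
      by_cases hw : |w| < δ
      · rw [hτ w hw]
        simp only [norm_zero, zero_mul, mul_zero, le_refl]
      · have h4 := hC T le_rfl w b (not_lt.1 hw)
        rw [Real.rpow_neg (by positivity), Real.rpow_natCast, le_inv_mul_iff₀ (by positivity)]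
        calc _ = ‖τ w‖ * ((1 + ‖b‖) ^ M * ‖𝓕 (chirpMul T w f) (w • b)‖) := by ring
          _ ≤ ‖τ w‖ * (C * (1 + |w|) ^ M) := mul_le_mul_of_nonneg_left h4 (norm_nonneg _)
          _ = _ := by ring

end RidgeSlice

/-! ### The quadratic feature map and the action of the affine group -/

/-- Expanding `(t + Lx)` in the transported polynomial, all terms involving `t` cancel; symmetry of
`A` merges the two cross terms. -/
lemma quadForm_smul {m : ℕ} (g : AffGroup m) (x : DataDom m) (ξ : QuadParam m) :
    quadForm (g • x) (g • ξ) = quadForm x ξ := by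
  obtain ⟨A, b, c⟩ := ξ
  change (g.t + g.L *ᵥ x.ofLp) ⬝ᵥ ((g.Linvᵀ * A.1 * g.Linv) *ᵥ (g.t + g.L *ᵥ x.ofLp))
      + (g.t + g.L *ᵥ x.ofLp) ⬝ᵥ (g.Linvᵀ *ᵥ b.ofLp - (2 : ℝ) • ((g.Linvᵀ * A.1 * g.Linv) *ᵥ g.t))
      + (c + g.t ⬝ᵥ ((g.Linvᵀ * A.1 * g.Linv) *ᵥ g.t) - g.t ⬝ᵥ (g.Linvᵀ *ᵥ b.ofLp))
    = x.ofLp ⬝ᵥ (A.1 *ᵥ x.ofLp) + x.ofLp ⬝ᵥ b.ofLp + c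
  rw [smul_aux_mulVec]
  simp only [add_dotProduct, dotProduct_add, dotProduct_sub, dotProduct_smul, smul_eq_mul,
    smul_aux_dot, smul_aux_symm g x.ofLp A.2]
  ring

lemma isJointInvariant_quadFeature {Y : Type*} (m : ℕ) (σ : ℝ → Y) :
    IsJointInvariant (AffGroup m) (quadFeature m σ) := fun g x ξ => by
  rw [quadFeature, quadFeature, quadForm_smul]

instance (m : ℕ) : SecondCountableTopology (SymMat m) :=
  (symHomeo m).symm.isEmbedding.secondCountableTopology

lemma continuous_smul_quadParam {m : ℕ} (g : AffGroup m) :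
    Continuous fun ξ : QuadParam m => g • ξ := by
  have hA : Continuous fun ξ : QuadParam m => ξ.1.1 := continuous_subtype_val.comp continuous_fst
  have hb : Continuous fun ξ : QuadParam m => ξ.2.1.ofLp :=
    (PiLp.continuous_ofLp 2 _).comp (continuous_fst.comp continuous_snd)
  have hc : Continuous fun ξ : QuadParam m => ξ.2.2 := continuous_snd.comp continuous_snd
  have hA' : Continuous fun ξ : QuadParam m => g.Linvᵀ * ξ.1.1 * g.Linv :=
    (continuous_const.matrix_mul hA).matrix_mul continuous_const
  have hAt := hA'.matrix_mulVec (continuous_const (y := g.t))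
  have hb' : Continuous fun ξ : QuadParam m => g.Linvᵀ *ᵥ ξ.2.1.ofLp :=
    continuous_const.matrix_mulVec hb
  refine (hA'.subtype_mk _).prodMk (Continuous.prodMk ?_ ?_)
  · exact (PiLp.continuous_toLp 2 _).comp (hb'.sub (hAt.const_smul (2 : ℝ)))
  · exact (hc.add (continuous_const.dotProduct hAt)).sub (continuous_const.dotProduct hb')

/-- The action of a group element on the parameter domain as a homeomorphism. -/
def quadHomeo {m : ℕ} (g : AffGroup m) : QuadParam m ≃ₜ QuadParam m where
  toEquiv := MulAction.toPerm g
  continuous_toFun := continuous_smul_quadParam g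
  continuous_invFun := continuous_smul_quadParam g⁻¹

/-- Coordinates on the parameter domain. -/
def paramCoord (m : ℕ) : QuadParam m ≃ₜ (LowerIdx m → ℝ) × DataDom m × ℝ :=
  (symHomeo m).symm.prodCongr (Homeomorph.refl _)

lemma measurePreserving_paramCoord_symm (m : ℕ) : MeasurePreserving (paramCoord m).symm :=
  (measurePreserving_symHomeo m).prod (MeasurePreserving.id _)

/-- In coordinates, each group element acts linearly on the parameter domain. -/
def quadLinear {m : ℕ} (g : AffGroup m) :
    ((LowerIdx m → ℝ) × DataDom m × ℝ) →ₗ[ℝ] (LowerIdx m → ℝ) × DataDom m × ℝ where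
  toFun v := paramCoord m (g • (paramCoord m).symm v)
  map_add' v w := by
    have hs : (symHomeo m (v.1 + w.1)).1 = (symHomeo m v.1).1 + (symHomeo m w.1).1 := by
      ext i j; rfl
    refine Prod.ext ?_ (Prod.ext ?_ ?_)
    · funext p
      change (g.Linvᵀ * (symHomeo m (v.1 + w.1)).1 * g.Linv) p.1.1 p.1.2
        = (g.Linvᵀ * (symHomeo m v.1).1 * g.Linv) p.1.1 p.1.2
          + (g.Linvᵀ * (symHomeo m w.1).1 * g.Linv) p.1.1 p.1.2
      rw [hs, Matrix.mul_add, Matrix.add_mul, Matrix.add_apply]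
    · refine congrArg (WithLp.toLp 2) ?_
      change g.Linvᵀ *ᵥ (v.2.1.ofLp + w.2.1.ofLp)
          - (2 : ℝ) • ((g.Linvᵀ * (symHomeo m (v.1 + w.1)).1 * g.Linv) *ᵥ g.t)
        = (g.Linvᵀ *ᵥ v.2.1.ofLp - (2 : ℝ) • ((g.Linvᵀ * (symHomeo m v.1).1 * g.Linv) *ᵥ g.t))
          + (g.Linvᵀ *ᵥ w.2.1.ofLp - (2 : ℝ) • ((g.Linvᵀ * (symHomeo m w.1).1 * g.Linv) *ᵥ g.t))
      rw [hs, Matrix.mul_add, Matrix.add_mul, Matrix.add_mulVec, Matrix.mulVec_add, smul_add]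
      abel
    · change (v.2.2 + w.2.2) + g.t ⬝ᵥ ((g.Linvᵀ * (symHomeo m (v.1 + w.1)).1 * g.Linv) *ᵥ g.t)
          - g.t ⬝ᵥ (g.Linvᵀ *ᵥ (v.2.1.ofLp + w.2.1.ofLp))
        = (v.2.2 + g.t ⬝ᵥ ((g.Linvᵀ * (symHomeo m v.1).1 * g.Linv) *ᵥ g.t)
            - g.t ⬝ᵥ (g.Linvᵀ *ᵥ v.2.1.ofLp))
          + (w.2.2 + g.t ⬝ᵥ ((g.Linvᵀ * (symHomeo m w.1).1 * g.Linv) *ᵥ g.t)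
            - g.t ⬝ᵥ (g.Linvᵀ *ᵥ w.2.1.ofLp))
      rw [hs, Matrix.mul_add, Matrix.add_mul, Matrix.add_mulVec, Matrix.mulVec_add, dotProduct_add,
        dotProduct_add]
      ring
  map_smul' r v := by
    have hs : (symHomeo m (r • v.1)).1 = r • (symHomeo m v.1).1 := by
      ext i j; rfl
    refine Prod.ext ?_ (Prod.ext ?_ ?_)
    · funext p
      change (g.Linvᵀ * (symHomeo m (r • v.1)).1 * g.Linv) p.1.1 p.1.2
        = r * (g.Linvᵀ * (symHomeo m v.1).1 * g.Linv) p.1.1 p.1.2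
      rw [hs, Matrix.mul_smul, Matrix.smul_mul, Matrix.smul_apply, smul_eq_mul]
    · refine congrArg (WithLp.toLp 2) ?_
      change g.Linvᵀ *ᵥ (r • v.2.1.ofLp)
          - (2 : ℝ) • ((g.Linvᵀ * (symHomeo m (r • v.1)).1 * g.Linv) *ᵥ g.t)
        = r • (g.Linvᵀ *ᵥ v.2.1.ofLp - (2 : ℝ) • ((g.Linvᵀ * (symHomeo m v.1).1 * g.Linv) *ᵥ g.t))
      rw [hs, Matrix.mul_smul, Matrix.smul_mul, Matrix.smul_mulVec, Matrix.mulVec_smul, smul_sub,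
        smul_comm r]
    · change (r * v.2.2) + g.t ⬝ᵥ ((g.Linvᵀ * (symHomeo m (r • v.1)).1 * g.Linv) *ᵥ g.t)
          - g.t ⬝ᵥ (g.Linvᵀ *ᵥ (r • v.2.1.ofLp))
        = r * (v.2.2 + g.t ⬝ᵥ ((g.Linvᵀ * (symHomeo m v.1).1 * g.Linv) *ᵥ g.t)
            - g.t ⬝ᵥ (g.Linvᵀ *ᵥ v.2.1.ofLp))
      rw [hs, Matrix.mul_smul, Matrix.smul_mul, Matrix.smul_mulVec, Matrix.mulVec_smul,
        dotProduct_smul, dotProduct_smul, smul_eq_mul, smul_eq_mul]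
      ring

lemma quadLinear_bijective {m : ℕ} (g : AffGroup m) : Function.Bijective (quadLinear g) :=
  (paramCoord m).bijective.comp ((MulAction.bijective g).comp (paramCoord m).symm.bijective)

/-- Each group element scales the measure of the parameter domain. -/
lemma exists_map_smul_quadParam {m : ℕ} (g : AffGroup m) :
    ∃ J : ℝ, 0 < J ∧ Measure.map (fun ξ : QuadParam m => g • ξ) volume
      = ENNReal.ofReal J • (volume : Measure (QuadParam m)) := by
  have hdet : LinearMap.det (quadLinear g) ≠ 0 :=
    (LinearEquiv.isUnit_det' (LinearEquiv.ofBijective _ (quadLinear_bijective g))).ne_zero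
  -- The value of this Jacobian is never needed: positivity is enough for the norm argument in
  -- `exists_isReconstruction`.
  refine ⟨|(LinearMap.det (quadLinear g))⁻¹|, by positivity, ?_⟩
  have hmp := measurePreserving_paramCoord_symm m
  have : (volume : Measure (DataDom m × ℝ)).IsAddHaarMeasure :=
    inferInstanceAs (Measure.prod volume volume).IsAddHaarMeasure
  have : (volume : Measure ((LowerIdx m → ℝ) × DataDom m × ℝ)).IsAddHaarMeasure :=
    Measure.prod.instIsAddHaarMeasure volume volume
  have h1 := Measure.map_linearMap_addHaar_eq_smul_addHaar
    (volume : Measure ((LowerIdx m → ℝ) × DataDom m × ℝ)) hdet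
  have h2 : (fun ξ : QuadParam m => g • ξ) ∘ (paramCoord m).symm
      = (paramCoord m).symm ∘ quadLinear g := by
    funext v
    exact ((paramCoord m).symm_apply_apply _).symm
  have hq : Measurable (quadLinear g) :=
    (LinearMap.continuous_of_finiteDimensional _).measurable
  rw [← hmp.map_eq, Measure.map_map (continuous_smul_quadParam g).measurable hmp.measurable, h2,
    ← Measure.map_map hmp.measurable hq, h1, Measure.map_smul]

/-- Translations preserve the measure of the parameter domain. -/
lemma measurePreserving_translation {m : ℕ} (v : DataDom m) :
    MeasurePreserving fun ξ : QuadParam m =>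
      (SemidirectProduct.inl (Multiplicative.ofAdd v) : AffGroup m) • ξ := by
  set g : AffGroup m := SemidirectProduct.inl (Multiplicative.ofAdd v) with hg
  have hLi : g.Linv = 1 := by simp [AffGroup.Linv, hg]
  have hinner : ∀ A : SymMat m, MeasurePreserving fun p : DataDom m × ℝ =>
      (g • ((A, p) : QuadParam m)).2 := by
    intro A
    -- For fixed `A` the map is a shear: `b` moves by a constant, and `c` by an amount depending
    -- only on `b`.
    have h := (measurePreserving_add_right (volume : Measure (DataDom m))
      (WithLp.toLp 2 (-((2 : ℝ) • ((g.Linvᵀ * A.1 * g.Linv) *ᵥ g.t))))).skew_product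
      (g := fun (b : DataDom m) (c : ℝ) => c + g.t ⬝ᵥ ((g.Linvᵀ * A.1 * g.Linv) *ᵥ g.t)
        - g.t ⬝ᵥ (g.Linvᵀ *ᵥ b.ofLp)) (μc := volume) (μd := volume) ?_ (.of_forall fun b => ?_)
    · refine Eq.mp (congrArg (fun φ => MeasurePreserving φ volume volume) (funext fun p => ?_)) h
      refine Prod.ext (congrArg (WithLp.toLp 2) ?_) rfl
      change p.1.ofLp + -_ = g.Linvᵀ *ᵥ p.1.ofLp - _
      rw [sub_eq_add_neg, hLi, Matrix.transpose_one, Matrix.one_mulVec]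
    · refine Continuous.measurable ?_
      refine (continuous_snd.add continuous_const).sub (continuous_const.dotProduct
        (continuous_const.matrix_mulVec ((PiLp.continuous_ofLp 2 _).comp continuous_fst)))
    · simp only [add_sub_assoc]
      exact map_add_right_eq_self _ _
  have h := (MeasurePreserving.id (volume : Measure (SymMat m))).skew_product
    (g := fun (A : SymMat m) (p : DataDom m × ℝ) => (g • ((A, p) : QuadParam m)).2)
    (μc := volume) (μd := volume) ?_ (.of_forall fun A => (hinner A).map_eq)
  · refine Eq.mp (congrArg (fun φ => MeasurePreserving φ volume volume) (funext fun ξ => ?_)) h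
    refine Prod.ext (Subtype.ext ?_) rfl
    change ξ.1.1 = g.Linvᵀ * ξ.1.1 * g.Linv
    rw [hLi, Matrix.transpose_one, Matrix.one_mul, Matrix.mul_one]
  · exact (continuous_snd.comp (continuous_smul_quadParam g)).measurable

/-- The linear map of a symmetric matrix. -/
def symCLM {m : ℕ} (A : SymMat m) : DataDom m →L[ℝ] DataDom m :=
  LinearMap.toContinuousLinearMap (Matrix.toEuclideanLin A.1)

lemma quadForm_eq {m : ℕ} (x : DataDom m) (ξ : QuadParam m) :
    quadForm x ξ = inner ℝ x (symCLM ξ.1 x) + inner ℝ x ξ.2.1 + ξ.2.2 := by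
  rw [quadForm, EuclideanSpace.inner_eq_star_dotProduct, EuclideanSpace.inner_eq_star_dotProduct,
    dotProduct_comm x.ofLp, dotProduct_comm x.ofLp]
  rfl

lemma continuous_symCLM (m : ℕ) : Continuous (symCLM (m := m)) := by
  have h : Continuous (LinearMap.toContinuousLinearMap.toLinearMap ∘ₗ
      (Matrix.toEuclideanLin (𝕜 := ℝ) (m := Fin m) (n := Fin m)).toLinearMap :
        Matrix (Fin m) (Fin m) ℝ →ₗ[ℝ] (DataDom m →L[ℝ] DataDom m)) :=
    LinearMap.continuous_of_finiteDimensional _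
  exact h.comp continuous_subtype_val

/-! ### The ridgelet transform as a right inverse of the network -/

section SliceNetwork

variable {E : Type*} [NormedAddCommGroup E] [InnerProductSpace ℝ E] [FiniteDimensional ℝ E]
  [MeasurableSpace E] [BorelSpace E]

lemma continuous_ridgeSlice (g : 𝓢(ℝ, ℂ)) (f : 𝓢(E, ℂ)) {X : Type*} [TopologicalSpace X]
    [FirstCountableTopology X] {T : X → E →L[ℝ] E} (hT : Continuous T) {b : X → E}
    (hb : Continuous b) {c : X → ℝ} (hc : Continuous c) :
    Continuous fun x => ridgeSlice g f (T x) (b x) (c x) := by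
  obtain ⟨D, hD0, hD⟩ := g.exists_one_add_norm_pow_mul_apply_le 0
  refine continuous_of_dominated (bound := fun y => ‖f y‖ * D) (fun x => ?_)
    (fun x => .of_forall fun y => ?_) (f.integrable.norm.mul_const D) (.of_forall fun y => ?_)
  · exact (integrable_ridgeSlice g f (T x) (b x) (c x)).1
  · rw [norm_mul]
    gcongr
    simpa using hD _
  · exact continuous_const.mul (g.continuous.comp (by fun_prop))

lemma integrable_one_add_norm_pow_inv :
    Integrable fun b : E => ((1 + ‖b‖) ^ (volume : Measure E).integrablePower)⁻¹ := by
  have h : Integrable fun b : E => (1 + ‖b‖) ^ (-((volume : Measure E).integrablePower : ℝ)) :=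
    Measure.integrable_pow_neg_integrablePower volume
  refine h.congr (.of_forall fun b => ?_)
  simp only
  rw [Real.rpow_neg (by positivity), Real.rpow_natCast]

lemma aestronglyMeasurable_of_tempered {σ : ℝ → ℂ} (hσ : IsTemperedFun σ) :
    AEStronglyMeasurable σ := by
  obtain ⟨k, hk⟩ := hσ
  have h1 : σ = fun t : ℝ => ((1 + |t|) ^ k : ℝ) • ((((1 + |t|) ^ k)⁻¹ : ℝ) • σ t) := by
    funext t
    have h1 : (1 + |t|) ^ k ≠ 0 := by positivity
    rw [smul_smul, mul_inv_cancel₀ h1, one_smul]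
  have h2 : AEStronglyMeasurable (fun t : ℝ => (1 + |t|) ^ k) :=
    (by fun_prop : Continuous fun t : ℝ => (1 + |t|) ^ k).aestronglyMeasurable
  rw [h1]
  exact h2.smul hk.1

/-- The slice decays integrably in `b` and to the tempered order of `σ` in `c`, so Fubini allows
integrating over `b` first, where the inversion formula applies. -/
lemma ridgeSlice_machine {σ : ℝ → ℂ} (hσ : IsTemperedFun σ) {δ : ℝ} (hδ : 0 < δ) {τ χ : 𝓢(ℝ, ℂ)}
    (hτ : ∀ w, |w| < δ → τ w = 0) (hχ : ∀ w, |w| < δ → χ w = 0)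
    (hτχ : ∀ w, τ w = ((|w| ^ Module.finrank ℝ E : ℝ) : ℂ) * χ w) (f : 𝓢(E, ℂ)) (T : E →L[ℝ] E) :
    ∫ p : E × ℝ, ridgeSlice (𝓕 τ) f T p.1 p.2 * σ p.2 = f 0 * ∫ t, σ t * 𝓕 χ t := by
  obtain ⟨k, hk⟩ := id hσ
  obtain ⟨C, hC0, hC⟩ := exists_ridgeSlice_decay (norm_nonneg T) hδ
    (volume : Measure E).integrablePower k hτ f
  have hint : Integrable (fun p : E × ℝ => ridgeSlice (𝓕 τ) f T p.1 p.2 * σ p.2)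
      ((volume : Measure E).prod volume) := by
    refine ((integrable_one_add_norm_pow_inv (E := E)).const_mul C).mul_prod hk.norm |>.mono' ?_
      (.of_forall fun p => ?_)
    · exact (continuous_ridgeSlice (𝓕 τ) f continuous_const continuous_fst
        continuous_snd).aestronglyMeasurable.mul (aestronglyMeasurable_of_tempered hσ).comp_snd
    · rw [norm_mul, norm_smul, Real.norm_of_nonneg (by positivity)]
      calc _ ≤ (C * (((1 + ‖p.1‖) ^ (volume : Measure E).integrablePower)⁻¹
            * ((1 + |p.2|) ^ k)⁻¹)) * ‖σ p.2‖ := by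
            gcongr
            exact hC T le_rfl p.1 p.2
        _ = _ := by ring
  have hvol : (volume : Measure (E × ℝ)) = (volume : Measure E).prod volume := rfl
  rw [hvol, integral_prod_symm _ hint]
  simp only
  rw [← integral_const_mul]
  refine integral_congr_ae (.of_forall fun c => ?_)
  simp only
  rw [integral_mul_const, integral_ridgeSlice hδ hτ hχ hτχ]
  ring

end SliceNetwork

/-! ### Windowed ridgelet transforms on the whole parameter domain. -/

section Network

variable {m : ℕ}

/-- The Schwartz function `conj ∘ g`. -/
def conjSchwartz (g : 𝓢(ℝ, ℂ)) : 𝓢(ℝ, ℂ) :=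
  SchwartzMap.postcompCLM (𝕜 := ℝ) (Complex.conjCLE : ℂ →L[ℝ] ℂ) g

lemma conj_conjSchwartz (g : 𝓢(ℝ, ℂ)) (t : ℝ) : conj (conjSchwartz g t) = g t := by
  simp [conjSchwartz]

lemma windowedFeature_conj (η : SymMat m → ℝ) (g : 𝓢(ℝ, ℂ)) (f : 𝓢(DataDom m, ℂ))
    (x : DataDom m) (ξ : QuadParam m) :
    f x * conj (windowedFeature η (conjSchwartz g) x ξ)
      = η ξ.1 * (f x * g (inner ℝ x (symCLM ξ.1 x) + inner ℝ x ξ.2.1 + ξ.2.2)) := by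
  rw [windowedFeature, quadFeature, map_mul, conj_conjSchwartz, Complex.conj_ofReal, quadForm_eq]
  ring

lemma ridgelet_windowedFeature (η : SymMat m → ℝ) (g : 𝓢(ℝ, ℂ)) (f : 𝓢(DataDom m, ℂ))
    (ξ : QuadParam m) :
    ridgelet (windowedFeature η (conjSchwartz g)) f ξ
      = η ξ.1 * ridgeSlice g f (symCLM ξ.1) ξ.2.1 ξ.2.2 := by
  rw [ridgelet]
  simp only [windowedFeature_conj]
  rw [integral_const_mul, ridgeSlice]

lemma continuous_ridgelet {η : SymMat m → ℝ} (hη : Continuous η) (g : 𝓢(ℝ, ℂ))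
    (f : 𝓢(DataDom m, ℂ)) : Continuous (ridgelet (windowedFeature η (conjSchwartz g)) f) := by
  have h : ridgelet (windowedFeature η (conjSchwartz g)) f
      = fun ξ => (η ξ.1 : ℂ) * ridgeSlice g f (symCLM ξ.1) ξ.2.1 ξ.2.2 :=
    funext (ridgelet_windowedFeature η g f)
  have : FirstCountableTopology (SymMat m) := inferInstance
  rw [h]
  exact (Complex.continuous_ofReal.comp (hη.comp continuous_fst)).mul
    (continuous_ridgeSlice g f ((continuous_symCLM m).comp continuous_fst)
      (continuous_fst.comp continuous_snd) (continuous_snd.comp continuous_snd))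

instance : IsFiniteMeasureOnCompacts (volume : Measure (SymMat m)) :=
  Measure.IsFiniteMeasureOnCompacts.map volume (symHomeo m)

/-- The slice estimates are uniform only for bounded operators; compact support of the window
provides the bound. -/
lemma exists_ridgelet_decay {η : SymMat m → ℝ} (hηs : HasCompactSupport η)
    {δ : ℝ} (hδ : 0 < δ) {τ : 𝓢(ℝ, ℂ)} (hτ : ∀ w, |w| < δ → τ w = 0) (f : 𝓢(DataDom m, ℂ))
    (M N : ℕ) :
    ∃ C, 0 ≤ C ∧ ∀ ξ, ‖ridgelet (windowedFeature η (conjSchwartz (𝓕 τ))) f ξ‖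
      ≤ C * (|η ξ.1| * (((1 + ‖ξ.2.1‖) ^ M)⁻¹ * ((1 + |ξ.2.2|) ^ N)⁻¹)) := by
  obtain ⟨R, hR⟩ := hηs.isCompact.exists_bound_of_continuousOn (continuous_symCLM m).continuousOn
  obtain ⟨C, hC0, hC⟩ := exists_ridgeSlice_decay (le_max_right R 0) hδ M N hτ f
  refine ⟨C, hC0, fun ξ => ?_⟩
  rw [ridgelet_windowedFeature, norm_mul, Complex.norm_real, Real.norm_eq_abs]
  by_cases h : ξ.1 ∈ tsupport η
  · calc _ ≤ |η ξ.1| * (C * (((1 + ‖ξ.2.1‖) ^ M)⁻¹ * ((1 + |ξ.2.2|) ^ N)⁻¹)) := by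
          gcongr
          exact hC _ ((hR _ h).trans (le_max_left _ _)) _ _
      _ = _ := by ring
  · rw [image_eq_zero_of_notMem_tsupport h]
    simp

lemma memLp_ridgelet {η : SymMat m → ℝ} (hη : Continuous η) (hηs : HasCompactSupport η)
    {δ : ℝ} (hδ : 0 < δ) {τ : 𝓢(ℝ, ℂ)} (hτ : ∀ w, |w| < δ → τ w = 0) (f : 𝓢(DataDom m, ℂ)) :
    MemLp (ridgelet (windowedFeature η (conjSchwartz (𝓕 τ))) f) 2
      (volume : Measure (QuadParam m)) := by
  obtain ⟨C, hC0, hC⟩ := exists_ridgelet_decay hηs hδ hτ f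
    (volume : Measure (DataDom m)).integrablePower (volume : Measure ℝ).integrablePower
  obtain ⟨D, hD⟩ := hηs.exists_bound_of_continuous hη
  have hm := (continuous_ridgelet hη (𝓕 τ) f).aestronglyMeasurable
    (μ := (volume : Measure (QuadParam m)))
  refine (memLp_two_iff_integrable_sq_norm hm).2 ?_
  -- In the square, one factor is bounded by `C * D` and the other keeps its integrable majorant.
  have hdom : Integrable (fun ξ : QuadParam m => C * D * (C * (|η ξ.1| *
      (((1 + ‖ξ.2.1‖) ^ (volume : Measure (DataDom m)).integrablePower)⁻¹ *
        ((1 + |ξ.2.2|) ^ (volume : Measure ℝ).integrablePower)⁻¹)))) := by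
    have h1 : Integrable fun A : SymMat m => |η A| := (hη.integrable_of_hasCompactSupport hηs).norm
    exact ((h1.mul_prod ((integrable_one_add_norm_pow_inv (E := DataDom m)).mul_prod
      (integrable_one_add_norm_pow_inv (E := ℝ)))).const_mul C).const_mul (C * D)
  refine hdom.mono' (hm.norm.pow 2) (.of_forall fun ξ => ?_)
  rw [Real.norm_of_nonneg (by positivity), sq]
  have h2 := hC ξ
  refine mul_le_mul (h2.trans ?_) h2 (norm_nonneg _) ((norm_nonneg _).trans (h2.trans ?_)) <;>
  · gcongr
    have h3 : ((1 + ‖ξ.2.1‖) ^ (volume : Measure (DataDom m)).integrablePower)⁻¹ ≤ 1 :=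
      inv_le_one_of_one_le₀ (one_le_pow₀ (by linarith [norm_nonneg ξ.2.1]))
    have h4 : ((1 + |ξ.2.2|) ^ (volume : Measure ℝ).integrablePower)⁻¹ ≤ 1 :=
      inv_le_one_of_one_le₀ (one_le_pow₀ (by linarith [abs_nonneg ξ.2.2]))
    calc _ ≤ |η ξ.1| * (1 * 1) := by gcongr
      _ ≤ D := by simpa using hD ξ.1

/-- This is the network integrand at `x = 0`, where the quadratic polynomial reduces to `c`. -/
lemma integrable_ridgelet_mul_zero {σ : ℝ → ℂ} (hσ : IsTemperedFun σ) {η : SymMat m → ℝ}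
    (hη : Continuous η) (hηs : HasCompactSupport η)
    {δ : ℝ} (hδ : 0 < δ) {τ : 𝓢(ℝ, ℂ)} (hτ : ∀ w, |w| < δ → τ w = 0) (f : 𝓢(DataDom m, ℂ)) :
    Integrable fun ξ : QuadParam m =>
      ridgelet (windowedFeature η (conjSchwartz (𝓕 τ))) f ξ * σ ξ.2.2 := by
  obtain ⟨k, hk⟩ := id hσ
  obtain ⟨C, hC0, hC⟩ := exists_ridgelet_decay hηs hδ hτ f
    (volume : Measure (DataDom m)).integrablePower k
  have h1 : Integrable fun A : SymMat m => |η A| := (hη.integrable_of_hasCompactSupport hηs).norm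
  have hdom := (h1.mul_prod ((integrable_one_add_norm_pow_inv (E := DataDom m)).mul_prod
    hk.norm)).const_mul C
  refine hdom.mono' ?_ (.of_forall fun ξ => ?_)
  · exact (continuous_ridgelet hη (𝓕 τ) f).aestronglyMeasurable.mul
      (aestronglyMeasurable_of_tempered hσ).comp_snd.comp_snd
  · rw [norm_mul, norm_smul, Real.norm_of_nonneg (by positivity)]
    calc _ ≤ (C * (|η ξ.1| * (((1 + ‖ξ.2.1‖) ^ (volume : Measure (DataDom m)).integrablePower)⁻¹
          * ((1 + |ξ.2.2|) ^ k)⁻¹))) * ‖σ ξ.2.2‖ := by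
          gcongr
          exact hC ξ
      _ = _ := by ring

/-- The integral over `(b, c)` is the same for every `A` apart from the weight `η A`, so the window
enters only through its integral. -/
lemma integral_ridgelet_mul_zero {σ : ℝ → ℂ} (hσ : IsTemperedFun σ) {η : SymMat m → ℝ}
    (hη : Continuous η) (hηs : HasCompactSupport η)
    {δ : ℝ} (hδ : 0 < δ) {τ χ : 𝓢(ℝ, ℂ)} (hτ : ∀ w, |w| < δ → τ w = 0)
    (hχ : ∀ w, |w| < δ → χ w = 0) (hτχ : ∀ w, τ w = ((|w| ^ m : ℝ) : ℂ) * χ w)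
    (f : 𝓢(DataDom m, ℂ)) :
    ∫ ξ : QuadParam m, ridgelet (windowedFeature η (conjSchwartz (𝓕 τ))) f ξ * σ ξ.2.2
      = (∫ A, (η A : ℂ)) * (∫ t, σ t * 𝓕 χ t) * f 0 := by
  have h1 := integrable_ridgelet_mul_zero hσ hη hηs hδ hτ f
  have hvol : (volume : Measure (QuadParam m)) = (volume : Measure (SymMat m)).prod volume := rfl
  rw [hvol] at h1 ⊢
  rw [integral_prod _ h1, mul_assoc, ← integral_mul_const]
  refine integral_congr_ae (.of_forall fun A => ?_)
  simp only [ridgelet_windowedFeature, mul_assoc]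
  rw [integral_const_mul, ridgeSlice_machine hσ hδ hτ hχ (by simpa using hτχ)]
  ring

/-- Translations fix `A`, hence the window: the windowed feature keeps invariance under
translations, which is all that recentring needs. -/
lemma ridgelet_translate (η : SymMat m → ℝ) (ρ : ℝ → ℂ) (f : 𝓢(DataDom m, ℂ)) (v : DataDom m)
    (ξ : QuadParam m) :
    ridgelet (windowedFeature η ρ) f ξ = ridgelet (windowedFeature η ρ)
      (SchwartzMap.compSubConstCLM ℂ v f)
      ((SemidirectProduct.inl (Multiplicative.ofAdd v) : AffGroup m) • ξ) := by
  set g : AffGroup m := SemidirectProduct.inl (Multiplicative.ofAdd v) with hg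
  have hLi : g.Linv = 1 := by simp [AffGroup.Linv, hg]
  have hL : g.L = 1 := by simp [AffGroup.L, hg]
  have hA : (g • ξ).1 = ξ.1 := Subtype.ext (by
    change g.Linvᵀ * ξ.1.1 * g.Linv = ξ.1.1
    rw [hLi, Matrix.transpose_one, Matrix.one_mul, Matrix.mul_one])
  have hx : ∀ x : DataDom m, g • x = x + v := fun x => by
    rw [AffGroup.smul_def, hL, Matrix.one_mulVec, add_comm]
    rfl
  rw [ridgelet, ridgelet]
  conv_rhs => rw [← integral_add_right_eq_self _ v]
  refine integral_congr_ae (.of_forall fun x => ?_)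
  simp only [SchwartzMap.compSubConstCLM_apply, add_sub_cancel_right]
  rw [← hx, windowedFeature, windowedFeature, quadFeature, quadFeature, quadForm_smul, hA]

theorem exists_ridgelet_rightInverse {σ : ℝ → ℂ} (hσ : IsTemperedFun σ) (hp : ¬ IsAEPolynomial σ) :
    ∃ (η : SymMat m → ℝ) (ρ : 𝓢(ℝ, ℂ)), Continuous η ∧ HasCompactSupport η ∧
      ∀ f : 𝓢(DataDom m, ℂ),
        (∀ ξ, Integrable fun x => f x * conj (windowedFeature η ρ x ξ)) ∧
        MemLp (ridgelet (windowedFeature η ρ) f) 2 (volume : Measure (QuadParam m)) ∧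
        (∀ x, Integrable fun ξ =>
          ridgelet (windowedFeature η ρ) f ξ * quadFeature m σ x ξ) ∧
        ∀ x, QNN σ (ridgelet (windowedFeature η ρ) f) x = f x := by
  obtain ⟨χ₀, s, δ, hs, hδ, hχ₀, hne⟩ := exists_oneSided_of_not_isAEPolynomial hσ hp
  obtain ⟨η, hη, hηs, hη1⟩ : ∃ η : SymMat m → ℝ, Continuous η ∧ HasCompactSupport η ∧
      ∫ A, (η A : ℂ) ≠ 0 := by
    let B : ContDiffBump (0 : LowerIdx m → ℝ) := ⟨1, 2, one_pos, one_lt_two⟩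
    refine ⟨fun A => B ((symHomeo m).symm A), B.continuous.comp (symHomeo m).symm.continuous,
      B.hasCompactSupport.comp_homeomorph (symHomeo m).symm, ?_⟩
    have h1 := (measurePreserving_symHomeo m).integral_comp (symHomeo m).measurableEmbedding
      fun A => ((B ((symHomeo m).symm A) : ℝ) : ℂ)
    rw [← h1]
    simp only [Homeomorph.symm_apply_apply]
    rw [integral_complex_ofReal]
    exact_mod_cast B.integral_pos.ne'
  set c : ℂ := (∫ A, (η A : ℂ)) * ∫ t, σ t * 𝓕 χ₀ t with hc
  have hc0 : c ≠ 0 := mul_ne_zero hη1 hne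
  -- Normalised so that the reconstruction constant becomes one.
  set χ : 𝓢(ℝ, ℂ) := c⁻¹ • χ₀ with hχdef
  have hχs : ∀ w, s * w < δ → χ w = 0 := fun w hw => by
    rw [hχdef, _root_.smul_apply, hχ₀ w hw, smul_zero]
  have habs : ∀ w, s * w ≤ |w| := fun w => by
    refine (le_abs_self _).trans_eq ?_
    rw [abs_mul, hs, one_mul]
  have hχ : ∀ w, |w| < δ → χ w = 0 := fun w hw => hχs w ((habs w).trans_lt hw)
  have hc1 : (∫ A, (η A : ℂ)) * ∫ t, σ t * 𝓕 χ t = 1 := by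
    have h1 : ∀ t, σ t * 𝓕 χ t = c⁻¹ * (σ t * 𝓕 χ₀ t) := fun t => by
      rw [hχdef, FourierTransform.fourier_smul, _root_.smul_apply, smul_eq_mul]
      ring
    simp only [h1]
    rw [integral_const_mul, mul_left_comm, ← hc, inv_mul_cancel₀ hc0]
  have htg : Function.HasTemperateGrowth fun w : ℝ => (((s * w) ^ m : ℝ) : ℂ) :=
    Function.Complex.hasTemperateGrowth_ofReal.comp
      (f := fun w : ℝ => (s * w) ^ m) (((Function.HasTemperateGrowth.const s).mul .id').pow m)
  -- One-sidedness of `χ` is used here: on its support `|w| ^ m` equals the polynomial `(s * w) ^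
  -- m`, so `τ` is Schwartz.
  set τ : 𝓢(ℝ, ℂ) := SchwartzMap.smulLeftCLM ℂ (fun w : ℝ => (((s * w) ^ m : ℝ) : ℂ)) χ with hτdef
  have hτχ : ∀ w, τ w = ((|w| ^ m : ℝ) : ℂ) * χ w := fun w => by
    rw [hτdef, SchwartzMap.smulLeftCLM_apply_apply htg, smul_eq_mul]
    by_cases hw : s * w < δ
    · rw [hχs w hw, mul_zero, mul_zero]
    · have h1 : s * w = |w| := by
        rw [← abs_of_pos (hδ.trans_le (not_lt.1 hw)), abs_mul, hs, one_mul]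
      rw [h1]
  have hτ : ∀ w, |w| < δ → τ w = 0 := fun w hw => by rw [hτχ, hχ w hw, mul_zero]
  refine ⟨η, conjSchwartz (𝓕 τ), hη, hηs, fun f => ⟨fun ξ => ?_, memLp_ridgelet hη hηs hδ hτ f, ?_⟩⟩
  · simp only [windowedFeature_conj]
    exact (integrable_ridgeSlice _ f _ _ _).const_mul _
  -- Translating by `-x` moves the evaluation point to the origin and `f` to its translate, whose
  -- value there is `f x`.
  · have key : ∀ x : DataDom m, ∀ ξ : QuadParam m,
        ridgelet (windowedFeature η (conjSchwartz (𝓕 τ))) f ξ * quadFeature m σ x ξ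
          = (fun ξ : QuadParam m => ridgelet (windowedFeature η (conjSchwartz (𝓕 τ)))
            (SchwartzMap.compSubConstCLM ℂ (-x) f) ξ * σ ξ.2.2)
            ((SemidirectProduct.inl (Multiplicative.ofAdd (-x)) : AffGroup m) • ξ) := by
      intro x ξ
      set g : AffGroup m := SemidirectProduct.inl (Multiplicative.ofAdd (-x)) with hg
      have hL : g.L = 1 := by simp [AffGroup.L, hg]
      have hx : g • x = 0 := by
        rw [AffGroup.smul_def, hL, Matrix.one_mulVec]
        change -x + x = 0
        simp
      simp only
      rw [ridgelet_translate η _ f (-x) ξ, quadFeature, ← quadForm_smul g, hx,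
        show quadForm 0 (g • ξ) = (g • ξ).2.2 by simp [quadForm]]
    have hmp := fun x : DataDom m => measurePreserving_translation (-x)
    have hemb := fun x : DataDom m =>
      (quadHomeo (SemidirectProduct.inl (Multiplicative.ofAdd (-x)) : AffGroup m)).measurableEmbedding
    refine ⟨fun x => ?_, fun x => ?_⟩
    · simp only [key x]
      exact ((hmp x).integrable_comp_emb (hemb x)).2
        (integrable_ridgelet_mul_zero hσ hη hηs hδ hτ _)
    · rw [QNN, machine]
      simp only [key x]
      rw [(hmp x).integral_comp (hemb x) fun ξ : QuadParam m =>
        ridgelet (windowedFeature η (conjSchwartz (𝓕 τ)))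
            (SchwartzMap.compSubConstCLM ℂ (-x) f) ξ * σ ξ.2.2,
        integral_ridgelet_mul_zero hσ hη hηs hδ hτ hχ hτχ, hc1, one_mul]
      simp

theorem exists_universal {σ : ℝ → ℂ} (hσ : IsTemperedFun σ) (hp : ¬ IsAEPolynomial σ)
    (f : L2Space m) {ε : ℝ} (hε : 0 < ε) :
    ∃ γ : QuadParam m → ℂ, MemLp γ 2 volume ∧
      (∀ x, Integrable fun ξ => γ ξ * quadFeature m σ x ξ) ∧
      MemLp (QNN σ γ) 2 (volume : Measure (DataDom m)) ∧
      eLpNorm (fun x => QNN σ γ x - f x) 2 volume < ENNReal.ofReal ε := by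
  obtain ⟨η, ρ, -, -, h⟩ := exists_ridgelet_rightInverse (m := m) hσ hp
  have hd : DenseRange (SchwartzMap.toLpCLM ℂ (E := DataDom m) ℂ 2 volume) :=
    SchwartzMap.denseRange_toLpCLM ENNReal.ofNat_ne_top
  obtain ⟨g, hg⟩ := hd.exists_dist_lt f hε
  obtain ⟨-, h2, h3, h4⟩ := h g
  have hQ : QNN σ (ridgelet (windowedFeature η ρ) g) = g := funext h4
  refine ⟨ridgelet (windowedFeature η ρ) g, h2, h3, ?_, ?_⟩
  · rw [hQ]
    exact g.memLp 2 volume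
  · have h5 : eLpNorm (fun x => QNN σ (ridgelet (windowedFeature η ρ) g) x - f x) 2 volume
        = ENNReal.ofReal (dist f (SchwartzMap.toLpCLM ℂ (E := DataDom m) ℂ 2 volume g)) := by
      rw [hQ, dist_comm, ← edist_dist, Lp.edist_def]
      refine eLpNorm_congr_ae ?_
      filter_upwards [g.coeFn_toLp 2 volume] with x hx
      simp [hx]
    rw [h5]
    exact (ENNReal.ofReal_lt_ofReal_iff hε).2 hg

end Network

/-! ### Irreducibility of the regular representation -/

/-- The affine map `x ↦ v + A x` as a group element. -/
def affMk {m : ℕ} (v : DataDom m) (A : Matrix (Fin m) (Fin m) ℝ) (hA : A.det ≠ 0) : AffGroup m :=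
  ⟨Multiplicative.ofAdd v, Matrix.GeneralLinearGroup.mkOfDetNeZero A hA⟩

section Irreducible

variable {m : ℕ}

lemma affMk_L (v : DataDom m) (A : Matrix (Fin m) (Fin m) ℝ) (hA : A.det ≠ 0) :
    (affMk v A hA).L = A := rfl

lemma affMk_smul (v : DataDom m) (A : Matrix (Fin m) (Fin m) ℝ) (hA : A.det ≠ 0) (x : DataDom m) :
    affMk v A hA • x = v + Matrix.toEuclideanLin A x := rfl

/-- The action is a measurable embedding, so no measurability or integrability of `F` is required.
-/
lemma integral_smul_comp (g : AffGroup m) (F : DataDom m → ℂ) :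
    ∫ x, F x = |g.L.det| * ∫ x, F (g • x) := by
  have hemb : MeasurableEmbedding fun x : DataDom m => g • x :=
    ⟨MulAction.injective g, g.measurable_smul, fun s hs => by
      have : (fun x : DataDom m => g • x) '' s = (fun x : DataDom m => g⁻¹ • x) ⁻¹' s := by
        ext x
        constructor
        · rintro ⟨y, hy, rfl⟩
          simpa using hy
        · intro hx
          exact ⟨g⁻¹ • x, hx, by simp⟩
      rw [this]
      exact (g⁻¹).measurable_smul hs⟩
  have hd : |g.L.det| ≠ 0 := abs_ne_zero.2 g.det_L_ne_zero
  rw [← hemb.integral_map, AffGroup.map_smul_volume, integral_smul_measure,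
    ENNReal.toReal_ofReal (by positivity), Complex.real_smul, ← mul_assoc, Complex.ofReal_inv,
    mul_inv_cancel₀ (mod_cast hd), one_mul]

lemma ae_smul {p : DataDom m → Prop} (g : AffGroup m) (h : ∀ᵐ x, p (g • x)) : ∀ᵐ x, p x := by
  filter_upwards [(g⁻¹).quasiMeasurePreserving_smul.ae h] with x hx
  simpa using hx

/-- An integrable function with vanishing Fourier transform vanishes. -/
lemma ae_eq_zero_of_fourier_eq_zero {G : DataDom m → ℂ} (hG : Integrable G)
    (h : ∀ t, 𝓕 G t = 0) : ∀ᵐ x, G x = 0 := by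
  refine ae_eq_zero_of_integral_contDiff_smul_eq_zero hG.locallyIntegrable fun g hg hgc => ?_
  let φ : 𝓢(DataDom m, ℂ) := HasCompactSupport.toSchwartzMap (f := fun x => ((g x : ℝ) : ℂ))
    (hgc.comp_left (g := fun x : ℝ => (x : ℂ)) Complex.ofReal_zero)
    (Complex.ofRealCLM.contDiff.comp hg)
  -- The test function is a Fourier transform, and the self-duality `∫ 𝓕ψ · G = ∫ ψ · 𝓕G` moves the
  -- transform to `G`.
  let ψ : 𝓢(DataDom m, ℂ) := 𝓕⁻ φ
  have h1 : ∀ x, g x • G x = (𝓕 ψ : 𝓢(DataDom m, ℂ)) x • G x := fun x => by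
    rw [FourierTransform.fourier_fourierInv_eq]
    change _ = ((g x : ℝ) : ℂ) • G x
    simp
  simp only [h1]
  have h2 := VectorFourier.integral_fourierIntegral_smul_eq_flip (L := innerₗ (DataDom m))
    (μ := volume) (ν := volume) (f := ⇑ψ) (g := G) Real.continuous_fourierChar
    continuous_inner ψ.integrable hG
  refine Eq.trans ?_ (h2.trans ?_)
  · rfl
  · have h3 : ∀ x, VectorFourier.fourierIntegral Real.fourierChar volume
        (innerₗ (DataDom m)).flip G x = 0 := fun x => by
      rw [flip_innerₗ]
      exact h x
    simp only [h3, smul_zero, integral_zero]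

/-- Multiplication with the character `ξ ↦ exp (-2πi ⟪t, ξ⟫)`. -/
def phase (t ξ : DataDom m) : ℂ := Complex.exp ((-2 * Real.pi * inner ℝ t ξ : ℝ) * Complex.I)

lemma norm_phase (t ξ : DataDom m) : ‖phase t ξ‖ = 1 := Complex.norm_exp_ofReal_mul_I _

lemma continuous_phase (t : DataDom m) : Continuous (phase t) := by
  unfold phase
  fun_prop

lemma memLp_phase_mul (t : DataDom m) {f : DataDom m → ℂ} (hf : MemLp f 2 volume) :
    MemLp (fun ξ => phase t ξ * f ξ) 2 volume :=
  hf.of_le ((continuous_phase t).aestronglyMeasurable.mul hf.1)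
    (.of_forall fun ξ => by rw [norm_mul, norm_phase, one_mul])

/-- The modulation operator on `L²`. -/
def modulate (t : DataDom m) : L2Space m →ₗᵢ[ℂ] L2Space m where
  toFun f := MemLp.toLp _ (memLp_phase_mul t (Lp.memLp f))
  map_add' f f' := by
    rw [← MemLp.toLp_add]
    refine MemLp.toLp_congr _ _ ?_
    filter_upwards [Lp.coeFn_add f f'] with ξ hξ
    rw [hξ, Pi.add_apply, Pi.add_apply, mul_add]
  map_smul' c f := by
    rw [RingHom.id_apply, ← MemLp.toLp_const_smul]
    refine MemLp.toLp_congr _ _ ?_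
    filter_upwards [Lp.coeFn_smul c f] with ξ hξ
    rw [hξ, Pi.smul_apply, Pi.smul_apply, smul_eq_mul, smul_eq_mul, mul_left_comm]
  norm_map' f := by
    change ‖MemLp.toLp _ (memLp_phase_mul t (Lp.memLp f))‖ = ‖f‖
    rw [Lp.norm_toLp, Lp.norm_def]
    congr 1
    exact eLpNorm_congr_norm_ae (.of_forall fun ξ => by rw [norm_mul, norm_phase, one_mul])

lemma coeFn_modulate (t : DataDom m) (f : L2Space m) :
    modulate t f =ᵐ[volume] fun ξ => phase t ξ * f ξ :=
  MemLp.coeFn_toLp (memLp_phase_mul t (Lp.memLp f))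

lemma inner_toEuclideanLin (A : Matrix (Fin m) (Fin m) ℝ) (x y : DataDom m) :
    inner ℝ (Matrix.toEuclideanLin A x) y = inner ℝ x (Matrix.toEuclideanLin Aᵀ y) := by
  rw [EuclideanSpace.inner_eq_star_dotProduct, EuclideanSpace.inner_eq_star_dotProduct]
  change y.ofLp ⬝ᵥ (A *ᵥ x.ofLp) = (Aᵀ *ᵥ y.ofLp) ⬝ᵥ x.ofLp
  rw [Matrix.dotProduct_mulVec, Matrix.mulVec_transpose]

lemma toEuclideanLin_mul_apply (A B : Matrix (Fin m) (Fin m) ℝ) (x : DataDom m) :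
    Matrix.toEuclideanLin A (Matrix.toEuclideanLin B x) = Matrix.toEuclideanLin (A * B) x := by
  change WithLp.toLp 2 (A *ᵥ (B *ᵥ x.ofLp)) = WithLp.toLp 2 ((A * B) *ᵥ x.ofLp)
  rw [Matrix.mulVec_mulVec]

lemma toEuclideanLin_one_apply (x : DataDom m) :
    Matrix.toEuclideanLin (1 : Matrix (Fin m) (Fin m) ℝ) x = x := by
  change WithLp.toLp 2 ((1 : Matrix (Fin m) (Fin m) ℝ) *ᵥ x.ofLp) = x
  rw [Matrix.one_mulVec]

/-- Keeps the intertwining computation inside Schwartz space, where the Fourier transform is an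
integral; density extends it to `L²`. -/
lemma exists_schwartz_pull (v : DataDom m) (A : Matrix (Fin m) (Fin m) ℝ) (hA : A.det ≠ 0)
    (f : 𝓢(DataDom m, ℂ)) : ∃ f' : 𝓢(DataDom m, ℂ), ∀ x, f' x = (affMk v A hA).pull f x := by
  have hu : IsUnit A.det := isUnit_iff_ne_zero.2 hA
  let e : DataDom m ≃ₗ[ℝ] DataDom m := LinearEquiv.ofLinearMap (Matrix.toEuclideanLin A⁻¹)
    (Matrix.toEuclideanLin A)
    (LinearMap.ext fun x => by
      simp only [LinearMap.comp_apply, LinearMap.id_apply]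
      rw [toEuclideanLin_mul_apply, Matrix.nonsing_inv_mul _ hu, toEuclideanLin_one_apply])
    (LinearMap.ext fun x => by
      simp only [LinearMap.comp_apply, LinearMap.id_apply]
      rw [toEuclideanLin_mul_apply, Matrix.mul_nonsing_inv _ hu, toEuclideanLin_one_apply])
  refine ⟨((|A.det| ^ (-(1 / 2) : ℝ) : ℝ) : ℂ) • SchwartzMap.compSubConstCLM ℂ v
    (SchwartzMap.compCLMOfContinuousLinearEquiv ℂ e.toContinuousLinearEquiv f), fun x => ?_⟩
  have h1 : (affMk v A hA)⁻¹ • x = Matrix.toEuclideanLin A⁻¹ (x - v) := by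
    rw [inv_smul_eq_iff, affMk_smul, toEuclideanLin_mul_apply, Matrix.mul_nonsing_inv _ hu,
      toEuclideanLin_one_apply]
    abel
  rw [AffGroup.pull, h1, affMk_L]
  rfl

lemma fourier_pull (v : DataDom m) (A : Matrix (Fin m) (Fin m) ℝ) (hA : A.det ≠ 0)
    (f : DataDom m → ℂ) (ξ : DataDom m) :
    𝓕 ((affMk v A hA).pull f) ξ = phase v ξ *
      ((|A.det| ^ (1 / 2 : ℝ) : ℝ) * 𝓕 f (Matrix.toEuclideanLin Aᵀ ξ)) := by
  have hpos : 0 < |A.det| := abs_pos.2 hA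
  rw [Real.fourier_eq', Real.fourier_eq', integral_smul_comp (affMk v A hA), affMk_L,
    ← integral_const_mul, ← integral_const_mul, ← integral_const_mul]
  refine integral_congr_ae (.of_forall fun x => ?_)
  simp only [AffGroup.pull, inv_smul_smul, affMk_L, smul_eq_mul]
  rw [affMk_smul, inner_add_left, inner_toEuclideanLin, mul_add, Complex.ofReal_add, add_mul,
    Complex.exp_add, phase]
  have h1 : ((|A.det| : ℝ) : ℂ) * ((|A.det| ^ (-(1 / 2) : ℝ) : ℝ) : ℂ)
      = ((|A.det| ^ (1 / 2 : ℝ) : ℝ) : ℂ) := by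
    rw [← Complex.ofReal_mul, ← Real.rpow_one_add' hpos.le (by norm_num)]
    norm_num
  rw [← h1]
  ring

lemma toEuclideanLin_transpose_inv (A : Matrix (Fin m) (Fin m) ℝ) (hA : A.det ≠ 0)
    (hA' : (A⁻¹ᵀ).det ≠ 0) (ξ : DataDom m) :
    (affMk 0 A⁻¹ᵀ hA')⁻¹ • ξ = Matrix.toEuclideanLin Aᵀ ξ := by
  rw [inv_smul_eq_iff, affMk_smul, zero_add, toEuclideanLin_mul_apply, ← Matrix.transpose_mul,
    Matrix.mul_nonsing_inv _ (isUnit_iff_ne_zero.2 hA), Matrix.transpose_one,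
    toEuclideanLin_one_apply]

lemma det_inv_transpose_ne_zero {A : Matrix (Fin m) (Fin m) ℝ} (hA : A.det ≠ 0) :
    (A⁻¹ᵀ).det ≠ 0 := by
  rw [Matrix.det_transpose, Matrix.det_nonsing_inv, Ring.inverse_eq_inv']
  exact inv_ne_zero hA

lemma pull_transpose_inv (A : Matrix (Fin m) (Fin m) ℝ) (hA : A.det ≠ 0) (F : DataDom m → ℂ)
    (ξ : DataDom m) :
    (affMk 0 A⁻¹ᵀ (det_inv_transpose_ne_zero hA)).pull F ξ
      = (|A.det| ^ (1 / 2 : ℝ) : ℝ) * F (Matrix.toEuclideanLin Aᵀ ξ) := by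
  rw [AffGroup.pull, toEuclideanLin_transpose_inv A hA, affMk_L, Matrix.det_transpose,
    Matrix.det_nonsing_inv, Ring.inverse_eq_inv', abs_inv, Real.inv_rpow (abs_nonneg _),
    Real.rpow_neg (abs_nonneg _), inv_inv]

/-- The Fourier transform intertwines the regular representation with its dual form. -/
lemma fourier_regularRep (v : DataDom m) (A : Matrix (Fin m) (Fin m) ℝ) (hA : A.det ≠ 0)
    (f : L2Space m) : 𝓕 (regularRep m (affMk v A hA) f)
      = modulate v (regularRep m (affMk 0 A⁻¹ᵀ (det_inv_transpose_ne_zero hA)) (𝓕 f)) := by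
  have hd : DenseRange (SchwartzMap.toLpCLM ℂ (E := DataDom m) ℂ 2 volume) :=
    SchwartzMap.denseRange_toLpCLM ENNReal.ofNat_ne_top
  have hF : Continuous fun f : L2Space m => 𝓕 f := (Lp.fourierTransformₗᵢ (DataDom m) ℂ).continuous
  refine congrFun (hd.equalizer (g := fun f => 𝓕 (regularRep m (affMk v A hA) f))
    (h := fun f => modulate v (regularRep m (affMk 0 A⁻¹ᵀ (det_inv_transpose_ne_zero hA)) (𝓕 f)))
    (hF.comp (regularRep m _).continuous)
    ((modulate v).continuous.comp ((regularRep m _).continuous.comp hF)) (funext fun φ => ?_)) f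
  obtain ⟨φ', hφ'⟩ := exists_schwartz_pull v A hA φ
  simp only [Function.comp_apply, SchwartzMap.toLpCLM_apply]
  have h1 : regularRep m (affMk v A hA) (φ.toLp 2) = φ'.toLp 2 := by
    refine Lp.ext ((coeFn_regularRep _ _).trans ?_)
    refine ((affMk v A hA).pull_congr (φ.coeFn_toLp 2 volume)).trans ?_
    filter_upwards [φ'.coeFn_toLp 2 volume] with x hx
    rw [hx, hφ']
  rw [h1, SchwartzMap.toLp_fourier_eq, SchwartzMap.toLp_fourier_eq]
  refine Lp.ext ?_
  filter_upwards [(𝓕 φ').coeFn_toLp 2 volume, coeFn_modulate v (regularRep m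
    (affMk 0 A⁻¹ᵀ (det_inv_transpose_ne_zero hA)) ((𝓕 φ).toLp 2)),
    coeFn_regularRep (affMk 0 A⁻¹ᵀ (det_inv_transpose_ne_zero hA)) ((𝓕 φ).toLp 2),
    (affMk 0 A⁻¹ᵀ (det_inv_transpose_ne_zero hA)).pull_congr ((𝓕 φ).coeFn_toLp 2 volume)]
    with ξ h2 h3 h4 h5
  rw [h2, h3, h4, h5, pull_transpose_inv A hA, SchwartzMap.fourier_coe, SchwartzMap.fourier_coe,
    ← fourier_pull v A hA]
  exact congrArg (fun u : DataDom m → ℂ => 𝓕 u ξ) (funext hφ')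

/-- Orthogonality to all translates of the dilated `f` says that the integrable function `ξ ↦ conj
(ĥ ξ) · f̂(Aᵀξ)` has zero Fourier transform. -/
lemma ae_mul_eq_zero_of_orthogonal {K : Submodule ℂ (L2Space m)}
    (hK : IsInvariantSubspace (regularRep m) K) {f h : L2Space m} (hf : f ∈ K) (hh : h ∈ Kᗮ)
    (A : Matrix (Fin m) (Fin m) ℝ) (hA : A.det ≠ 0) :
    ∀ᵐ ξ, (𝓕 f : L2Space m) (Matrix.toEuclideanLin Aᵀ ξ) = 0 ∨ (𝓕 h : L2Space m) ξ = 0 := by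
  set F' := regularRep m (affMk 0 A⁻¹ᵀ (det_inv_transpose_ne_zero hA)) (𝓕 f) with hF'
  have hint := L2.integrable_inner (𝕜 := ℂ) (𝓕 h : L2Space m) F'
  have h0 := ae_eq_zero_of_fourier_eq_zero hint fun t => by
    have h1 : inner ℂ h (regularRep m (affMk t A hA) f) = 0 :=
      Submodule.inner_left_of_mem_orthogonal (hK _ f hf) hh
    rw [← Lp.inner_fourier_eq, fourier_regularRep, ← hF', L2.inner_def] at h1
    rw [Real.fourier_eq', ← h1]
    refine integral_congr_ae ?_
    filter_upwards [coeFn_modulate t F'] with ξ hξ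
    rw [hξ, ← smul_eq_mul (phase t ξ), inner_smul_right, phase, real_inner_comm, smul_eq_mul]
  filter_upwards [h0, coeFn_regularRep (affMk 0 A⁻¹ᵀ (det_inv_transpose_ne_zero hA)) (𝓕 f)]
    with ξ h1 h2
  rw [← hF', pull_transpose_inv A hA] at h2
  rw [RCLike.inner_apply, h2] at h1
  have h3 : ((|A.det| ^ (1 / 2 : ℝ) : ℝ) : ℂ) ≠ 0 := by
    exact_mod_cast (Real.rpow_pos_of_pos (abs_pos.2 hA) _).ne'
  simpa [h3, hA] using h1

lemma eq_zero_of_fourier_ae_eq_zero {f : L2Space m} (hf : ∀ᵐ ξ, (𝓕 f : L2Space m) ξ = 0) :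
    f = 0 := by
  have h1 : (𝓕 f : L2Space m) = 0 := (Lp.eq_zero_iff_ae_eq_zero).2 hf
  rw [← norm_eq_zero, ← Lp.norm_fourier_eq, h1, norm_zero]

lemma ae_coord_ne (j : Fin m) (r : ℝ) : ∀ᵐ v : DataDom m, v.ofLp j ≠ r := by
  have h1 : ∀ᵐ v : Fin m → ℝ, v j ≠ r := by
    simpa [volume_pi] using Measure.ae_eval_ne (μ := fun _ : Fin m => (volume : Measure ℝ)) j r
  exact (PiLp.volume_preserving_ofLp (Fin m)).quasiMeasurePreserving.ae h1

/-- The exceptional null set depends on `A`. A family of matrices parametrised by `v ∈ ℝ^m`, with `v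
↦ Aᵀξ` onto for a.e. fixed `ξ`, lets Fubini exchange the quantifiers. -/
lemma eq_zero_or_eq_zero_of_orthogonal {K : Submodule ℂ (L2Space m)}
    (hK : IsInvariantSubspace (regularRep m) K) {f h : L2Space m} (hf : f ∈ K) (hh : h ∈ Kᗮ) :
    f = 0 ∨ h = 0 := by
  -- For `m = 0` there is no coordinate `j`, but the space is a point and "a.e." means everywhere.
  rcases Nat.eq_zero_or_pos m with rfl | hm
  · have h1 := ae_mul_eq_zero_of_orthogonal hK hf hh 1 (by simp)
    obtain ⟨ξ, hξ⟩ := h1.exists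
    rcases hξ with hξ | hξ
    · refine Or.inl (eq_zero_of_fourier_ae_eq_zero (.of_forall fun ζ => ?_))
      rwa [Subsingleton.elim ζ (Matrix.toEuclideanLin 1ᵀ ξ)]
    · refine Or.inr (eq_zero_of_fourier_ae_eq_zero (.of_forall fun ζ => ?_))
      rwa [Subsingleton.elim ζ ξ]
  · let j : Fin m := ⟨0, hm⟩
    set F : L2Space m := 𝓕 f with hF
    set H : L2Space m := 𝓕 h with hH
    have h1 : ∀ᵐ v : DataDom m, ∀ᵐ ξ : DataDom m, F (ξ + ξ.ofLp j • v) = 0 ∨ H ξ = 0 := by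
      -- The rank-one perturbation below has determinant `1 + v_j`.
      filter_upwards [ae_coord_ne j (-1)] with v hv
      set A : Matrix (Fin m) (Fin m) ℝ :=
        1 + Matrix.vecMulVec (Pi.single j 1) v.ofLp with hAdef
      have hA : A.det ≠ 0 := by
        rw [hAdef, Matrix.vecMulVec_eq Unit, Matrix.det_one_add_replicateCol_mul_replicateRow]
        simp only [dotProduct_single, mul_one, ne_eq]
        intro h0
        exact hv (by linarith)
      have hAt : ∀ ξ : DataDom m, Matrix.toEuclideanLin Aᵀ ξ = ξ + ξ.ofLp j • v := by
        intro ξ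
        refine congrArg (WithLp.toLp 2) ?_
        change Aᵀ *ᵥ ξ.ofLp = ξ.ofLp + ξ.ofLp j • v.ofLp
        rw [hAdef, Matrix.transpose_add, Matrix.transpose_one, Matrix.transpose_vecMulVec,
          Matrix.add_mulVec, Matrix.one_mulVec, Matrix.vecMulVec_mulVec]
        simp
      simpa only [hAt] using ae_mul_eq_zero_of_orthogonal hK hf hh A hA
    have hcont : Continuous fun p : DataDom m × DataDom m => p.2 + p.2.ofLp j • p.1 := by fun_prop
    have hmeas : MeasurableSet {p : DataDom m × DataDom m |
        F (p.2 + p.2.ofLp j • p.1) = 0 ∨ H p.2 = 0} := by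
      refine MeasurableSet.union ?_ ?_
      · exact ((Lp.stronglyMeasurable F).measurable.comp hcont.measurable)
          (measurableSet_singleton 0)
      · exact ((Lp.stronglyMeasurable H).measurable.comp measurable_snd)
          (measurableSet_singleton 0)
    have h2 := (Measure.ae_ae_comm hmeas).1 h1
    by_cases hH0 : ∀ᵐ ξ, H ξ = 0
    · exact Or.inr (eq_zero_of_fourier_ae_eq_zero hH0)
    · refine Or.inl (eq_zero_of_fourier_ae_eq_zero ?_)
      obtain ⟨ξ, hξ0, hξj, hξ⟩ :=
        ((Filter.not_eventually.1 hH0).and_eventually ((ae_coord_ne j 0).and h2)).exists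
      -- Since `ξ_j ≠ 0`, the map `v ↦ ξ + ξ_j v` is an affine bijection and carries the a.e.
      -- statement in `v` to all of space.
      have hdet : (ξ.ofLp j • (1 : Matrix (Fin m) (Fin m) ℝ)).det ≠ 0 := by
        rw [Matrix.det_smul, Matrix.det_one, mul_one]
        exact pow_ne_zero _ hξj
      refine ae_smul (affMk ξ _ hdet) ?_
      filter_upwards [hξ] with v hv
      have h3 : affMk ξ _ hdet • v = ξ + ξ.ofLp j • v := by
        rw [affMk_smul, map_smul, LinearMap.smul_apply, toEuclideanLin_one_apply]
      rw [h3]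
      exact hv.resolve_right hξ0

theorem isIrreducibleRep_regularRep (m : ℕ) : IsIrreducibleRep (regularRep m) := by
  refine ⟨?_, fun K hKc hK => ?_⟩
  · let B : ContDiffBump (0 : DataDom m) := ⟨1, 2, one_pos, one_lt_two⟩
    let φ : 𝓢(DataDom m, ℂ) := HasCompactSupport.toSchwartzMap (f := fun x => ((B x : ℝ) : ℂ))
      (B.hasCompactSupport.comp_left (g := fun x : ℝ => (x : ℂ)) Complex.ofReal_zero)
      (Complex.ofRealCLM.contDiff.comp B.contDiff)
    refine ⟨φ.toLp 2, 0, fun h => ?_⟩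
    have h1 : φ = 0 := SchwartzMap.injective_toLp 2 volume (h.trans (map_zero
      (SchwartzMap.toLpCLM ℂ (E := DataDom m) ℂ 2 volume)).symm)
    have h2 : ((B 0 : ℝ) : ℂ) = 0 := congrArg (fun ψ : 𝓢(DataDom m, ℂ) => ψ 0) h1
    rw [B.one_of_mem_closedBall (by simp [B.rIn_pos.le])] at h2
    simp at h2
  · by_cases h : K = ⊥
    · exact Or.inl h
    · right
      obtain ⟨f, hf, hf0⟩ := K.ne_bot_iff.1 h
      have : CompleteSpace K := hKc.completeSpace_coe
      rw [← Submodule.orthogonal_eq_bot_iff, Submodule.eq_bot_iff]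
      exact fun g hg => (eq_zero_or_eq_zero_of_orthogonal hK hf hg).resolve_left hf0

end Irreducible

/-! ### Schur's lemma for unitary representations -/

section Schur

variable {G H : Type*} [Group G] [NormedAddCommGroup H] [InnerProductSpace ℂ H]
  {π : G →* (H ≃ₗᵢ[ℂ] H)}

/-- A representation by unitary operators, as bounded operators. -/
def repCLM (π : G →* (H ≃ₗᵢ[ℂ] H)) (g : G) : H →L[ℂ] H := (π g).toContinuousLinearEquiv

/-- The kernel of an intertwiner is a closed invariant subspace. -/
lemma eq_zero_or_injective_of_commute (hπ : IsIrreducibleRep π) {T : H →L[ℂ] H}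
    (hT : ∀ g, Commute T (repCLM π g)) : T = 0 ∨ ∀ x, T x = 0 → x = 0 := by
  rcases hπ.2 (LinearMap.ker T.toLinearMap) T.isClosed_ker fun g f hf => by
      have h := DFunLike.congr_fun (hT g).eq f
      change T (π g f) = π g (T f) at h
      rw [LinearMap.mem_ker] at hf ⊢
      change T (π g f) = 0
      rw [h, show T f = 0 from hf, map_zero] with h | h
  · exact Or.inr fun x hx => (Submodule.eq_bot_iff _).1 h x hx
  · exact Or.inl (ContinuousLinearMap.ext fun x => by
      have : x ∈ LinearMap.ker T.toLinearMap := h ▸ Submodule.mem_top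
      exact this)

variable [CompleteSpace H]

lemma star_repCLM (π : G →* (H ≃ₗᵢ[ℂ] H)) (g : G) : star (repCLM π g) = repCLM π g⁻¹ := by
  rw [ContinuousLinearMap.star_eq_adjoint, eq_comm, ContinuousLinearMap.eq_adjoint_iff]
  intro x y
  change inner ℂ (π g⁻¹ x) y = inner ℂ x (π g y)
  rw [← (π g).inner_map_map, map_inv]
  congr 1
  exact (π g).apply_symm_apply x

lemma commute_star_repCLM {T : H →L[ℂ] H} (hT : ∀ g, Commute T (repCLM π g)) (g : G) :
    Commute (star T) (repCLM π g) := by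
  have h := (hT g⁻¹).star_star
  rwa [star_repCLM, inv_inv] at h

/-- Two spectral points would give, through functional calculus, two nonzero intertwiners with zero
product, but a nonzero intertwiner is injective. So the spectrum is one point and the operator is
scalar. -/
lemma exists_eq_smul_one_of_isSelfAdjoint (hπ : IsIrreducibleRep π) {T : H →L[ℂ] H}
    (hT : ∀ g, Commute T (repCLM π g)) (hs : IsSelfAdjoint T) :
    ∃ c : ℝ, T = algebraMap ℝ (H →L[ℂ] H) c := by
  have := hπ.1
  obtain ⟨a, ha⟩ := ContinuousFunctionalCalculus.spectrum_nonempty (R := ℝ) T hs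
  refine ⟨a, ?_⟩
  have key : ∀ b ∈ spectrum ℝ T, b = a := by
    intro b hb
    by_contra hba
    have hδ : 0 < |b - a| := abs_pos.2 (sub_ne_zero.2 hba)
    -- A tent of half-width `|b - a| / 2`: the tents at `a` and `b` have zero product, and each is
    -- positive at its centre.
    let bump : ℝ → ℝ → ℝ := fun c t => max 0 (|b - a| - 2 * |t - c|)
    have hcont : ∀ c, Continuous (bump c) := fun c => by fun_prop
    have hne : ∀ c ∈ spectrum ℝ T, cfc (bump c) T ≠ 0 := by
      intro c hc h0
      have h1 : bump c c ∈ spectrum ℝ (cfc (bump c) T) := by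
        rw [cfc_map_spectrum (bump c) T hs (hcont c).continuousOn]
        exact ⟨c, hc, rfl⟩
      rw [h0, spectrum.zero_eq] at h1
      have h2 : max 0 (|b - a| - 2 * |c - c|) = 0 := h1
      rw [sub_self, abs_zero, mul_zero, sub_zero, max_eq_right hδ.le] at h2
      exact hδ.ne' h2
    have hprod : cfc (bump a) T * cfc (bump b) T = 0 := by
      rw [← cfc_mul (bump a) (bump b) T (hcont a).continuousOn (hcont b).continuousOn,
        show (fun t => bump a t * bump b t) = fun _ => 0 from ?_, cfc_const_zero]
      funext t
      rcases le_total |b - a| (2 * |t - a|) with h | h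
      · rw [show bump a t = 0 from max_eq_left (by linarith), zero_mul]
      · have h3 : |b - a| ≤ |t - b| + |t - a| := by
          have := abs_sub_le b t a
          rwa [abs_sub_comm b t] at this
        rw [show bump b t = 0 from max_eq_left (by linarith), mul_zero]
    rcases eq_zero_or_injective_of_commute hπ fun g => (hT g).cfc_real (bump a) with h | h
    · exact hne a ha h
    · exact hne b hb (ContinuousLinearMap.ext fun x => h _ (DFunLike.congr_fun hprod x))
  calc T = cfc (fun t : ℝ => t) T := (cfc_id' ℝ T).symm
    _ = cfc (fun _ : ℝ => a) T := cfc_congr key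
    _ = algebraMap ℝ (H →L[ℂ] H) a := cfc_const a T

/-- Schur's lemma. -/
theorem exists_eq_smul_of_commute (hπ : IsIrreducibleRep π) {T : H →L[ℂ] H}
    (hT : ∀ g x, T (π g x) = π g (T x)) : ∃ c : ℂ, ∀ x, T x = c • x := by
  have hT' : ∀ g, Commute T (repCLM π g) := fun g => ContinuousLinearMap.ext (hT g)
  -- Adjoints of intertwiners intertwine, as `π` is unitary, so the self-adjoint parts reduce the
  -- claim to the previous case.
  have hre : ∀ g, Commute (realPart T : H →L[ℂ] H) (repCLM π g) := fun g => by
    rw [realPart_apply_coe]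
    exact ((hT' g).add_left (commute_star_repCLM hT' g)).smul_left _
  have him : ∀ g, Commute (imaginaryPart T : H →L[ℂ] H) (repCLM π g) := fun g => by
    rw [imaginaryPart_apply_coe]
    exact (((hT' g).sub_left (commute_star_repCLM hT' g)).smul_left _).smul_left _
  obtain ⟨a, ha⟩ := exists_eq_smul_one_of_isSelfAdjoint hπ hre (realPart T).2
  obtain ⟨b, hb⟩ := exists_eq_smul_one_of_isSelfAdjoint hπ him (imaginaryPart T).2
  refine ⟨a + Complex.I * b, fun x => ?_⟩
  have h := DFunLike.congr_fun (realPart_add_I_smul_imaginaryPart T) x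
  rw [ha, hb, Algebra.algebraMap_eq_smul_one, Algebra.algebraMap_eq_smul_one] at h
  rw [← h, add_smul, mul_smul]
  rfl

end Schur

/-! ### The reconstruction formula -/

section Linearity

variable {X Ξ : Type*}

lemma ridgelet_congr [MeasureSpace X] (ψ : X → Ξ → ℂ) {f f' : X → ℂ} (h : f =ᵐ[volume] f') :
    ridgelet ψ f = ridgelet ψ f' :=
  funext fun ξ => integral_congr_ae (by filter_upwards [h] with x hx; rw [hx])

lemma machine_congr [MeasureSpace Ξ] (φ : X → Ξ → ℂ) {γ γ' : Ξ → ℂ} (h : γ =ᵐ[volume] γ') :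
    machine φ γ = machine φ γ' :=
  funext fun x => integral_congr_ae (by filter_upwards [h] with ξ hξ; rw [hξ])

lemma ridgelet_smul [MeasureSpace X] (ψ : X → Ξ → ℂ) (c : ℂ) (f : X → ℂ) :
    ridgelet ψ (c • f) = c • ridgelet ψ f := by
  funext ξ
  simp only [ridgelet, Pi.smul_apply, smul_eq_mul, mul_assoc, integral_const_mul]

lemma machine_smul [MeasureSpace Ξ] (φ : X → Ξ → ℂ) (c : ℂ) (γ : Ξ → ℂ) :
    machine φ (c • γ) = c • machine φ γ := by
  funext x
  simp only [machine, Pi.smul_apply, smul_eq_mul, mul_assoc, integral_const_mul]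

variable [MeasureSpace X] [MeasureSpace Ξ]

lemma ridgelet_add {ψ : X → Ξ → ℂ} {f f' : X → ℂ}
    (hf : ∀ᵐ ξ : Ξ, Integrable fun x : X => f x * conj (ψ x ξ))
    (hf' : ∀ᵐ ξ : Ξ, Integrable fun x : X => f' x * conj (ψ x ξ)) :
    ridgelet ψ (f + f') =ᵐ[volume] ridgelet ψ f + ridgelet ψ f' := by
  filter_upwards [hf, hf'] with ξ h h'
  simp only [ridgelet, Pi.add_apply, add_mul]
  exact integral_add h h'

lemma ridgelet_add_smul_left {ψ ψ' : X → Ξ → ℂ} {f : X → ℂ}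
    (hf : ∀ᵐ ξ : Ξ, Integrable fun x : X => f x * conj (ψ x ξ))
    (hf' : ∀ᵐ ξ : Ξ, Integrable fun x : X => f x * conj (ψ' x ξ)) (a : ℂ) :
    ridgelet (ψ + a • ψ') f =ᵐ[volume] ridgelet ψ f + conj a • ridgelet ψ' f := by
  filter_upwards [hf, hf'] with ξ h h'
  simp only [ridgelet, Pi.add_apply, Pi.smul_apply, smul_eq_mul, ← integral_const_mul]
  rw [← integral_add h (h'.const_mul _)]
  refine integral_congr_ae (.of_forall fun x => ?_)
  simp only [map_add, map_mul]
  ring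

lemma machine_add_smul {φ : X → Ξ → ℂ} {γ γ' : Ξ → ℂ}
    (hγ : ∀ᵐ x : X, Integrable fun ξ : Ξ => γ ξ * φ x ξ)
    (hγ' : ∀ᵐ x : X, Integrable fun ξ : Ξ => γ' ξ * φ x ξ) (a : ℂ) :
    machine φ (γ + a • γ') =ᵐ[volume] machine φ γ + a • machine φ γ' := by
  filter_upwards [hγ, hγ'] with x h h'
  simp only [machine, Pi.add_apply, Pi.smul_apply, smul_eq_mul, ← integral_const_mul]
  rw [← integral_add h (h'.const_mul _)]
  refine integral_congr_ae (.of_forall fun ξ => ?_)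
  ring

lemma machine_add_smul_left {φ φ' : X → Ξ → ℂ} {γ : Ξ → ℂ}
    (h : ∀ᵐ x : X, Integrable fun ξ : Ξ => γ ξ * φ x ξ)
    (h' : ∀ᵐ x : X, Integrable fun ξ : Ξ => γ ξ * φ' x ξ) (a : ℂ) :
    machine (φ + a • φ') γ =ᵐ[volume] machine φ γ + a • machine φ' γ := by
  filter_upwards [h, h'] with x h h'
  simp only [machine, Pi.add_apply, Pi.smul_apply, smul_eq_mul, ← integral_const_mul]
  rw [← integral_add h (h'.const_mul _)]
  refine integral_congr_ae (.of_forall fun ξ => ?_)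
  ring

/-- The composite of machine and ridgelet transform, as a linear map on `D`. -/
def IsBoundedOn.toLinearMap {φ ψ : X → Ξ → ℂ} {D : Submodule ℂ (Lp ℂ 2 (volume : Measure X))}
    (h : IsBoundedOn φ ψ D) : D →ₗ[ℂ] Lp ℂ 2 (volume : Measure X) where
  toFun f := (h.memLp f f.2).toLp
  map_add' f f' := by
    rw [← MemLp.toLp_add]
    refine MemLp.toLp_congr _ _ ?_
    rw [Submodule.coe_add, ridgelet_congr ψ (Lp.coeFn_add f.1 f'.1), machine_congr φ
      (ridgelet_add (h.ridgelet_integrable f f.2) (h.ridgelet_integrable f' f'.2))]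
    simpa using machine_add_smul (h.machine_integrable f f.2) (h.machine_integrable f' f'.2) 1
  map_smul' c f := by
    rw [RingHom.id_apply, ← MemLp.toLp_const_smul]
    refine MemLp.toLp_congr _ _ ?_
    rw [Submodule.coe_smul, ridgelet_congr ψ (Lp.coeFn_smul c f.1), ridgelet_smul, machine_smul]

lemma IsBoundedOn.coeFn_toLinearMap {φ ψ : X → Ξ → ℂ}
    {D : Submodule ℂ (Lp ℂ 2 (volume : Measure X))} (h : IsBoundedOn φ ψ D) (f : D) :
    h.toLinearMap f =ᵐ[volume] machine φ (ridgelet ψ f) :=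
  MemLp.coeFn_toLp (h.memLp f f.2)

lemma IsBoundedOn.exists_extension {φ ψ : X → Ξ → ℂ}
    {D : Submodule ℂ (Lp ℂ 2 (volume : Measure X))} (h : IsBoundedOn φ ψ D)
    (hD : Dense (D : Set (Lp ℂ 2 (volume : Measure X)))) :
    ∃ T : Lp ℂ 2 (volume : Measure X) →L[ℂ] Lp ℂ 2 (volume : Measure X),
      ∀ f ∈ D, T f =ᵐ[volume] machine φ (ridgelet ψ f) := by
  obtain ⟨C, hC⟩ := h.bounded
  refine ⟨h.toLinearMap.extendOfNorm D.subtype, fun f hf => ?_⟩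
  have h1 := LinearMap.extendOfNorm_eq (f := h.toLinearMap) (e := D.subtype)
    (by simpa [DenseRange] using hD) ⟨C, fun f => ?_⟩ ⟨f, hf⟩
  · rw [show h.toLinearMap.extendOfNorm D.subtype f = h.toLinearMap ⟨f, hf⟩ from h1]
    exact h.coeFn_toLinearMap ⟨f, hf⟩
  · change ‖(h.memLp f f.2).toLp‖ ≤ C * ‖f.1‖
    rw [Lp.norm_toLp, Lp.norm_def]
    refine (ENNReal.toReal_mono (ENNReal.mul_ne_top ENNReal.coe_ne_top (Lp.eLpNorm_ne_top _))
      (hC f f.2)).trans_eq ?_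
    rw [ENNReal.toReal_mul, ENNReal.coe_toReal]

end Linearity

/-! ### Covariance of the composite operator and the reconstruction constant. -/

section Reconstruction

variable {m : ℕ}

/-- The three factors are the Jacobian of `g`, the unitary normalisation and the relative invariance
of `ψ`. -/
lemma ridgelet_pull {s : ℝ} {ψ : DataDom m → QuadParam m → ℂ} (hψ : IsRelInvariant m s ψ)
    (g : AffGroup m) (f : DataDom m → ℂ) :
    ridgelet ψ (g.pull f) = ((|g.L.det| * |g.L.det| ^ (-(1 / 2) : ℝ) * |g.L.det| ^ s : ℝ) : ℂ) •
      fun ξ => ridgelet ψ f (g⁻¹ • ξ) := by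
  funext ξ
  rw [Pi.smul_apply, smul_eq_mul, ridgelet, ridgelet, integral_smul_comp g, ← integral_const_mul,
    ← integral_const_mul]
  refine integral_congr_ae (.of_forall fun x => ?_)
  have h := hψ g x (g⁻¹ • ξ)
  rw [smul_inv_smul] at h
  simp only [AffGroup.pull, inv_smul_smul, h, map_mul, Complex.conj_ofReal, Complex.ofReal_mul]
  ring

lemma exists_machine_comp_smul (g : AffGroup m) : ∃ J : ℝ, 0 < J ∧
    ∀ (σ : ℝ → ℂ) (γ : QuadParam m → ℂ) (x : DataDom m),
      machine (quadFeature m σ) (fun ξ => γ (g⁻¹ • ξ)) x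
        = J * machine (quadFeature m σ) γ (g⁻¹ • x) := by
  obtain ⟨J, hJ, hmap⟩ := exists_map_smul_quadParam g⁻¹
  refine ⟨J, hJ, fun σ γ x => ?_⟩
  have h1 := (quadHomeo g⁻¹).measurableEmbedding.integral_map (μ := volume)
    fun ξ => γ ξ * quadFeature m σ (g⁻¹ • x) ξ
  rw [show Measure.map (quadHomeo g⁻¹) volume = _ from hmap, integral_smul_measure,
    ENNReal.toReal_ofReal hJ.le, Complex.real_smul] at h1
  rw [machine, machine, h1]
  refine integral_congr_ae (.of_forall fun ξ => ?_)
  change _ = γ (g⁻¹ • ξ) * quadFeature m σ (g⁻¹ • x) (g⁻¹ • ξ)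
  rw [isJointInvariant_quadFeature m σ]

/-- The composite is covariant only up to a positive multiplier, which depends on `s` and `g` alone;
the normalisation factor is reabsorbed into `pull`. -/
lemma exists_machine_ridgelet_pull (s : ℝ) (g : AffGroup m) : ∃ χ : ℝ, 0 < χ ∧
    ∀ (σ : ℝ → ℂ) (ψ : DataDom m → QuadParam m → ℂ), IsRelInvariant m s ψ →
      ∀ f : DataDom m → ℂ, machine (quadFeature m σ) (ridgelet ψ (g.pull f))
        = (χ : ℂ) • g.pull (machine (quadFeature m σ) (ridgelet ψ f)) := by
  obtain ⟨J, hJ, hmach⟩ := exists_machine_comp_smul g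
  have hd : 0 < |g.L.det| := abs_pos.2 g.det_L_ne_zero
  refine ⟨|g.L.det| * |g.L.det| ^ s * J, by positivity, fun σ ψ hψ f => ?_⟩
  rw [ridgelet_pull hψ, machine_smul]
  funext x
  rw [Pi.smul_apply, Pi.smul_apply, hmach, AffGroup.pull]
  simp only [smul_eq_mul, Complex.ofReal_mul]
  ring

/-- The composite of the network with the ridgelet transform is multiplication by `c` on `D`. -/
def IsReconstruction (D : Submodule ℂ (L2Space m)) (σ : ℝ → ℂ) (ψ : DataDom m → QuadParam m → ℂ)
    (c : ℂ) : Prop :=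
  ∀ f ∈ D, QNN σ (ridgelet ψ f) =ᵐ[volume] fun x => c * f x

variable {s : ℝ} {D : Submodule ℂ (L2Space m)} {σ σ' : ℝ → ℂ} {ψ ψ' : DataDom m → QuadParam m → ℂ}

lemma exists_isReconstruction (hD : Dense (D : Set (L2Space m)))
    (hinv : IsInvariantSubspace (regularRep m) D) (hψ : IsRelInvariant m s ψ)
    (hb : IsBoundedOn (quadFeature m σ) ψ D) : ∃ c, IsReconstruction D σ ψ c := by
  obtain ⟨T, hT⟩ := hb.exists_extension hD
  suffices h : ∃ c : ℂ, ∀ f, T f = c • f by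
    obtain ⟨c, hc⟩ := h
    refine ⟨c, fun f hf => (hT f hf).symm.trans ?_⟩
    rw [hc f]
    exact Lp.coeFn_smul c f
  have hcov : ∀ g : AffGroup m, ∃ χ : ℝ, 0 < χ ∧
      ∀ f, T (regularRep m g f) = (χ : ℂ) • regularRep m g (T f) := by
    intro g
    obtain ⟨χ, hχ, h⟩ := exists_machine_ridgelet_pull s g
    refine ⟨χ, hχ, fun f => ?_⟩
    refine congrFun (Continuous.ext_on hD (f := fun f => T (regularRep m g f))
      (g := fun f => (χ : ℂ) • regularRep m g (T f)) (by fun_prop) (by fun_prop)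
      fun f hf => Lp.ext ?_) f
    refine (hT _ (hinv g f hf)).trans ?_
    rw [ridgelet_congr ψ (coeFn_regularRep g f), h σ ψ hψ]
    filter_upwards [Lp.coeFn_smul (χ : ℂ) (regularRep m g (T f)), coeFn_regularRep g (T f),
      g.pull_congr (hT f hf)] with x h1 h2 h3
    rw [h1, Pi.smul_apply, Pi.smul_apply, h2, h3]
  -- Schur's lemma covers the commuting case. Otherwise some multiplier differs from one, and since
  -- `π_g` is isometric, `‖T‖ = χ ‖T‖` forces `T = 0`.
  by_cases hone : ∀ g f, T (regularRep m g f) = regularRep m g (T f)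
  · exact exists_eq_smul_of_commute (isIrreducibleRep_regularRep m) hone
  · push Not at hone
    obtain ⟨g, f₀, hne⟩ := hone
    obtain ⟨χ, hχ, h⟩ := hcov g
    have hχ1 : χ ≠ 1 := by
      rintro rfl
      exact hne (by simpa using h f₀)
    have hnorm : ‖T‖ = χ * ‖T‖ := by
      have h1 : T.comp (repCLM (regularRep m) g) = (χ : ℂ) • (repCLM (regularRep m) g).comp T :=
        ContinuousLinearMap.ext h
      calc ‖T‖ = ‖T.comp (repCLM (regularRep m) g)‖ :=
            (T.opNorm_comp_linearIsometryEquiv (regularRep m g)).symm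
        _ = ‖(χ : ℂ)‖ * ‖(repCLM (regularRep m) g).comp T‖ := by rw [h1, norm_smul]
        _ = χ * ‖T‖ := by
            rw [Complex.norm_real, Real.norm_of_nonneg hχ.le]
            congr 1
            exact (regularRep m g).toLinearIsometry.norm_toContinuousLinearMap_comp
    have hT0 : ‖T‖ = 0 := by
      have h2 : (χ - 1) * ‖T‖ = 0 := by linarith
      exact (mul_eq_zero.1 h2).resolve_left (sub_ne_zero.2 hχ1)
    exact ⟨0, fun f => by rw [norm_eq_zero.1 hT0, zero_smul, _root_.zero_apply]⟩

/-- A dense subspace of a nonzero space has a nonzero element, which determines the constant.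
Linearity of the chosen constants follows from this. -/
lemma IsReconstruction.unique (hD : Dense (D : Set (L2Space m))) {c c' : ℂ}
    (h : IsReconstruction D σ ψ c) (h' : IsReconstruction D σ ψ c') : c = c' := by
  have := (isIrreducibleRep_regularRep m).1
  obtain ⟨f, hf, hf0⟩ : ∃ f ∈ D, f ≠ 0 := by
    rw [← Submodule.ne_bot_iff]
    rintro rfl
    obtain ⟨u, hu⟩ := exists_ne (0 : L2Space m)
    have h1 : u ∈ closure ((⊥ : Submodule ℂ (L2Space m)) : Set (L2Space m)) := hD u
    rw [Submodule.bot_coe, closure_singleton] at h1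
    exact hu h1
  by_contra hne
  refine hf0 ((Lp.eq_zero_iff_ae_eq_zero).2 ?_)
  filter_upwards [h f hf, h' f hf] with x h1 h2
  have h3 : (c - c') * f x = 0 := by rw [sub_mul, ← h1, ← h2, sub_self]
  exact (mul_eq_zero.1 h3).resolve_left (sub_ne_zero.2 hne)

lemma IsReconstruction.add_smul_left {c c' : ℂ} (h : IsReconstruction D σ ψ c)
    (h' : IsReconstruction D σ' ψ c') (hb : IsBoundedOn (quadFeature m σ) ψ D)
    (hb' : IsBoundedOn (quadFeature m σ') ψ D) (a : ℂ) :
    IsReconstruction D (σ + a • σ') ψ (c + a * c') := fun f hf => by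
  filter_upwards [h f hf, h' f hf, machine_add_smul_left (hb.machine_integrable f hf)
    (hb'.machine_integrable f hf) a] with x h1 h2 h3
  refine h3.trans ?_
  rw [QNN] at h1 h2
  rw [Pi.add_apply, Pi.smul_apply, h1, h2, smul_eq_mul]
  ring

lemma IsReconstruction.add_smul_right {c c' : ℂ} (h : IsReconstruction D σ ψ c)
    (h' : IsReconstruction D σ ψ' c') (hb : IsBoundedOn (quadFeature m σ) ψ D)
    (hb' : IsBoundedOn (quadFeature m σ) ψ' D) (a : ℂ) :
    IsReconstruction D σ (ψ + a • ψ') (c + conj a * c') := fun f hf => by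
  filter_upwards [h f hf, h' f hf, machine_add_smul (hb.machine_integrable f hf)
    (hb'.machine_integrable f hf) (conj a)] with x h1 h2 h3
  rw [QNN, machine_congr _ (ridgelet_add_smul_left (hb.ridgelet_integrable f hf)
    (hb'.ridgelet_integrable f hf) a), h3]
  rw [QNN] at h1 h2
  rw [Pi.add_apply, Pi.smul_apply, h1, h2, smul_eq_mul]
  ring

theorem exists_reconstruction_form (s : ℝ) (D : Submodule ℂ (L2Space m))
    (hD : Dense (D : Set (L2Space m))) (hinv : IsInvariantSubspace (regularRep m) D) :
    ∃ B : (ℝ → ℂ) → (DataDom m → QuadParam m → ℂ) → ℂ,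
      (∀ σ ψ, IsRelInvariant m s ψ → IsBoundedOn (quadFeature m σ) ψ D →
        ∀ f ∈ D, QNN σ (ridgelet ψ f) =ᵐ[volume] fun x => B σ ψ * f x) ∧
      (∀ σ σ' ψ, IsRelInvariant m s ψ → IsBoundedOn (quadFeature m σ) ψ D →
        IsBoundedOn (quadFeature m σ') ψ D → ∀ a : ℂ,
        B (σ + a • σ') ψ = B σ ψ + a * B σ' ψ) ∧
      (∀ σ ψ ψ', IsRelInvariant m s ψ → IsRelInvariant m s ψ' →
        IsBoundedOn (quadFeature m σ) ψ D → IsBoundedOn (quadFeature m σ) ψ' D → ∀ a : ℂ,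
        B σ (ψ + a • ψ') = B σ ψ + conj a * B σ ψ') := by
  -- The choice is made for all pairs, with a junk value where no constant exists. A linear
  -- combination need not be shown admissible: the combined constant itself witnesses existence.
  have hB : ∀ {σ ψ}, IsRelInvariant m s ψ → IsBoundedOn (quadFeature m σ) ψ D →
      IsReconstruction D σ ψ (Classical.epsilon (IsReconstruction D σ ψ)) := fun hψ hb =>
    Classical.epsilon_spec (exists_isReconstruction hD hinv hψ hb)
  refine ⟨fun σ ψ => Classical.epsilon (IsReconstruction D σ ψ), fun σ ψ hψ hb => hB hψ hb,
    fun σ σ' ψ hψ hb hb' a => ?_, fun σ ψ ψ' hψ hψ' hb hb' a => ?_⟩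
  · have h := (hB hψ hb).add_smul_left (hB hψ hb') hb hb' a
    exact (Classical.epsilon_spec ⟨_, h⟩ : IsReconstruction D _ _ _).unique hD h
  · have h := (hB hψ hb).add_smul_right (hB hψ' hb') hb hb' a
    exact (Classical.epsilon_spec ⟨_, h⟩ : IsReconstruction D _ _ _).unique hD h

end Reconstruction

end

theorem mainTheorem5 (m : ℕ) :
    -- joint invariance of the quadratic feature map, for an arbitrary function `σ`
    (∀ σ : ℝ → ℂ, IsJointInvariant (AffGroup m) (quadFeature m σ)) ∧
    -- irreducibility of the regular representation of `Aff(m)` on `L²(ℝ^m)`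
    IsIrreducibleRep (regularRep m) ∧
    -- reconstruction formula, for arbitrary `σ` and jointly invariant (`s = 0`) or, more generally,
    -- relatively invariant `ψ`, with a constant `B σ ψ` that is linear in `σ` and conjugate-linear
    -- in `ψ`
    (∀ (s : ℝ) (D : Submodule ℂ (L2Space m)), Dense (D : Set (L2Space m)) →
      IsInvariantSubspace (regularRep m) D →
      ∃ B : (ℝ → ℂ) → (DataDom m → QuadParam m → ℂ) → ℂ,
        (∀ σ ψ, IsRelInvariant m s ψ → IsBoundedOn (quadFeature m σ) ψ D →
          ∀ f ∈ D, QNN σ (ridgelet ψ f) =ᵐ[volume] fun x => B σ ψ * f x) ∧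
        (∀ σ σ' ψ, IsRelInvariant m s ψ → IsBoundedOn (quadFeature m σ) ψ D →
          IsBoundedOn (quadFeature m σ') ψ D → ∀ a : ℂ,
          B (σ + a • σ') ψ = B σ ψ + a * B σ' ψ) ∧
        (∀ σ ψ ψ', IsRelInvariant m s ψ → IsRelInvariant m s ψ' →
          IsBoundedOn (quadFeature m σ) ψ D → IsBoundedOn (quadFeature m σ) ψ' D → ∀ a : ℂ,
          B σ (ψ + a • ψ') = B σ ψ + conj a * B σ ψ')) ∧
    -- for tempered non-polynomial `σ`: a ridgelet transform that is a right inverse of the network,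
    -- and universality in `L²(ℝ^m)`
    (∀ σ : ℝ → ℂ, IsTemperedFun σ → ¬ IsAEPolynomial σ →
      (∃ (η : SymMat m → ℝ) (ρ : 𝓢(ℝ, ℂ)), Continuous η ∧ HasCompactSupport η ∧
        ∀ f : 𝓢(DataDom m, ℂ),
          (∀ ξ, Integrable fun x => f x * conj (windowedFeature η ρ x ξ)) ∧
          MemLp (ridgelet (windowedFeature η ρ) f) 2 (volume : Measure (QuadParam m)) ∧
          (∀ x, Integrable fun ξ =>
            ridgelet (windowedFeature η ρ) f ξ * quadFeature m σ x ξ) ∧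
          ∀ x, QNN σ (ridgelet (windowedFeature η ρ) f) x = f x) ∧
      (∀ (f : L2Space m) (ε : ℝ), 0 < ε →
        ∃ γ : QuadParam m → ℂ, MemLp γ 2 volume ∧
          (∀ x, Integrable fun ξ => γ ξ * quadFeature m σ x ξ) ∧
          MemLp (QNN σ γ) 2 (volume : Measure (DataDom m)) ∧
          eLpNorm (fun x => QNN σ γ x - f x) 2 volume < ENNReal.ofReal ε)) := by
  exact ⟨isJointInvariant_quadFeature m, isIrreducibleRep_regularRep m, exists_reconstruction_form,
    fun σ hσ hp => ⟨exists_ridgelet_rightInverse hσ hp,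
      fun f ε hε => exists_universal hσ hp f hε⟩⟩
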